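/- Work in classical many-sorted first-order logic over the finite types generated from $0$ (natural numbers) by $(\sigma,\tau)\mapsto(\sigma\to\tau)$; write $1=0\to0$, $2=1\to0$, $3=2\to 0$. The language has $0,1,+,\times,<,=$ at type $0$, the combinators $\Pi,\Sigma$ and recursors $\mathbf R_\sigma$; equality at higher types is defined pointwise from equality at type $0$. The theory $\mathsf{RCA}_0^\omega$ consists of: the axioms of an ordered semi-ring with equality at type $0$; the axioms for $\Pi$ and $\Sigma$; the defining axiom of $\mathbf R_0$; extensionality $x=_\rho y\to\varphi(x)=_\tau\varphi(y)$ for all types; induction for quantifier-free formulas; and $\mathsf{QF\text{-}AC}^{1,0}$. Here $\mathsf{QF\text{-}AC}^{\sigma,\tau}$ is the schema $(\forall x^\sigma)(\exists y^\tau)A(x,y)\to(\exists Y^{\sigma\to\tau})(\forall x^\sigma)A(x,Y(x))$ for quantifier-free $A$ (variables of all types allowed as parameters). The theory $\mathsf{ACA}_0^\omega$ is $\mathsf{RCA}_0^\omega$ plus the axiom $(\mu^2)$: there is $\mu^2$ such that for all $f^1$, $\mu(f)$ is the least zero of $f$ if $f$ has a zero, and $\mu(f)=0$ otherwise. Let $C=\{f^1: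 f\le_1 1\}$ be Cantor space, let $\overline f n=\langle f(0),\dots,f(n-1)\rangle$, and write $g\in[\overline f n]$ if $g(m)=f(m)$ for all $m<n$. For $F^2,G^2$ let $$\mathsf{LOC}(F,G)\equiv(\forall f,g\in C)\big[g\in[\overline fG(f)]\to F(g)\le G(f)\big].$$ Consider the following sentences. - $\mathsf{PIT_u}$: $(\forall G^2)(\exists N^0)(\forall F^2)\big[\mathsf{LOC}(F,G)\to(\forall g\in C)(F(g)\le N)\big]$. - $\mathsf{HBU_c}$: $(\forall G^2)(\exists\langle f_1,\dots,f_k\rangle)(\forall f\in C)(\exists i\le k)\big(f\in[\overline{f_i}G(f_i)]\big)$, where the $f_i$ have type $1$. - $\mathsf{HBU}$: for every $\Psi:\mathbb R\to\mathbb R^+$ there is a finite sequence $\langle y_1,\dots,y_k\rangle$ of reals such that every $x\in[0,1]$ lies in $(y_i-\Psi(y_i),y_i+\Psi(y_i))$ for some $i\le k$. Here reals are sequences of (codes of) rationals with $|q_n-q_{n+i}|<2^{-n}$ for all $n,i$; $q=_{\mathbb R}r$ means $|q_n-r_n|\le2^{-n+1}$ for all $n$, and $q<_{\mathbb R}r$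 means $q_n+2^{-n+1}<r_n$ for some $n$; and $\Psi$ is an object of type $1\to1$ that maps reals to positive reals and equal reals to equal reals. - $(\exists\Theta)\mathsf{SCF}(\Theta)$: there is a functional $\Theta$ that maps each $G^2$ to a finite sequence $\Theta(G)$ of type $1$ objects such that $(\forall G^2)(\forall f\in C)(\exists g\in\Theta(G))(f\in[\overline gG(g)])$. - $(\exists M)\mathsf{PR}(M)$: there is $M^3$ such that $(\forall F^2,G^2)\big[\mathsf{LOC}(F,G)\to(\forall g\in C)(F(g)\le M(G))\big]$. Then: 1. $\mathsf{RCA}_0^\omega+\mathsf{QF\text{-}AC}^{0,1}$ proves $\mathsf{PIT_u}\leftrightarrow\mathsf{HBU_c}\leftrightarrow\mathsf{HBU}$. 2. $\mathsf{ACA}_0^\omega+\mathsf{QF\text{-}AC}^{2,1}$ proves $\mathsf{HBU_c}\leftrightarrow\mathsf{HBU}\leftrightarrow(\exists\Theta)\mathsf{SCF}(\Theta)\leftrightarrow\mathsf{PIT_u}\leftrightarrow(\exists M)\mathsf{PR}(M)$. -/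

import Mathlib

/-! Many-sorted classical logic over all finite types, the systems of higher-order reverse
mathematics, and the principles compared in the theorem. -/

namespace HOA

/-! ### Finite types, terms, formulas -/

/-- The finite types: `nat` is the type `0`. -/
inductive Ty : Type
  | nat : Ty
  | arr : Ty → Ty → Ty

infixr:70 " ⇾ " => Ty.arr

abbrev T0 : Ty := Ty.nat
abbrev T1 : Ty := T0 ⇾ T0
abbrev T2 : Ty := T1 ⇾ T0
abbrev T3 : Ty := T2 ⇾ T0

/-- Contexts: the types of the free variables, the most recently bound one first. -/
abbrev Ctx : Type := List Ty

/-- `Var Γ ρ`: the variables of type `ρ` in the context `Γ` (typed de Bruijn indices). -/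
inductive Var : Ctx → Ty → Type
  | zero {Γ : Ctx} {ρ : Ty} : Var (ρ :: Γ) ρ
  | succ {Γ : Ctx} {ρ τ : Ty} : Var Γ ρ → Var (τ :: Γ) ρ

/-- Terms over a family `K` of typed constants. -/
inductive Tm (K : Ty → Type) (Γ : Ctx) : Ty → Type
  | var {ρ : Ty} : Var Γ ρ → Tm K Γ ρ
  | const {ρ : Ty} : K ρ → Tm K Γ ρ
  | app {ρ τ : Ty} : Tm K Γ (ρ ⇾ τ) → Tm K Γ ρ → Tm K Γ τ

infixl:100 " ⬝ " => Tm.app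

/-- Formulas. The prime formulas are `s =₀ t` and `s <₀ t`; the remaining connectives and the
existential quantifier are defined classically below. -/
inductive Fm (K : Ty → Type) : Ctx → Type
  | eq {Γ : Ctx} : Tm K Γ T0 → Tm K Γ T0 → Fm K Γ
  | lt {Γ : Ctx} : Tm K Γ T0 → Tm K Γ T0 → Fm K Γ
  | bot {Γ : Ctx} : Fm K Γ
  | imp {Γ : Ctx} : Fm K Γ → Fm K Γ → Fm K Γ
  | all {Γ : Ctx} (ρ : Ty) : Fm K (ρ :: Γ) → Fm K Γ

infix:65 " =₀ " => Fm.eq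
infix:65 " <₀ " => Fm.lt
infixr:30 " →ᶠ " => Fm.imp

section Substitution

variable {K : Ty → Type} {Γ Δ : Ctx} {ρ τ : Ty}

/-- Renamings of variables. -/
abbrev Ren (Γ Δ : Ctx) : Type := ∀ ρ : Ty, Var Γ ρ → Var Δ ρ

/-- Simultaneous substitutions of terms for variables. -/
abbrev Sub (K : Ty → Type) (Γ Δ : Ctx) : Type := ∀ ρ : Ty, Var Γ ρ → Tm K Δ ρ

def Tm.rename (r : Ren Γ Δ) : ∀ {ρ : Ty}, Tm K Γ ρ → Tm K Δ ρ
  | _, .var x => .var (r _ x)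
  | _, .const c => .const c
  | _, .app s t => .app (s.rename r) (t.rename r)

/-- Weakening by one fresh variable. -/
def Tm.wk (t : Tm K Γ ρ) : Tm K (τ :: Γ) ρ := t.rename fun _ x => x.succ

def Tm.subst (s : Sub K Γ Δ) : ∀ {ρ : Ty}, Tm K Γ ρ → Tm K Δ ρ
  | _, .var x => s _ x
  | _, .const c => .const c
  | _, .app t u => .app (t.subst s) (u.subst s)

/-- The substitution that sends variable `0` to `t` and continues as `s`. -/
def Sub.cons (t : Tm K Δ ρ) (s : Sub K Γ Δ) : Sub K (ρ :: Γ) Δ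
  | _, .zero => t
  | _, .succ x => s _ x

/-- A substitution carried under a binder. -/
def Sub.lift (s : Sub K Γ Δ) : Sub K (ρ :: Γ) (ρ :: Δ) :=
  Sub.cons (.var .zero) fun _ x => (s _ x).wk

def Fm.subst : ∀ {Γ Δ : Ctx}, Sub K Γ Δ → Fm K Γ → Fm K Δ
  | _, _, s, .eq t u => .eq (t.subst s) (u.subst s)
  | _, _, s, .lt t u => .lt (t.subst s) (u.subst s)
  | _, _, _, .bot => .bot
  | _, _, s, .imp A B => .imp (A.subst s) (B.subst s)
  | _, _, s, .all ρ A => .all ρ (A.subst s.lift)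

/-- Weakening of a formula by one fresh variable. -/
def Fm.wk (A : Fm K Γ) : Fm K (τ :: Γ) := A.subst fun _ x => .var x.succ

/-- `A.inst t` is `A(t)`: the term `t` is substituted for variable `0`. -/
def Fm.inst (A : Fm K (ρ :: Γ)) (t : Tm K Γ ρ) : Fm K Γ :=
  A.subst (Sub.cons t fun _ x => .var x)

/-- The substitution from the empty context. -/
def Sub.empty : Sub K [] Γ := fun _ x => nomatch x

/-- A sentence, considered in the context `Γ`. -/
def Fm.ofSentence (A : Fm K []) : Fm K Γ := A.subst Sub.empty

/-- Universal closure. -/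
def Fm.close : ∀ {Γ : Ctx}, Fm K Γ → Fm K []
  | [], A => A
  | ρ :: _, A => Fm.close (.all ρ A)

/-- Quantifier-free formulas (with variables of any type). -/
def Fm.QF : ∀ {Γ : Ctx}, Fm K Γ → Prop
  | _, .eq _ _ => True
  | _, .lt _ _ => True
  | _, .bot => True
  | _, .imp A B => A.QF ∧ B.QF
  | _, .all _ _ => False

def Fm.neg (A : Fm K Γ) : Fm K Γ := A →ᶠ .bot
def Fm.and (A B : Fm K Γ) : Fm K Γ := (A →ᶠ B.neg).neg
def Fm.or (A B : Fm K Γ) : Fm K Γ := A.neg →ᶠ B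
def Fm.iff (A B : Fm K Γ) : Fm K Γ := (A →ᶠ B).and (B →ᶠ A)
def Fm.ex (ρ : Ty) (A : Fm K (ρ :: Γ)) : Fm K Γ := (Fm.all ρ A.neg).neg

/-- The most recently bound variables: `v0` is the innermost one. -/
def v0 {a : Ty} : Tm K (a :: Γ) a := .var .zero
def v1 {a b : Ty} : Tm K (b :: a :: Γ) a := .var (.succ .zero)
def v2 {a b c : Ty} : Tm K (c :: b :: a :: Γ) a := .var (.succ (.succ .zero))

end Substitution

prefix:max "¬ᶠ " => Fm.neg
infixr:35 " ∧ᶠ " => Fm.and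
infixr:33 " ∨ᶠ " => Fm.or
infix:25 " ↔ᶠ " => Fm.iff

/-! ### Derivability: natural deduction for classical many-sorted logic -/

/-- `Prov T H A`: the formula `A` is derivable from the axioms `T` and the hypotheses `H`; all
of `H` and `A` live in the same context of free variables. -/
inductive Prov {K : Ty → Type} (T : Set (Fm K [])) :
    ∀ {Γ : Ctx}, List (Fm K Γ) → Fm K Γ → Prop
  | ax {Γ : Ctx} {H : List (Fm K Γ)} {A : Fm K []} : A ∈ T → Prov T H A.ofSentence
  | hyp {Γ : Ctx} {H : List (Fm K Γ)} {A : Fm K Γ} : A ∈ H → Prov T H A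
  | impI {Γ : Ctx} {H : List (Fm K Γ)} {A B : Fm K Γ} : Prov T (A :: H) B → Prov T H (A →ᶠ B)
  | impE {Γ : Ctx} {H : List (Fm K Γ)} {A B : Fm K Γ} :
      Prov T H (A →ᶠ B) → Prov T H A → Prov T H B
  | raa {Γ : Ctx} {H : List (Fm K Γ)} {A : Fm K Γ} : Prov T (A.neg :: H) .bot → Prov T H A
  | allI {Γ : Ctx} {H : List (Fm K Γ)} {ρ : Ty} {A : Fm K (ρ :: Γ)} :
      Prov T (H.map Fm.wk) A → Prov T H (.all ρ A)
  | allE {Γ : Ctx} {H : List (Fm K Γ)} {ρ : Ty} {A : Fm K (ρ :: Γ)} (t : Tm K Γ ρ) :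
      Prov T H (.all ρ A) → Prov T H (A.inst t)

/-- The theory `T` proves the sentence `A`. -/
def Proves {K : Ty → Type} (T : Set (Fm K [])) (A : Fm K []) : Prop := Prov T [] A

infix:20 " ⊢ᶠ " => Proves

/-! ### The language of higher-order arithmetic -/

/-- The constants: `0`, `1`, `+`, `×`, the combinators `Π` and `Σ`, and the recursors. -/
inductive LConst : Ty → Type
  | zero : LConst T0
  | one : LConst T0
  | add : LConst (T0 ⇾ T0 ⇾ T0)
  | mul : LConst (T0 ⇾ T0 ⇾ T0)
  | combK (ρ τ : Ty) : LConst (ρ ⇾ τ ⇾ ρ)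
  | combS (ρ σ τ : Ty) : LConst ((ρ ⇾ σ ⇾ τ) ⇾ (ρ ⇾ σ) ⇾ ρ ⇾ τ)
  | recursor (σ : Ty) : LConst ((T0 ⇾ σ ⇾ σ) ⇾ σ ⇾ T0 ⇾ σ)

abbrev Term (Γ : Ctx) (ρ : Ty) : Type := Tm LConst Γ ρ
abbrev Formula (Γ : Ctx) : Type := Fm LConst Γ
abbrev Sentence : Type := Fm LConst []

section Language

variable {Γ : Ctx}

def tZero : Term Γ T0 := .const .zero
def tOne : Term Γ T0 := .const .one
def tAdd (s t : Term Γ T0) : Term Γ T0 := .const .add ⬝ s ⬝ t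
def tMul (s t : Term Γ T0) : Term Γ T0 := .const .mul ⬝ s ⬝ t

end Language

infixl:75 " +₀ " => tAdd
infixl:80 " *₀ " => tMul

section Language

variable {Γ : Ctx}

def tTwo : Term Γ T0 := tOne +₀ tOne

/-- `2 ^ n`, by primitive recursion: `R₀ (λ k r, 2 * r) 1 n`. -/
def tPowTwo (n : Term Γ T0) : Term Γ T0 :=
  .const (.recursor T0) ⬝ (.const (.combK T1 T0) ⬝ (.const .mul ⬝ tTwo)) ⬝ tOne ⬝ n

def leF (s t : Term Γ T0) : Formula Γ := s <₀ t ∨ᶠ s =₀ t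

/-- Equality at an arbitrary finite type, reduced to equality at type `0`. -/
def eqAt : ∀ {Γ : Ctx} (τ : Ty), Term Γ τ → Term Γ τ → Formula Γ
  | _, .nat, s, t => s =₀ t
  | _, .arr σ τ, s, t => .all σ (eqAt τ (s.wk ⬝ v0) (t.wk ⬝ v0))

/-- `∃ i < k, A(i)`. -/
def exBelow (k : Term Γ T0) (A : Formula (T0 :: Γ)) : Formula Γ := .ex T0 (v0 <₀ k.wk ∧ᶠ A)

/-- `∀ i < k, A(i)`. -/
def allBelow (k : Term Γ T0) (A : Formula (T0 :: Γ)) : Formula Γ := .all T0 (v0 <₀ k.wk →ᶠ A)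

end Language

infix:65 " ⩽₀ " => leF

/-! ### The axioms -/

/-- The axioms of a (discretely) ordered semi-ring with equality, in the variables `v2, v1, v0`. -/
def semiringAxioms : List (Formula [T0, T0, T0]) :=
  [ v0 =₀ v0,
    v0 =₀ v1 →ᶠ v1 =₀ v0,
    v0 =₀ v1 →ᶠ v1 =₀ v2 →ᶠ v0 =₀ v2,
    v0 =₀ v1 →ᶠ v0 <₀ v2 →ᶠ v1 <₀ v2,
    v0 =₀ v1 →ᶠ v2 <₀ v0 →ᶠ v2 <₀ v1,
    v0 +₀ v1 +₀ v2 =₀ v0 +₀ (v1 +₀ v2),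
    v0 +₀ v1 =₀ v1 +₀ v0,
    v0 +₀ tZero =₀ v0,
    v0 *₀ v1 *₀ v2 =₀ v0 *₀ (v1 *₀ v2),
    v0 *₀ v1 =₀ v1 *₀ v0,
    v0 *₀ tOne =₀ v0,
    v0 *₀ tZero =₀ tZero,
    v0 *₀ (v1 +₀ v2) =₀ v0 *₀ v1 +₀ v0 *₀ v2,
    ¬ᶠ (v0 <₀ v0),
    v0 <₀ v1 →ᶠ v1 <₀ v2 →ᶠ v0 <₀ v2,
    v0 <₀ v1 ∨ᶠ v0 =₀ v1 ∨ᶠ v1 <₀ v0,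
    v0 <₀ v1 →ᶠ v0 +₀ v2 <₀ v1 +₀ v2,
    v0 <₀ v1 →ᶠ tZero <₀ v2 →ᶠ v0 *₀ v2 <₀ v1 *₀ v2,
    tZero ⩽₀ v0,
    v0 <₀ v1 ↔ᶠ v0 +₀ tOne ⩽₀ v1 ]

/-- The instance of induction for `A(n)`, where `n` is variable `0`. -/
def inductionFor {Γ : Ctx} (A : Formula (T0 :: Γ)) : Formula Γ :=
  A.inst tZero →ᶠ
    .all T0 (A →ᶠ A.subst (Sub.cons (v0 +₀ tOne) fun _ x => .var x.succ)) →ᶠ .all T0 A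

/-- The instance of choice for `A(x, y)`, where `y` is variable `0` and `x` is variable `1`:
`(∀ x ∃ y, A(x, y)) → ∃ Y ∀ x, A(x, Y x)`. -/
def choiceFor {Γ : Ctx} {σ τ : Ty} (A : Formula (τ :: σ :: Γ)) : Formula Γ :=
  .all σ (.ex τ A) →ᶠ
    .ex (σ ⇾ τ) (.all σ
      (A.subst (Sub.cons (v1 ⬝ v0) (Sub.cons v0 fun _ x => .var x.succ.succ))))

/-- Quantifier-free choice `QF-AC^{σ,τ}`, with parameters of arbitrary types. -/
def QFAC (σ τ : Ty) : Set Sentence :=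
  {φ | ∃ (Γ : Ctx) (A : Formula (τ :: σ :: Γ)), A.QF ∧ φ = (choiceFor A).close}

/-- The axioms of `RCA₀^ω`. -/
inductive RCAAxiom : Sentence → Prop
  | semiring {A : Formula [T0, T0, T0]} : A ∈ semiringAxioms → RCAAxiom A.close
  /-- `Π x y = x` -/
  | combK (ρ τ : Ty) :
      RCAAxiom (Fm.close (Γ := [τ, ρ]) (eqAt ρ (.const (.combK ρ τ) ⬝ v1 ⬝ v0) v1))
  /-- `Σ x y z = x z (y z)` -/
  | combS (ρ σ τ : Ty) :
      RCAAxiom (Fm.close (Γ := [ρ, ρ ⇾ σ, ρ ⇾ σ ⇾ τ])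
        (eqAt τ (.const (.combS ρ σ τ) ⬝ v2 ⬝ v1 ⬝ v0) (v2 ⬝ v0 ⬝ (v1 ⬝ v0))))
  /-- `R₀ f m 0 = m` -/
  | rec_zero :
      RCAAxiom (Fm.close (Γ := [T0, T0 ⇾ T0 ⇾ T0])
        (.const (.recursor T0) ⬝ v1 ⬝ v0 ⬝ tZero =₀ v0))
  /-- `R₀ f m (n + 1) = f n (R₀ f m n)` -/
  | rec_succ :
      RCAAxiom (Fm.close (Γ := [T0, T0, T0 ⇾ T0 ⇾ T0])
        (.const (.recursor T0) ⬝ v2 ⬝ v1 ⬝ (v0 +₀ tOne) =₀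
          v2 ⬝ v0 ⬝ (.const (.recursor T0) ⬝ v2 ⬝ v1 ⬝ v0)))
  /-- `x = y → φ x = φ y` -/
  | ext (ρ τ : Ty) :
      RCAAxiom (Fm.close (Γ := [ρ ⇾ τ, ρ, ρ])
        (eqAt ρ v2 v1 →ᶠ eqAt τ (v0 ⬝ v2) (v0 ⬝ v1)))
  | induction {Γ : Ctx} (A : Formula (T0 :: Γ)) : A.QF → RCAAxiom (inductionFor A).close
  | qfac {φ : Sentence} : φ ∈ QFAC T1 T0 → RCAAxiom φ

/-- The base theory `RCA₀^ω`. -/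
def RCA : Set Sentence := {φ | RCAAxiom φ}

/-- The axiom `(μ²)`: for some `μ` and all `f`, if `f` has a zero, then `μ f` is the least zero
of `f`; if `f` has no zero, then `μ f = 0`. -/
def muAxiom : Sentence :=
  .ex T2 (.all T1
    ((.ex T0 (v1 ⬝ v0 =₀ tZero) →ᶠ
        (v0 ⬝ (v1 ⬝ v0) =₀ tZero) ∧ᶠ allBelow (v1 ⬝ v0) (¬ᶠ (v1 ⬝ v0 =₀ tZero))) ∧ᶠ
      (.all T0 (¬ᶠ (v1 ⬝ v0 =₀ tZero)) →ᶠ v1 ⬝ v0 =₀ tZero)))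

/-- `ACA₀^ω`, that is, `RCA₀^ω` with `(μ²)`. -/
def ACA : Set Sentence := RCA ∪ {muAxiom}

/-! ### Principles on Cantor space -/

section Cantor

variable {Γ : Ctx}

/-- `f ∈ C`: the function `f` is a binary sequence. -/
def inCantor (f : Term Γ T1) : Formula Γ := .all T0 (f.wk ⬝ v0 ⩽₀ tOne)

/-- `g ∈ [f̄ n]`: the functions `f` and `g` agree below `n`. -/
def inNbhd (g f : Term Γ T1) (n : Term Γ T0) : Formula Γ :=
  allBelow n (g.wk ⬝ v0 =₀ f.wk ⬝ v0)

/-- `LOC(F, G)`: for `f, g ∈ C` with `g ∈ [f̄ (G f)]`, one has `F g ≤ G f`. -/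
def locF (F G : Term Γ T2) : Formula Γ :=
  .all T1 (.all T1 (inCantor v1 →ᶠ inCantor v0 →ᶠ inNbhd v0 v1 (G.wk.wk ⬝ v1) →ᶠ
    F.wk.wk ⬝ v0 ⩽₀ G.wk.wk ⬝ v1))

/-- `F` is bounded by `N` on `C`. -/
def boundedOnCantor (F : Term Γ T2) (N : Term Γ T0) : Formula Γ :=
  .all T1 (inCantor v0 →ᶠ F.wk ⬝ v0 ⩽₀ N.wk)

/-- The finite sequence `w 0, …, w (k - 1)` provides a covering of `C` by the neighbourhoods
`[f̄ (G f)]`. -/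
def coversCantor (G : Term Γ T2) (k : Term Γ T0) (w : Term Γ (T0 ⇾ T1)) : Formula Γ :=
  .all T1 (inCantor v0 →ᶠ
    exBelow k.wk (inNbhd v1 (w.wk.wk ⬝ v0) (G.wk.wk ⬝ (w.wk.wk ⬝ v0))))

end Cantor

/-- Uniform Pincherle theorem: `∀ G ∃ N ∀ F (LOC(F, G) → F is bounded by N on C)`. -/
def PITu : Sentence :=
  .all T2 (.ex T0 (.all T2 (locF v0 v2 →ᶠ boundedOnCantor v0 v1)))

/-- Heine-Borel for uncountable coverings of Cantor space. A finite sequence of type `1` objects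
is given by its length and a function of type `0 → 1`. -/
def HBUc : Sentence := .all T2 (.ex T0 (.ex (T0 ⇾ T1) (coversCantor v2 v1 v0)))

/-- There is a special fan functional `Θ`: the length and the entries of the finite sequence
`Θ G` are given by functionals of types `2 → 0` and `2 → (0 → 1)`. -/
def existsSCF : Sentence :=
  .ex T3 (.ex (T2 ⇾ T0 ⇾ T1) (.all T2 (coversCantor v0 (v2 ⬝ v0) (v1 ⬝ v0))))

/-- There is a Pincherle realiser `M`. -/
def existsPR : Sentence :=
  .ex T3 (.all T2 (.all T2 (locF v1 v0 →ᶠ boundedOnCantor v1 (v2 ⬝ v0))))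

/-! ### Rational and real numbers -/

/-- A rational expression `(pos - neg) / den` given by number terms, where `den` is positive. -/
structure RatTm (Γ : Ctx) where
  pos : Term Γ T0
  neg : Term Γ T0
  den : Term Γ T0

section Reals

variable {Γ : Ctx}

def RatTm.wk {τ : Ty} (a : RatTm Γ) : RatTm (τ :: Γ) := ⟨a.pos.wk, a.neg.wk, a.den.wk⟩

def RatTm.add (a b : RatTm Γ) : RatTm Γ :=
  ⟨a.pos *₀ b.den +₀ b.pos *₀ a.den, a.neg *₀ b.den +₀ b.neg *₀ a.den, a.den *₀ b.den⟩

def RatTm.opp (a : RatTm Γ) : RatTm Γ := ⟨a.neg, a.pos, a.den⟩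

def RatTm.sub (a b : RatTm Γ) : RatTm Γ := a.add b.opp

def RatTm.lt (a b : RatTm Γ) : Formula Γ :=
  a.pos *₀ b.den +₀ b.neg *₀ a.den <₀ b.pos *₀ a.den +₀ a.neg *₀ b.den

def RatTm.le (a b : RatTm Γ) : Formula Γ :=
  a.pos *₀ b.den +₀ b.neg *₀ a.den ⩽₀ b.pos *₀ a.den +₀ a.neg *₀ b.den

/-- `|a - b| < c` -/
def RatTm.distLt (a b c : RatTm Γ) : Formula Γ := (a.sub b).lt c ∧ᶠ (b.sub a).lt c

/-- `|a - b| ≤ c` -/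
def RatTm.distLe (a b c : RatTm Γ) : Formula Γ := (a.sub b).le c ∧ᶠ (b.sub a).le c

def ratZero : RatTm Γ := ⟨tZero, tZero, tOne⟩
def ratOne : RatTm Γ := ⟨tOne, tZero, tOne⟩

/-- The rational `2 ^ (-n)`. -/
def ratEps (n : Term Γ T0) : RatTm Γ := ⟨tOne, tZero, tPowTwo n⟩

/-- The rational `2 ^ (-n + 1)`. -/
def ratTwoEps (n : Term Γ T0) : RatTm Γ := ⟨tTwo, tZero, tPowTwo n⟩

/-- `c` is the Cantor pair of `u` and `d`: `2 c = (u + d)² + 3 u + d`. -/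
def isPair (c u d : Term Γ T0) : Formula Γ :=
  tTwo *₀ c =₀ (u +₀ d) *₀ (u +₀ d) +₀ (tTwo +₀ tOne) *₀ u +₀ d

/-- The number `c` codes the signed quotient `(p - m) / (d + 1)`: the pair of `2 p` and `d` codes
`p / (d + 1)`, and the pair of `2 m - 1` and `d`, for `m > 0`, codes `- m / (d + 1)`. -/
def isRatCode (c p m d : Term Γ T0) : Formula Γ :=
  (m =₀ tZero ∧ᶠ isPair c (tTwo *₀ p) d) ∨ᶠ
    (p =₀ tZero ∧ᶠ .ex T0 (v0 +₀ tOne =₀ tTwo *₀ m.wk ∧ᶠ isPair c.wk v0 d.wk))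

/-- `A(q)` for the rational number `q` coded by `c`. -/
def withRat (c : Term Γ T0) (A : RatTm (T0 :: T0 :: T0 :: Γ) → Formula (T0 :: T0 :: T0 :: Γ)) :
    Formula Γ :=
  .ex T0 (.ex T0 (.ex T0
    (isRatCode c.wk.wk.wk v2 v1 v0 ∧ᶠ A ⟨v2, v1, v0 +₀ tOne⟩)))

/-- `x ∈ ℝ`: for all `n, i`, `|x n - x (n + i)| < 2 ^ (-n)`. -/
def isReal (x : Term Γ T1) : Formula Γ :=
  .all T0 (.all T0
    (withRat (x.wk.wk ⬝ v1) fun a =>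
      withRat (x.wk.wk.wk.wk.wk ⬝ (v1 +₀ v0).wk.wk.wk) fun b =>
        a.wk.wk.wk.distLt b (ratEps v1.wk.wk.wk.wk.wk.wk)))

/-- `x = y` as real numbers: for all `n`, `|x n - y n| ≤ 2 ^ (-n + 1)`. -/
def eqReal (x y : Term Γ T1) : Formula Γ :=
  .all T0
    (withRat (x.wk ⬝ v0) fun a =>
      withRat (y.wk.wk.wk.wk ⬝ v0.wk.wk.wk) fun b =>
        a.wk.wk.wk.distLe b (ratTwoEps v0.wk.wk.wk.wk.wk.wk))

/-- `x > 0` as real numbers: for some `n`, `2 ^ (-n + 1) < x n`. -/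
def isPosReal (x : Term Γ T1) : Formula Γ :=
  .ex T0 (withRat (x.wk ⬝ v0) fun a => (ratTwoEps v0.wk.wk.wk).lt a)

/-- `x ∈ [0, 1]`, that is, neither `x < 0` nor `1 < x`: for no `n`, `x n + 2 ^ (-n + 1) < 0`
or `1 + 2 ^ (-n + 1) < x n`. -/
def inUnitInterval (x : Term Γ T1) : Formula Γ :=
  ¬ᶠ (.ex T0 (withRat (x.wk ⬝ v0) fun a => (a.add (ratTwoEps v0.wk.wk.wk)).lt ratZero)) ∧ᶠ
  ¬ᶠ (.ex T0 (withRat (x.wk ⬝ v0) fun a => (ratOne.add (ratTwoEps v0.wk.wk.wk)).lt a))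

/-- `x ∈ (y - r, y + r)`. The `n`-th approximations of `y - r` and `y + r` are
`y (n + 1) - r (n + 1)` and `y (n + 1) + r (n + 1)`, and `s < t` means that
`s n + 2 ^ (-n + 1) < t n` for some `n`. -/
def inBall (x y r : Term Γ T1) : Formula Γ :=
  .ex T0
    (withRat (x.wk ⬝ v0) fun a =>
      withRat (y.wk.wk.wk.wk ⬝ (v0 +₀ tOne).wk.wk.wk) fun b =>
        withRat (r.wk.wk.wk.wk.wk.wk.wk ⬝ (v0 +₀ tOne).wk.wk.wk.wk.wk.wk) fun c =>
          ((b.wk.wk.wk.sub c).add (ratTwoEps v0.wk.wk.wk.wk.wk.wk.wk.wk.wk)).lt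
            a.wk.wk.wk.wk.wk.wk) ∧ᶠ
  .ex T0
    (withRat (x.wk ⬝ v0) fun a =>
      withRat (y.wk.wk.wk.wk ⬝ (v0 +₀ tOne).wk.wk.wk) fun b =>
        withRat (r.wk.wk.wk.wk.wk.wk.wk ⬝ (v0 +₀ tOne).wk.wk.wk.wk.wk.wk) fun c =>
          (a.wk.wk.wk.wk.wk.wk.add (ratTwoEps v0.wk.wk.wk.wk.wk.wk.wk.wk.wk)).lt
            (b.wk.wk.wk.add c))

/-- `Ψ : ℝ → ℝ⁺`: the functional `Ψ` maps reals to positive reals and equal reals to equal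
reals. -/
def isPosRealFunction (Ψ : Term Γ (T1 ⇾ T1)) : Formula Γ :=
  .all T1 (isReal v0 →ᶠ isReal (Ψ.wk ⬝ v0) ∧ᶠ isPosReal (Ψ.wk ⬝ v0)) ∧ᶠ
  .all T1 (.all T1 (isReal v1 →ᶠ isReal v0 →ᶠ eqReal v1 v0 →ᶠ
    eqReal (Ψ.wk.wk ⬝ v1) (Ψ.wk.wk ⬝ v0)))

end Reals

/-- Heine-Borel for uncountable coverings of the unit interval: for every `Ψ : ℝ → ℝ⁺` there are
finitely many reals `y` whose intervals `(y - Ψ y, y + Ψ y)` cover `[0, 1]`. -/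
def HBU : Sentence :=
  .all (T1 ⇾ T1) (isPosRealFunction v0 →ᶠ
    .ex T0 (.ex (T0 ⇾ T1)
      (allBelow v1 (isReal (v1 ⬝ v0)) ∧ᶠ
        .all T1 (isReal v0 →ᶠ inUnitInterval v0 →ᶠ
          exBelow v2 (inBall v1 (v2 ⬝ v0) (.var (.succ (.succ (.succ (.succ .zero)))) ⬝ (v2 ⬝ v0)))))))

end HOA

/-! Derivability is first exchanged for truth. By a completeness theorem (`proves_of_models`) it is
enough to verify each equivalence in all models of the theory, and pointwise equality can be divided
out, so that the models are extensional. The numbers of such a model may be nonstandard; only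
induction on decidable predicates (`induct`) and the available choice may be used inside it.
Combinatory completeness supplies internal λ-abstraction (`lam`), and the predicate `Dfn` records
which maps can be abstracted.

`PITu` and `HBUc`: the sum of `G` over the centres of a finite covering bounds every `F` with
`LOC(F, G)`. Conversely, let `N` be the bound for `G`. If some `g` lay in no neighbourhood given by
an `f` with `G f ≤ N`, then the functional with value `N + 1` near `g` and `0` elsewhere would
satisfy `LOC` and exceed `N`. So neighbourhoods of length at most `N` cover, and one centre for each
of the `2 ^ N` binary sequences of length `N` suffices (`HBUc_of_PITu`).

`HBUc` implies `HBU` through binary expansions (`HBU_of_HBUc`). For the converse, Cantor space is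
embedded in the line with digits `0, 1` in base `4`, and half the distance to a decidable set of
nodes becomes a real function `radius`. There are two cases. If `∃²` exists, one can decide whether
the radius is positive, keep it off the embedded Cantor set, and use a radius given by `G` on that
set. If `∃²` does not exist, every functional of type `2` is continuous by Grilliot's trick
(`exists_isExists`); then the nodes at which `G` still asks for more digits form a set without
infinite branch, its radius is positive everywhere, and a finite subcovering bounds the depth at
which sequences leave it (`HBUc_of_HBU`).

Realisers: whether finitely many neighbourhoods cover is decided on finitely many nodes
(`covers_iff`), so quantifier-free choice of type `(2, 1)` turns `HBUc` into a functional `Θ`, from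
which a Pincherle realiser is read off by summation. -/

namespace HOA

/-! ### Simultaneous translation of constants and variables -/

section Translation

variable {K K₁ K₂ K₃ : Ty → Type} {Γ Δ Θ : Ctx} {ρ τ : Ty}

/-- Interpretations of the constants `K₁` by terms over `K₂`. -/
abbrev CSub (K₁ K₂ : Ty → Type) (Δ : Ctx) : Type := ∀ ρ : Ty, K₁ ρ → Tm K₂ Δ ρ

def CSub.wk (θ : CSub K₁ K₂ Δ) : CSub K₁ K₂ (τ :: Δ) := fun _ c => (θ _ c).wk

def CSub.id : CSub K K Δ := fun _ c => .const c

def Sub.id : Sub K Γ Γ := fun _ x => .var x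

/-- Replaces constants and variables by terms. -/
def Tm.tr (θ : CSub K₁ K₂ Δ) (s : Sub K₂ Γ Δ) : ∀ {ρ : Ty}, Tm K₁ Γ ρ → Tm K₂ Δ ρ
  | _, .var x => s _ x
  | _, .const c => θ _ c
  | _, .app t u => .app (t.tr θ s) (u.tr θ s)

def Fm.tr : ∀ {Γ Δ : Ctx}, CSub K₁ K₂ Δ → Sub K₂ Γ Δ → Fm K₁ Γ → Fm K₂ Δ
  | _, _, θ, s, .eq t u => .eq (t.tr θ s) (u.tr θ s)
  | _, _, θ, s, .lt t u => .lt (t.tr θ s) (u.tr θ s)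
  | _, _, _, _, .bot => .bot
  | _, _, θ, s, .imp A B => .imp (A.tr θ s) (B.tr θ s)
  | _, _, θ, s, .all ρ A => .all ρ (A.tr θ.wk s.lift)

theorem Tm.subst_eq_tr (s : Sub K Γ Δ) (t : Tm K Γ ρ) : t.subst s = t.tr CSub.id s := by
  induction t with
  | var x => rfl
  | const c => rfl
  | app t u iht ihu => simp only [Tm.subst, Tm.tr, iht, ihu]

theorem Tm.rename_eq_tr (r : Ren Γ Δ) (t : Tm K Γ ρ) :
    t.rename r = t.tr CSub.id fun _ x => .var (r _ x) := by
  induction t with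
  | var x => rfl
  | const c => rfl
  | app t u iht ihu => simp only [Tm.rename, Tm.tr, iht, ihu]

theorem Tm.wk_eq_tr (t : Tm K Γ ρ) :
    (t.wk : Tm K (τ :: Γ) ρ) = t.tr CSub.id fun _ x => .var x.succ :=
  t.rename_eq_tr _

theorem CSub.wk_id : (CSub.id : CSub K K Γ).wk = (CSub.id : CSub K K (τ :: Γ)) := rfl

theorem Fm.subst_eq_tr (s : Sub K Γ Δ) (A : Fm K Γ) : A.subst s = A.tr CSub.id s := by
  induction A generalizing Δ with
  | eq t u => simp only [Fm.subst, Fm.tr, Tm.subst_eq_tr]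
  | lt t u => simp only [Fm.subst, Fm.tr, Tm.subst_eq_tr]
  | bot => rfl
  | imp A B ihA ihB => simp only [Fm.subst, Fm.tr, ihA, ihB]
  | all ρ A ih => simp only [Fm.subst, Fm.tr, ih, CSub.wk_id]

theorem Tm.tr_tr (θ₁ : CSub K₁ K₂ Δ) (s₁ : Sub K₂ Γ Δ) (θ₂ : CSub K₂ K₃ Θ) (s₂ : Sub K₃ Δ Θ)
    (t : Tm K₁ Γ ρ) :
    (t.tr θ₁ s₁).tr θ₂ s₂ =
      t.tr (fun _ c => (θ₁ _ c).tr θ₂ s₂) (fun _ x => (s₁ _ x).tr θ₂ s₂) := by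
  induction t with
  | var x => rfl
  | const c => rfl
  | app t u iht ihu => simp only [Tm.tr, iht, ihu]

theorem Tm.wk_tr_lift (θ : CSub K₁ K₂ Δ) (s : Sub K₂ Γ Δ) (t : Tm K₁ Γ ρ) :
    (t.wk : Tm K₁ (τ :: Γ) ρ).tr θ.wk s.lift = (t.tr θ s).wk := by
  rw [Tm.wk_eq_tr, Tm.wk_eq_tr, Tm.tr_tr, Tm.tr_tr]
  congr 1
  · funext σ c; exact Tm.wk_eq_tr _
  · funext σ x; exact Tm.wk_eq_tr _

theorem Fm.tr_tr (θ₁ : CSub K₁ K₂ Δ) (s₁ : Sub K₂ Γ Δ) (θ₂ : CSub K₂ K₃ Θ) (s₂ : Sub K₃ Δ Θ)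
    (A : Fm K₁ Γ) :
    (A.tr θ₁ s₁).tr θ₂ s₂ =
      A.tr (fun _ c => (θ₁ _ c).tr θ₂ s₂) (fun _ x => (s₁ _ x).tr θ₂ s₂) := by
  induction A generalizing Δ Θ with
  | eq t u => simp only [Fm.tr, Tm.tr_tr]
  | lt t u => simp only [Fm.tr, Tm.tr_tr]
  | bot => rfl
  | imp A B ihA ihB => simp only [Fm.tr, ihA, ihB]
  | all ρ A ih =>
    simp only [Fm.tr, ih]
    congr 2
    · funext σ c; exact Tm.wk_tr_lift _ _ _
    · funext σ x
      cases x with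
      | zero => rfl
      | succ x => exact Tm.wk_tr_lift _ _ _

theorem Tm.tr_id (t : Tm K Γ ρ) : t.tr CSub.id Sub.id = t := by
  induction t with
  | var x => rfl
  | const c => rfl
  | app t u iht ihu => simp only [Tm.tr, iht, ihu]

theorem Sub.lift_id : (Sub.id : Sub K Γ Γ).lift = (Sub.id : Sub K (τ :: Γ) (τ :: Γ)) := by
  funext σ x
  cases x <;> rfl

theorem Fm.tr_id (A : Fm K Γ) : A.tr CSub.id Sub.id = A := by
  induction A with
  | eq t u => simp only [Fm.tr, Tm.tr_id]
  | lt t u => simp only [Fm.tr, Tm.tr_id]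
  | bot => rfl
  | imp A B ihA ihB => simp only [Fm.tr, ihA, ihB]
  | all ρ A ih => simp only [Fm.tr, CSub.wk_id, Sub.lift_id, ih]

theorem Sub.eq_empty (s : Sub K [] Γ) : s = Sub.empty := by
  funext σ x
  exact nomatch x

theorem Fm.tr_wk (θ : CSub K₁ K₂ Δ) (s : Sub K₂ Γ Δ) (A : Fm K₁ Γ) :
    (A.wk : Fm K₁ (τ :: Γ)).tr θ.wk s.lift = (A.tr θ s).wk := by
  rw [Fm.wk, Fm.wk, Fm.subst_eq_tr, Fm.subst_eq_tr, Fm.tr_tr, Fm.tr_tr]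
  congr 1
  · funext σ c; exact Tm.wk_eq_tr _
  · funext σ x; exact Tm.wk_eq_tr _

theorem Tm.wk_tr_cons (t : Tm K Γ ρ) (u : Tm K Γ τ) :
    t.wk.tr CSub.id (Sub.cons u fun _ x => .var x) = t := by
  rw [Tm.wk_eq_tr, Tm.tr_tr]
  exact t.tr_id

theorem Fm.inst_tr (θ : CSub K₁ K₂ Δ) (s : Sub K₂ Γ Δ) (A : Fm K₁ (ρ :: Γ)) (t : Tm K₁ Γ ρ) :
    (A.inst t).tr θ s = (A.tr θ.wk s.lift).inst (t.tr θ s) := by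
  rw [Fm.inst, Fm.inst, Fm.subst_eq_tr, Fm.subst_eq_tr, Fm.tr_tr, Fm.tr_tr]
  congr 1
  · funext σ c; exact (Tm.wk_tr_cons _ _).symm
  · funext σ x
    cases x with
    | zero => rfl
    | succ x => exact (Tm.wk_tr_cons _ _).symm

theorem Fm.tr_lift_inst (θ : CSub K₁ K₂ Δ) (s : Sub K₂ Γ Δ) (A : Fm K₁ (ρ :: Γ)) (t : Tm K₂ Δ ρ) :
    (A.tr θ.wk s.lift).inst t = A.tr θ (Sub.cons t s) := by
  rw [Fm.inst, Fm.subst_eq_tr, Fm.tr_tr]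
  congr 1
  · funext σ c; exact Tm.wk_tr_cons _ _
  · funext σ x
    cases x with
    | zero => rfl
    | succ x => exact Tm.wk_tr_cons _ _

theorem Fm.ofSentence_tr (θ : CSub K₁ K₂ Δ) (s : Sub K₂ Γ Δ) (A : Fm K₁ []) :
    (A.ofSentence : Fm K₁ Γ).tr θ s = A.tr θ Sub.empty := by
  rw [Fm.ofSentence, Fm.subst_eq_tr, Fm.tr_tr]
  congr 1
  exact Sub.eq_empty _

theorem Fm.ofSentence_nil (A : Fm K []) : (A.ofSentence : Fm K []) = A := by
  rw [Fm.ofSentence, Fm.subst_eq_tr]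
  exact (congrArg (fun s => A.tr CSub.id s) (Sub.eq_empty Sub.id).symm).trans A.tr_id

end Translation

/-! ### Structural rules -/

section Structural

variable {K K₁ K₂ : Ty → Type} {Γ Δ : Ctx}

theorem Prov.weaken {T : Set (Fm K [])} {H : List (Fm K Γ)} {A : Fm K Γ} (h : Prov T H A) :
    ∀ {H' : List (Fm K Γ)}, H ⊆ H' → Prov T H' A := by
  induction h with
  | ax hA => exact fun _ => .ax hA
  | hyp hA => exact fun hs => .hyp (hs hA)
  | impI _ ih => exact fun hs => .impI (ih (List.cons_subset_cons _ hs))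
  | impE _ _ ih₁ ih₂ => exact fun hs => .impE (ih₁ hs) (ih₂ hs)
  | raa _ ih => exact fun hs => .raa (ih (List.cons_subset_cons _ hs))
  | allI _ ih => exact fun hs => .allI (ih (List.map_subset _ hs))
  | allE t _ ih => exact fun hs => .allE t (ih hs)

/-- The translation `θ` maps axioms of `T₁` to axioms of `T₂`. -/
def CSub.Respects (T₁ : Set (Fm K₁ [])) (T₂ : Set (Fm K₂ [])) (θ : CSub K₁ K₂ Δ) : Prop :=
  ∀ A ∈ T₁, ∃ B ∈ T₂, A.tr θ Sub.empty = B.ofSentence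

theorem CSub.Respects.wk {T₁ : Set (Fm K₁ [])} {T₂ : Set (Fm K₂ [])} {θ : CSub K₁ K₂ Δ} {τ : Ty}
    (h : θ.Respects T₁ T₂) : (θ.wk : CSub K₁ K₂ (τ :: Δ)).Respects T₁ T₂ := by
  intro A hA
  obtain ⟨B, hB, e⟩ := h A hA
  refine ⟨B, hB, ?_⟩
  have e' := congrArg (Fm.wk (τ := τ)) e
  rw [← Fm.tr_wk, Fm.ofSentence, Fm.wk, Fm.wk, Fm.subst_eq_tr, Fm.subst_eq_tr, Fm.subst_eq_tr,
    Fm.tr_tr, Fm.tr_tr] at e'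
  rw [Fm.ofSentence, Fm.subst_eq_tr]
  refine Eq.trans ?_ (e'.trans ?_)
  · congr 1; exact (Sub.eq_empty _).symm
  · congr 1; exact Sub.eq_empty _

/-- The two uses in the completeness proof are the elimination of new constants by closed terms and
the generalization on a new constant, which is turned into a variable. -/
theorem Prov.tr {T₁ : Set (Fm K₁ [])} {T₂ : Set (Fm K₂ [])} {H : List (Fm K₁ Γ)} {A : Fm K₁ Γ}
    (h : Prov T₁ H A) : ∀ {Δ : Ctx} (θ : CSub K₁ K₂ Δ) (s : Sub K₂ Γ Δ), θ.Respects T₁ T₂ →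
      Prov T₂ (H.map (Fm.tr θ s)) (A.tr θ s) := by
  induction h with
  | ax hA =>
    intro Δ θ s hθ
    obtain ⟨B, hB, e⟩ := hθ _ hA
    rw [Fm.ofSentence_tr, e]
    exact .ax hB
  | hyp hA => exact fun θ s _ => .hyp (List.mem_map_of_mem hA)
  | impI _ ih => exact fun θ s hθ => .impI (ih θ s hθ)
  | impE _ _ ih₁ ih₂ => exact fun θ s hθ => .impE (ih₁ θ s hθ) (ih₂ θ s hθ)
  | raa _ ih => exact fun θ s hθ => .raa (ih θ s hθ)
  | allI _ ih =>
    intro Δ θ s hθ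
    refine .allI ?_
    have := ih θ.wk s.lift hθ.wk
    rw [List.map_map] at this ⊢
    convert this using 2
    funext B
    exact (Fm.tr_wk θ s B).symm
  | allE t _ ih =>
    intro Δ θ s hθ
    rw [Fm.inst_tr]
    exact .allE _ (ih θ s hθ)

theorem Prov.exfalso {T : Set (Fm K [])} {H : List (Fm K Γ)} {A : Fm K Γ} (h : Prov T H .bot) :
    Prov T H A :=
  .raa (h.weaken (List.subset_cons_self _ _))

end Structural

/-! ### Semantics -/

section Semantics

/-- Structures: application and the constants are interpreted, and so are the two prime
predicates. -/
structure Str (K : Ty → Type) where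
  D : Ty → Type
  app : ∀ {ρ τ : Ty}, D (ρ ⇾ τ) → D ρ → D τ
  const : ∀ {ρ : Ty}, K ρ → D ρ
  eqv : D T0 → D T0 → Prop
  lt : D T0 → D T0 → Prop

abbrev Env (D : Ty → Type) (Γ : Ctx) : Type := ∀ ρ : Ty, Var Γ ρ → D ρ

def Env.nil {D : Ty → Type} : Env D [] := fun _ x => nomatch x

def Env.cons {D : Ty → Type} {Γ : Ctx} {ρ : Ty} (d : D ρ) (γ : Env D Γ) : Env D (ρ :: Γ)
  | _, .zero => d
  | _, .succ x => γ _ x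

variable {K : Ty → Type} {Γ : Ctx} {ρ : Ty}

def Tm.eval (M : Str K) (γ : Env M.D Γ) : ∀ {ρ : Ty}, Tm K Γ ρ → M.D ρ
  | _, .var x => γ _ x
  | _, .const c => M.const c
  | _, .app t u => M.app (t.eval M γ) (u.eval M γ)

def Fm.Sat (M : Str K) : ∀ {Γ : Ctx}, Env M.D Γ → Fm K Γ → Prop
  | _, γ, .eq t u => M.eqv (t.eval M γ) (u.eval M γ)
  | _, γ, .lt t u => M.lt (t.eval M γ) (u.eval M γ)
  | _, _, .bot => False
  | _, γ, .imp A B => A.Sat M γ → B.Sat M γ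
  | _, γ, .all ρ A => ∀ d : M.D ρ, A.Sat M (Env.cons d γ)

end Semantics

/-! ### Numerical codes of formulas -/

section Codes

/-- Codes serve only to give different formulas different Henkin constants, so injectivity is all
that matters. -/
def Ty.code : Ty → ℕ
  | .nat => 0
  | .arr σ τ => Nat.pair σ.code τ.code + 1

theorem Ty.code_injective : Function.Injective Ty.code := by
  intro σ
  induction σ with
  | nat => intro τ h; cases τ <;> simp_all [Ty.code]
  | arr σ₁ σ₂ ih₁ ih₂ =>
    intro τ h
    cases τ with
    | nat => simp [Ty.code] at h
    | arr τ₁ τ₂ =>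
      simp only [Ty.code, Nat.add_right_cancel_iff, Nat.pair_eq_pair] at h
      rw [ih₁ h.1, ih₂ h.2]

def Var.idx : ∀ {Γ : Ctx} {ρ : Ty}, Var Γ ρ → ℕ
  | _, _, .zero => 0
  | _, _, .succ x => x.idx + 1

theorem Var.idx_injective {Γ : Ctx} {ρ : Ty} : Function.Injective (Var.idx : Var Γ ρ → ℕ) := by
  intro x
  induction x with
  | zero => intro y h; cases y <;> simp_all [Var.idx]
  | succ x ih =>
    intro y h
    cases y with
    | zero => simp [Var.idx] at h
    | succ y => rw [ih (by simpa [Var.idx] using h)]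

variable {K : Ty → Type} (e : ∀ ρ : Ty, K ρ → ℕ)

def Tm.code {Γ : Ctx} : ∀ {ρ : Ty}, Tm K Γ ρ → ℕ
  | _, .var x => Nat.pair 0 x.idx
  | _, .const c => Nat.pair 1 (e _ c)
  -- The type of the argument is recorded because the type of the application does not determine it.
  | _, .app (ρ := ρ) t u => Nat.pair 2 (Nat.pair ρ.code (Nat.pair t.code u.code))

variable {e}

theorem Tm.code_injective (he : ∀ ρ : Ty, Function.Injective (e ρ)) {Γ : Ctx} {ρ : Ty} :
    Function.Injective (Tm.code e : Tm K Γ ρ → ℕ) := by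
  intro s
  induction s with
  | var x =>
    intro t h
    cases t <;> simp only [Tm.code, Nat.pair_eq_pair] at h
    · rw [Var.idx_injective h.2]
    · omega
    · omega
  | const c =>
    intro t h
    cases t <;> simp only [Tm.code, Nat.pair_eq_pair] at h
    · omega
    · rw [he _ h.2]
    · omega
  | app s₁ s₂ ih₁ ih₂ =>
    intro t h
    cases t <;> simp only [Tm.code, Nat.pair_eq_pair] at h
    · omega
    · omega
    · obtain ⟨-, h₀, h₁, h₂⟩ := h
      cases Ty.code_injective h₀
      rw [ih₁ h₁, ih₂ h₂]

variable (e) in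
def Fm.code : ∀ {Γ : Ctx}, Fm K Γ → ℕ
  | _, .eq t u => Nat.pair 0 (Nat.pair (t.code e) (u.code e))
  | _, .lt t u => Nat.pair 1 (Nat.pair (t.code e) (u.code e))
  | _, .bot => Nat.pair 2 0
  | _, .imp A B => Nat.pair 3 (Nat.pair A.code B.code)
  | _, .all ρ A => Nat.pair 4 (Nat.pair ρ.code A.code)

theorem Fm.code_injective (he : ∀ ρ : Ty, Function.Injective (e ρ)) {Γ : Ctx} : Function.Injective (Fm.code e : Fm K Γ → ℕ) := by
  intro A
  induction A with
  | eq t u =>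
    intro B h
    cases B <;> simp only [Fm.code, Nat.pair_eq_pair] at h <;> try omega
    rw [Tm.code_injective he h.2.1, Tm.code_injective he h.2.2]
  | lt t u =>
    intro B h
    cases B <;> simp only [Fm.code, Nat.pair_eq_pair] at h <;> try omega
    rw [Tm.code_injective he h.2.1, Tm.code_injective he h.2.2]
  | bot =>
    intro B h
    cases B <;> simp only [Fm.code, Nat.pair_eq_pair] at h <;> first | rfl | omega
  | imp A₁ A₂ ih₁ ih₂ =>
    intro B h
    cases B <;> simp only [Fm.code, Nat.pair_eq_pair] at h <;> try omega
    rw [ih₁ h.2.1, ih₂ h.2.2]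
  | all ρ A ih =>
    intro B h
    cases B <;> simp only [Fm.code, Nat.pair_eq_pair] at h <;> try omega
    obtain ⟨-, h₀, h₁⟩ := h
    cases Ty.code_injective h₀
    rw [ih h₁]

end Codes

/-! ### Completeness -/

/-! ### New constants and generalization on them. -/

section Names

variable {K : Ty → Type} {Γ Δ : Ctx} {ρ : Ty}

/-- The language with countably many new constants of each type. -/
abbrev WithNames (K : Ty → Type) (ρ : Ty) : Type := K ρ ⊕ ℕ

def CSub.incl : CSub K (WithNames K) Δ := fun _ c => .const (.inl c)

/-- A sentence in the language with new constants. -/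
def Fm.lift (A : Fm K []) : Fm (WithNames K) [] := A.tr CSub.incl Sub.empty

/-- A strict upper bound of the new constants of a term. -/
def Tm.bd : ∀ {ρ : Ty}, Tm (WithNames K) Γ ρ → ℕ
  | _, .var _ => 0
  | _, .const (.inl _) => 0
  | _, .const (.inr n) => n + 1
  | _, .app t u => max t.bd u.bd

def Fm.bd : ∀ {Γ : Ctx}, Fm (WithNames K) Γ → ℕ
  | _, .eq t u => max t.bd u.bd
  | _, .lt t u => max t.bd u.bd
  | _, .bot => 0
  | _, .imp A B => max A.bd B.bd
  | _, .all _ A => A.bd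

/-- `θ` fixes the old constants and the new constants below `n`. -/
def CSub.FixesBelow (n : ℕ) (θ : CSub (WithNames K) (WithNames K) Δ) : Prop :=
  (∀ (ρ : Ty) (c : K ρ), θ ρ (.inl c) = .const (.inl c)) ∧
    ∀ (ρ : Ty) (m : ℕ), m < n → θ ρ (.inr m) = .const (.inr m)

theorem CSub.FixesBelow.wk {n : ℕ} {θ : CSub (WithNames K) (WithNames K) Δ} {τ : Ty}
    (h : θ.FixesBelow n) : (θ.wk (τ := τ)).FixesBelow n := by
  refine ⟨fun ρ c => ?_, fun ρ m hm => ?_⟩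
  · rw [CSub.wk, h.1]; rfl
  · rw [CSub.wk, h.2 ρ m hm]; rfl

theorem Tm.tr_of_bd_le {n : ℕ} {θ : CSub (WithNames K) (WithNames K) Δ} (h : θ.FixesBelow n)
    (s : Sub (WithNames K) Γ Δ) (t : Tm (WithNames K) Γ ρ) (ht : t.bd ≤ n) :
    t.tr θ s = t.tr CSub.id s := by
  induction t with
  | var x => rfl
  | const c =>
    cases c with
    | inl c => exact h.1 _ c
    | inr m => exact h.2 _ m ht
  | app t u iht ihu =>
    simp only [Tm.bd, max_le_iff] at ht
    simp only [Tm.tr, iht ht.1, ihu ht.2]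

theorem Fm.tr_of_bd_le {n : ℕ} {θ : CSub (WithNames K) (WithNames K) Δ} (h : θ.FixesBelow n)
    (s : Sub (WithNames K) Γ Δ) (A : Fm (WithNames K) Γ) (hA : A.bd ≤ n) :
    A.tr θ s = A.tr CSub.id s := by
  induction A generalizing Δ with
  | eq t u =>
    simp only [Fm.bd, max_le_iff] at hA
    simp only [Fm.tr, Tm.tr_of_bd_le h s _ hA.1, Tm.tr_of_bd_le h s _ hA.2]
  | lt t u =>
    simp only [Fm.bd, max_le_iff] at hA
    simp only [Fm.tr, Tm.tr_of_bd_le h s _ hA.1, Tm.tr_of_bd_le h s _ hA.2]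
  | bot => rfl
  | imp A B ihA ihB =>
    simp only [Fm.bd, max_le_iff] at hA
    simp only [Fm.tr, ihA h s hA.1, ihB h s hA.2]
  | all ρ A ih => simp only [Fm.tr, ih h.wk _ hA, CSub.wk_id]

theorem Tm.bd_tr_le {n : ℕ} {θ : CSub (WithNames K) (WithNames K) Δ}
    {s : Sub (WithNames K) Γ Δ} (hθ : ∀ ρ c, (θ ρ c).bd ≤ max n (Tm.bd (Γ := Δ) (.const c)))
    (hs : ∀ ρ x, (s ρ x).bd ≤ n) (t : Tm (WithNames K) Γ ρ) : (t.tr θ s).bd ≤ max n t.bd := by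
  induction t with
  | var x => exact (hs _ x).trans (le_max_left _ _)
  | const c => cases c <;> exact hθ _ _
  | app t u iht ihu => simp only [Tm.tr, Tm.bd]; omega

theorem Tm.bd_id (c : WithNames K ρ) (n : ℕ) :
    ((CSub.id : CSub _ (WithNames K) Δ) ρ c).bd ≤ max n (Tm.bd (Γ := Δ) (.const c)) :=
  le_max_right _ _

theorem Tm.bd_wk_le {τ : Ty} (t : Tm (WithNames K) Γ ρ) :
    (t.wk : Tm (WithNames K) (τ :: Γ) ρ).bd ≤ t.bd := by
  rw [Tm.wk_eq_tr]
  have := t.bd_tr_le (n := 0) (θ := CSub.id) (s := fun σ x => (.var (x.succ : Var (τ :: Γ) σ)))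
    (fun ρ c => Tm.bd_id c 0) (fun _ _ => le_rfl)
  simpa using this

theorem Fm.bd_subst_le {n : ℕ} {s : Sub (WithNames K) Γ Δ} (hs : ∀ ρ x, (s ρ x).bd ≤ n)
    (A : Fm (WithNames K) Γ) : (A.subst s).bd ≤ max n A.bd := by
  induction A generalizing Δ with
  | eq t u =>
    have h₁ := t.bd_tr_le (fun ρ c => Tm.bd_id c n) hs
    have h₂ := u.bd_tr_le (fun ρ c => Tm.bd_id c n) hs
    simp only [Fm.subst, Fm.bd, Tm.subst_eq_tr]; omega
  | lt t u =>
    have h₁ := t.bd_tr_le (fun ρ c => Tm.bd_id c n) hs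
    have h₂ := u.bd_tr_le (fun ρ c => Tm.bd_id c n) hs
    simp only [Fm.subst, Fm.bd, Tm.subst_eq_tr]; omega
  | bot => exact Nat.zero_le _
  | imp A B ihA ihB =>
    have h₁ := ihA hs
    have h₂ := ihB hs
    simp only [Fm.subst, Fm.bd]; omega
  | all ρ A ih =>
    refine ih fun σ x => ?_
    cases x with
    | zero => exact Nat.zero_le _
    | succ x => exact (Tm.bd_wk_le _).trans (hs _ x)

theorem Tm.bd_incl {s : Sub (WithNames K) Γ Δ} (hs : ∀ ρ x, (s ρ x).bd = 0) (t : Tm K Γ ρ) :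
    (t.tr CSub.incl s).bd = 0 := by
  induction t with
  | var x => exact hs _ x
  | const c => rfl
  | app t u iht ihu => simp only [Tm.tr, Tm.bd, iht, ihu, max_self]

theorem Fm.bd_incl {s : Sub (WithNames K) Γ Δ} (hs : ∀ ρ x, (s ρ x).bd = 0) (A : Fm K Γ) :
    (A.tr CSub.incl s).bd = 0 := by
  induction A generalizing Δ with
  | eq t u => simp only [Fm.tr, Fm.bd, Tm.bd_incl hs, max_self]
  | lt t u => simp only [Fm.tr, Fm.bd, Tm.bd_incl hs, max_self]
  | bot => rfl
  | imp A B ihA ihB => simp only [Fm.tr, Fm.bd, ihA hs, ihB hs, max_self]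
  | all ρ A ih =>
    refine ih fun σ x => ?_
    cases x with
    | zero => rfl
    | succ x => exact Nat.le_zero.1 ((Tm.bd_wk_le _).trans (hs _ x).le)

theorem Fm.bd_lift (A : Fm K []) : A.lift.bd = 0 :=
  A.bd_incl (s := Sub.empty) fun _ (x : Var [] _) => nomatch x

/-- Replaces the new constant `n` of type `ρ` by variable `0`. -/
noncomputable def abstractName (K : Ty → Type) (ρ : Ty) (n : ℕ) :
    CSub (WithNames K) (WithNames K) [ρ] := fun σ c =>
  open Classical in
  match c with
  | .inl c => .const (.inl c)
  | .inr m => if h : σ = ρ ∧ m = n then .var (h.1 ▸ .zero) else .const (.inr m)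

theorem abstractName_fixesBelow (ρ : Ty) (n : ℕ) : (abstractName K ρ n).FixesBelow n := by
  refine ⟨fun σ c => rfl, fun σ m hm => ?_⟩
  simp only [abstractName]
  rw [dif_neg]
  rintro ⟨-, rfl⟩
  exact lt_irrefl _ hm

theorem abstractName_self (ρ : Ty) (n : ℕ) : abstractName K ρ n ρ (.inr n) = .var .zero := by
  simp [abstractName]

theorem CSub.incl_respects (T : Set (Fm K [])) :
    (CSub.incl : CSub K _ Δ).Respects T (Fm.lift '' T) := by
  refine fun A hA => ⟨A.lift, ⟨A, hA, rfl⟩, ?_⟩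
  rw [Fm.lift, Fm.ofSentence, Fm.subst_eq_tr, Fm.tr_tr]
  congr 1
  exact (Sub.eq_empty _).symm

theorem CSub.respects_lift {K₂ : Ty → Type} (T : Set (Fm K [])) (T₂ : Set (Fm K₂ []))
    (θ : CSub (WithNames K) K₂ Δ)
    (h : CSub.Respects T T₂ fun ρ (c : K ρ) => θ ρ (.inl c)) : θ.Respects (Fm.lift '' T) T₂ := by
  rintro _ ⟨A, hA, rfl⟩
  obtain ⟨B, hB, e⟩ := h A hA
  refine ⟨B, hB, Eq.trans ?_ e⟩
  rw [Fm.lift, Fm.tr_tr]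
  congr 1
  exact Sub.eq_empty _

/-- Generalization on a new constant. -/
theorem Prov.generalize {T : Set (Fm K [])} {L : List (Fm (WithNames K) [])}
    {A : Fm (WithNames K) [ρ]} {n : ℕ} (hL : ∀ B ∈ L, B.bd ≤ n) (hA : A.bd ≤ n)
    (h : Prov (Fm.lift '' T) L (A.inst (.const (.inr n)))) : Prov (Fm.lift '' T) L (.all ρ A) := by
  refine .allI ?_
  have h' := h.tr (abstractName K ρ n) Sub.empty
    (CSub.respects_lift T _ _ (CSub.incl_respects T))
  convert h' using 1
  · refine List.map_congr_left fun B hB => ?_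
    rw [Fm.tr_of_bd_le (abstractName_fixesBelow ρ n) _ _ (hL B hB), Fm.wk, Fm.subst_eq_tr]
    congr 1
    exact Sub.eq_empty _
  · rw [Fm.inst, Fm.subst_eq_tr, Fm.tr_tr]
    have : A.tr (abstractName K ρ n) Sub.id = A := by
      rw [Fm.tr_of_bd_le (abstractName_fixesBelow ρ n) _ _ hA, Fm.tr_id]
    refine this.symm.trans ?_
    congr 1
    funext σ x
    cases x with
    | zero => exact (abstractName_self ρ n).symm
    | succ x => exact nomatch x

end Names

/-! ### Henkin axioms and their consistency. -/

section Henkin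

variable {K : Ty → Type} (e : ∀ ρ : Ty, K ρ → ℕ)

def nameCode (ρ : Ty) : WithNames K ρ → ℕ
  | .inl c => 2 * e ρ c
  | .inr n => 2 * n + 1

/-- The index of the Henkin constant of `A`. -/
def henkinName {ρ : Ty} (A : Fm (WithNames K) [ρ]) : ℕ :=
  -- A pair is at least as large as its first component, so the new constant lies beyond all new
  -- constants of `A`.
  Nat.pair A.bd (Nat.pair ρ.code (A.code (nameCode e)))

/-- The Henkin axiom `A(c) → ∀ x, A(x)`. -/
def henkinAxiom {ρ : Ty} (A : Fm (WithNames K) [ρ]) : Fm (WithNames K) [] :=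
  A.inst (.const (.inr (henkinName e A))) →ᶠ .all ρ A

variable {e}

theorem nameCode_injective (he : ∀ ρ : Ty, Function.Injective (e ρ)) (ρ : Ty) :
    Function.Injective (nameCode e ρ) := by
  rintro (a | a) (b | b) h <;> simp only [nameCode] at h
  · rw [he ρ (by omega : e ρ a = e ρ b)]
  · omega
  · omega
  · rw [(by omega : a = b)]

theorem bd_henkinAxiom_le {ρ : Ty} (A : Fm (WithNames K) [ρ]) :
    (henkinAxiom e A).bd ≤ henkinName e A + 1 := by
  have h₁ : A.bd ≤ henkinName e A := Nat.left_le_pair _ _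
  have h₂ := A.bd_subst_le (n := henkinName e A + 1)
    (s := Sub.cons (.const (.inr (henkinName e A))) fun _ x => .var x) (Δ := []) (by
      intro σ x
      cases x with
      | zero => exact le_rfl
      | succ x => exact nomatch x)
  simp only [henkinAxiom, Fm.bd, Fm.inst]
  omega

theorem henkinName_injective (he : ∀ ρ : Ty, Function.Injective (e ρ)) {ρ σ : Ty}
    {A : Fm (WithNames K) [ρ]} {B : Fm (WithNames K) [σ]} (h : henkinName e A = henkinName e B) :
    henkinAxiom e A = henkinAxiom e B := by
  simp only [henkinName, Nat.pair_eq_pair] at h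
  obtain ⟨-, h₁, h₂⟩ := h
  cases Ty.code_injective h₁
  rw [Fm.code_injective (nameCode_injective he) h₂]

variable (T : Set (Fm K []))

/-- Consistency with the axioms in `T`. -/
def Consistent (S : Set (Fm (WithNames K) [])) : Prop :=
  ∀ L : List (Fm (WithNames K) []), (∀ A ∈ L, A ∈ S) → ¬ Prov (Fm.lift '' T) L .bot

/-- The Henkin axioms for constants of index less than `n`, together with `¬ ψ`. -/
def henkinSet (e : ∀ ρ : Ty, K ρ → ℕ) (ψ : Fm K []) (n : ℕ) : Set (Fm (WithNames K) []) :=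
  {B | B = ψ.lift.neg ∨
    ∃ (ρ : Ty) (A : Fm (WithNames K) [ρ]), henkinName e A < n ∧ B = henkinAxiom e A}

variable {T}

theorem bd_le_of_mem_henkinSet {ψ : Fm K []} {n : ℕ} {B : Fm (WithNames K) []}
    (hB : B ∈ henkinSet e ψ n) : B.bd ≤ n := by
  rcases hB with rfl | ⟨ρ, A, h, rfl⟩
  · simp [Fm.neg, Fm.bd, Fm.bd_lift]
  · exact (bd_henkinAxiom_le A).trans h

/-- Henkin axioms are added in the order of their constants. If the one for `A` with constant `c`
were refutable, both `A(c)` and `¬ ∀ x, A(x)` would be derivable from sentences that do not contain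
`c`; generalizing on `c` gives a contradiction. -/
theorem consistent_henkinSet (he : ∀ ρ : Ty, Function.Injective (e ρ))
    (inh : ∀ ρ : Ty, Tm K [] ρ) {ψ : Fm K []} (hψ : ¬ Proves T ψ) (n : ℕ) :
    Consistent T (henkinSet e ψ n) := by
  classical
  induction n with
  | zero =>
    intro L hL h
    have hL' : L ⊆ [ψ.lift.neg] := by
      intro B hB
      rcases hL B hB with rfl | ⟨ρ, A, h, rfl⟩
      · exact List.mem_singleton_self _
      · exact absurd h (Nat.not_lt_zero _)
    -- Only `¬ ψ` is left, so closed terms can replace the new constants and a derivation in the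
    -- original language results.
    let θ : CSub (WithNames K) K [] := fun σ c => Sum.elim (fun c => .const c) (fun _ => inh σ) c
    have hθ : θ.Respects (Fm.lift '' T) T := by
      refine CSub.respects_lift T T θ fun A hA => ⟨A, hA, ?_⟩
      rw [Fm.ofSentence, Fm.subst_eq_tr]
      rfl
    have hb := (h.weaken hL').tr θ Sub.empty hθ
    refine hψ (.raa ?_)
    have hl : ψ.lift.tr θ Sub.empty = ψ := by
      rw [Fm.lift, Fm.tr_tr]
      refine Eq.trans ?_ ψ.tr_id
      rw [Sub.eq_empty Sub.id, Sub.eq_empty (fun σ x => Tm.tr θ Sub.empty (Sub.empty σ x))]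
      rfl
    simpa [Fm.neg, Fm.tr, hl] using hb
  | succ n ih =>
    intro L hL h
    by_cases hex : ∃ (ρ : Ty) (A : Fm (WithNames K) [ρ]), henkinName e A = n
    · obtain ⟨ρ, A, hA⟩ := hex
      set L' := L.filter (· ≠ henkinAxiom e A) with hL'
      have hmem : ∀ B ∈ L', B ∈ henkinSet e ψ n := by
        intro B hB
        simp only [hL', List.mem_filter, decide_eq_true_eq] at hB
        rcases hL B hB.1 with rfl | ⟨σ, A', h', rfl⟩
        · exact Or.inl rfl
        · refine Or.inr ⟨σ, A', lt_of_le_of_ne (Nat.lt_succ_iff.1 h') fun h₀ => hB.2 ?_, rfl⟩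
          exact henkinName_injective he (h₀.trans hA.symm)
      have hsub : L ⊆ henkinAxiom e A :: L' := by
        intro B hB
        by_cases h₀ : B = henkinAxiom e A
        · rw [h₀]; exact List.mem_cons_self
        · exact List.mem_cons_of_mem _ (by simpa [hL'] using ⟨hB, h₀⟩)
      have h₁ : Prov (Fm.lift '' T) L' (henkinAxiom e A).neg := .impI (h.weaken hsub)
      have h₂ : Prov (Fm.lift '' T) L' (A.inst (.const (.inr n))) := by
        refine .raa (.impE (h₁.weaken (List.subset_cons_self _ _)) ?_)
        rw [henkinAxiom, hA]
        exact .impI (Prov.exfalso (.impE (.hyp (List.mem_cons_of_mem _ List.mem_cons_self))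
          (.hyp List.mem_cons_self)))
      have hbA : A.bd ≤ n := hA ▸ Nat.left_le_pair _ _
      have h₃ := Prov.generalize (fun B hB => bd_le_of_mem_henkinSet (hmem B hB)) hbA h₂
      exact ih L' hmem (.impE h₁ (.impI (h₃.weaken (List.subset_cons_self _ _))))
    · refine ih L (fun B hB => ?_) h
      rcases hL B hB with rfl | ⟨σ, A', h', rfl⟩
      · exact Or.inl rfl
      · exact Or.inr ⟨σ, A', lt_of_le_of_ne (Nat.lt_succ_iff.1 h') fun h₀ => hex ⟨σ, A', h₀⟩, rfl⟩

theorem Consistent.exists_maximal {S : Set (Fm (WithNames K) [])} (hS : Consistent T S) :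
    ∃ S', S ⊆ S' ∧ Maximal (Consistent T) S' := by
  refine zorn_subset_nonempty {S | Consistent T S} (fun c hc hchain hne => ?_) S hS
  refine ⟨⋃₀ c, fun L hL => ?_, fun s hs => Set.subset_sUnion_of_mem hs⟩
  have : ∃ s ∈ c, ∀ A ∈ L, A ∈ s := by
    clear hS
    induction L with
    | nil => obtain ⟨s, hs⟩ := hne; exact ⟨s, hs, by simp⟩
    | cons B L ih =>
      obtain ⟨s, hs, h⟩ := ih fun A hA => hL A (List.mem_cons_of_mem _ hA)
      obtain ⟨s', hs', hB⟩ := hL B List.mem_cons_self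
      rcases hchain.total hs hs' with hle | hle
      · refine ⟨s', hs', fun A hA => ?_⟩
        rcases List.mem_cons.1 hA with rfl | hA
        · exact hB
        · exact hle (h A hA)
      · refine ⟨s, hs, fun A hA => ?_⟩
        rcases List.mem_cons.1 hA with rfl | hA
        · exact hle hB
        · exact h A hA
  obtain ⟨s, hs, h⟩ := this
  exact hc hs L h

/-! ### Maximal consistent sets and the structure of closed terms. -/

section Maximal

variable {S : Set (Fm (WithNames K) [])} (hS : Maximal (Consistent T) S)
  {A B : Fm (WithNames K) []}

theorem exists_refutation_of_notMem (hS : Maximal (Consistent T) S) (hA : A ∉ S) :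
    ∃ L : List (Fm (WithNames K) []), (∀ B ∈ L, B ∈ S) ∧ Prov (Fm.lift '' T) L A.neg := by
  classical
  have : ¬ Consistent T (insert A S) := fun h =>
    hA (hS.2 h (Set.subset_insert _ _) (Set.mem_insert _ _))
  simp only [Consistent, not_forall, not_not] at this
  obtain ⟨L, hL, h⟩ := this
  refine ⟨L.filter (· ≠ A), fun B hB => ?_, .impI (h.weaken fun B hB => ?_)⟩
  · simp only [List.mem_filter, decide_eq_true_eq] at hB
    exact (hL B hB.1).resolve_left hB.2
  · by_cases h₀ : B = A
    · rw [h₀]; exact List.mem_cons_self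
    · exact List.mem_cons_of_mem _ (by simpa using ⟨hB, h₀⟩)

theorem mem_of_prov (hS : Maximal (Consistent T) S) {L : List (Fm (WithNames K) [])}
    (hL : ∀ B ∈ L, B ∈ S) (h : Prov (Fm.lift '' T) L A) : A ∈ S := by
  by_contra hA
  obtain ⟨L', hL', h'⟩ := exists_refutation_of_notMem hS hA
  refine hS.1 (L ++ L') (fun B hB => ?_) (.impE (h'.weaken ?_) (h.weaken ?_))
  · rcases List.mem_append.1 hB with hB | hB
    · exact hL B hB
    · exact hL' B hB
  · exact List.subset_append_right _ _
  · exact List.subset_append_left _ _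

theorem imp_mem_iff (hS : Maximal (Consistent T) S) : (A →ᶠ B) ∈ S ↔ (A ∈ S → B ∈ S) := by
  constructor
  · intro h hA
    refine mem_of_prov hS (L := [A →ᶠ B, A]) (by simp [h, hA])
      (.impE (A := A) (.hyp (by simp)) (.hyp (by simp)))
  · intro h
    by_cases hA : A ∈ S
    · exact mem_of_prov hS (L := [B]) (by simp [h hA]) (.impI (.hyp (by simp)))
    · obtain ⟨L, hL, h'⟩ := exists_refutation_of_notMem hS hA
      exact mem_of_prov hS hL (.impI (Prov.exfalso
        (.impE (h'.weaken (List.subset_cons_self _ _)) (.hyp List.mem_cons_self))))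

theorem bot_notMem (hS : Maximal (Consistent T) S) : (Fm.bot : Fm (WithNames K) []) ∉ S := fun h =>
  hS.1 [.bot] (by simp [h]) (.hyp (by simp))

theorem all_mem_iff (hS : Maximal (Consistent T) S) {ρ : Ty} {A : Fm (WithNames K) [ρ]}
    (hH : henkinAxiom e A ∈ S) : Fm.all ρ A ∈ S ↔ ∀ t : Tm (WithNames K) [] ρ, A.inst t ∈ S := by
  constructor
  · intro h t
    exact mem_of_prov hS (L := [.all ρ A]) (by simp [h]) (.allE t (.hyp (by simp)))
  · intro h
    exact (imp_mem_iff hS).1 hH (h _)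

/-- The structure of closed terms. -/
def termStr (S : Set (Fm (WithNames K) [])) : Str K where
  D := Tm (WithNames K) []
  app t u := t ⬝ u
  const c := .const (.inl c)
  eqv t u := (t =₀ u) ∈ S
  lt t u := (t <₀ u) ∈ S

theorem eval_termStr {Γ : Ctx} {ρ : Ty} (γ : Env (termStr S).D Γ) (t : Tm K Γ ρ) :
    t.eval (termStr S) γ = t.tr CSub.incl γ := by
  induction t with
  | var x => rfl
  | const c => rfl
  | app t u iht ihu => simp only [Tm.eval, Tm.tr, iht, ihu]; rfl

/-- The truth lemma. In the quantifier case the Henkin axioms make membership of all closed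
instances equivalent to membership of the universal formula. -/
theorem sat_termStr (hS : Maximal (Consistent T) S)
    (hH : ∀ (ρ : Ty) (A : Fm (WithNames K) [ρ]), henkinAxiom e A ∈ S) {Γ : Ctx}
    (γ : Env (termStr S).D Γ) (A : Fm K Γ) : A.Sat (termStr S) γ ↔ A.tr CSub.incl γ ∈ S := by
  induction A with
  | eq t u => simp only [Fm.Sat, Fm.tr, eval_termStr]; rfl
  | lt t u => simp only [Fm.Sat, Fm.tr, eval_termStr]; rfl
  | bot => exact iff_of_false id (bot_notMem hS)
  | imp A B ihA ihB => simp only [Fm.Sat, Fm.tr, ihA, ihB, imp_mem_iff hS]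
  | all ρ A ih =>
    simp only [Fm.Sat, Fm.tr, ih]
    rw [all_mem_iff hS (hH ρ _)]
    refine forall_congr' fun t => ?_
    refine iff_of_eq (congrArg (· ∈ S) (Eq.trans ?_ (Fm.tr_lift_inst CSub.incl γ A t).symm))
    refine congrArg (fun s => A.tr CSub.incl s) ?_
    funext σ x
    cases x <;> rfl

end Maximal

/-- Gödel's completeness theorem, for countable languages with closed terms of all types. -/
theorem proves_of_valid (he : ∀ ρ : Ty, Function.Injective (e ρ)) (inh : ∀ ρ : Ty, Tm K [] ρ)
    {ψ : Fm K []}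
    (h : ∀ M : Str K, (∀ φ ∈ T, φ.Sat M Env.nil) → ψ.Sat M Env.nil) : Proves T ψ := by
  by_contra hψ
  have hcon : Consistent T (⋃ n, henkinSet e ψ n) := by
    intro L hL
    have : ∃ n, ∀ A ∈ L, A ∈ henkinSet e ψ n := by
      induction L with
      | nil => exact ⟨0, by simp⟩
      | cons B L ih =>
        obtain ⟨n, hn⟩ := ih fun A hA => hL A (List.mem_cons_of_mem _ hA)
        obtain ⟨m, hm⟩ := Set.mem_iUnion.1 (hL B List.mem_cons_self)
        have mono : ∀ {i j : ℕ}, i ≤ j → henkinSet e ψ i ⊆ henkinSet e ψ j := by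
          rintro i j hij B (hB | ⟨ρ, A, hA, hB⟩)
          · exact Or.inl hB
          · exact Or.inr ⟨ρ, A, hA.trans_le hij, hB⟩
        refine ⟨max n m, fun A hA => ?_⟩
        rcases List.mem_cons.1 hA with rfl | hA
        · exact mono (le_max_right _ _) hm
        · exact mono (le_max_left _ _) (hn A hA)
    obtain ⟨n, hn⟩ := this
    exact consistent_henkinSet he inh hψ n L hn
  obtain ⟨S, hsub, hS⟩ := hcon.exists_maximal
  have hH : ∀ (ρ : Ty) (A : Fm (WithNames K) [ρ]), henkinAxiom e A ∈ S := fun ρ A =>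
    hsub (Set.mem_iUnion.2 ⟨henkinName e A + 1, Or.inr ⟨ρ, A, Nat.lt_succ_self _, rfl⟩⟩)
  have hsat : ∀ A : Fm K [], A.Sat (termStr S) Env.nil ↔ A.lift ∈ S := by
    intro A
    rw [sat_termStr hS hH, Fm.lift]
    exact iff_of_eq (congrArg (fun s => A.tr CSub.incl s ∈ S) (Sub.eq_empty _))
  have h₁ : ψ.lift ∈ S := (hsat ψ).1 (h _ fun φ hφ => (hsat φ).2 (mem_of_prov hS (L := [])
    (by simp) (Fm.ofSentence_nil φ.lift ▸ .ax ⟨φ, hφ, rfl⟩)))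
  have h₂ : ψ.lift.neg ∈ S := hsub (Set.mem_iUnion.2 ⟨0, Or.inl rfl⟩)
  exact bot_notMem hS ((imp_mem_iff hS).1 h₂ h₁)

end Henkin

/-! ### Satisfaction of the defined formulas -/

section Sat

variable {K : Ty → Type} {M : Str K} {Γ Δ : Ctx} {ρ τ : Ty}

@[simp] theorem Env.cons_zero {D : Ty → Type} (d : D ρ) (γ : Env D Γ) :
    Env.cons d γ ρ .zero = d := rfl

@[simp] theorem Env.cons_succ {D : Ty → Type} (d : D ρ) (γ : Env D Γ) (x : Var Γ τ) :
    Env.cons d γ τ x.succ = γ τ x := rfl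

theorem Env.eq_nil {D : Ty → Type} (γ : Env D []) : γ = Env.nil := by
  funext σ x
  exact nomatch x

@[simp] theorem Tm.eval_var (γ : Env M.D Γ) (x : Var Γ ρ) : (Tm.var x).eval M γ = γ ρ x := rfl

@[simp] theorem Tm.eval_const (γ : Env M.D Γ) (c : K ρ) :
    (Tm.const c : Tm K Γ ρ).eval M γ = M.const c := rfl

@[simp] theorem Tm.eval_app (γ : Env M.D Γ) (t : Tm K Γ (ρ ⇾ τ)) (u : Tm K Γ ρ) :
    (t ⬝ u).eval M γ = M.app (t.eval M γ) (u.eval M γ) := rfl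

theorem Tm.eval_rename (r : Ren Γ Δ) (γ : Env M.D Δ) (t : Tm K Γ ρ) :
    (t.rename r).eval M γ = t.eval M fun _ x => γ _ (r _ x) := by
  induction t with
  | var x => rfl
  | const c => rfl
  | app t u iht ihu => simp only [Tm.rename, Tm.eval, iht, ihu]

@[simp] theorem Tm.eval_wk (d : M.D τ) (γ : Env M.D Γ) (t : Tm K Γ ρ) :
    t.wk.eval M (Env.cons d γ) = t.eval M γ :=
  Tm.eval_rename _ _ _

theorem Tm.eval_subst (s : Sub K Γ Δ) (γ : Env M.D Δ) (t : Tm K Γ ρ) :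
    (t.subst s).eval M γ = t.eval M fun _ x => (s _ x).eval M γ := by
  induction t with
  | var x => rfl
  | const c => rfl
  | app t u iht ihu => simp only [Tm.subst, Tm.eval, iht, ihu]

@[simp] theorem eval_v0 (a : M.D ρ) (γ : Env M.D Γ) : (v0 : Tm K _ _).eval M (Env.cons a γ) = a :=
  rfl

@[simp] theorem eval_v1 {σ : Ty} (b : M.D σ) (a : M.D ρ) (γ : Env M.D Γ) :
    (v1 : Tm K _ _).eval M (Env.cons b (Env.cons a γ)) = a :=
  rfl

@[simp] theorem eval_v2 {σ σ' : Ty} (c : M.D σ') (b : M.D σ) (a : M.D ρ) (γ : Env M.D Γ) :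
    (v2 : Tm K _ _).eval M (Env.cons c (Env.cons b (Env.cons a γ))) = a :=
  rfl

@[simp] theorem sat_bot (γ : Env M.D Γ) : ¬ (Fm.bot : Fm K Γ).Sat M γ := id

@[simp] theorem sat_imp (γ : Env M.D Γ) (A B : Fm K Γ) :
    (A →ᶠ B).Sat M γ ↔ (A.Sat M γ → B.Sat M γ) := Iff.rfl

@[simp] theorem sat_all (γ : Env M.D Γ) (A : Fm K (ρ :: Γ)) :
    (Fm.all ρ A).Sat M γ ↔ ∀ d : M.D ρ, A.Sat M (Env.cons d γ) := Iff.rfl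

@[simp] theorem sat_neg (γ : Env M.D Γ) (A : Fm K Γ) : (¬ᶠ A).Sat M γ ↔ ¬ A.Sat M γ := Iff.rfl

@[simp] theorem sat_and (γ : Env M.D Γ) (A B : Fm K Γ) :
    (A ∧ᶠ B).Sat M γ ↔ A.Sat M γ ∧ B.Sat M γ := by
  simp only [Fm.and, sat_neg, sat_imp, Classical.not_imp, not_not]

@[simp] theorem sat_or (γ : Env M.D Γ) (A B : Fm K Γ) :
    (A ∨ᶠ B).Sat M γ ↔ A.Sat M γ ∨ B.Sat M γ := by
  simp only [Fm.or, sat_neg, sat_imp, or_iff_not_imp_left]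

@[simp] theorem sat_iff (γ : Env M.D Γ) (A B : Fm K Γ) :
    (A ↔ᶠ B).Sat M γ ↔ (A.Sat M γ ↔ B.Sat M γ) := by
  simp only [Fm.iff, sat_and, sat_imp, iff_iff_implies_and_implies]

@[simp] theorem sat_ex (γ : Env M.D Γ) (A : Fm K (ρ :: Γ)) :
    (Fm.ex ρ A).Sat M γ ↔ ∃ d : M.D ρ, A.Sat M (Env.cons d γ) := by
  simp only [Fm.ex, sat_neg, sat_all, not_forall, not_not]

theorem sat_subst (s : Sub K Γ Δ) (γ : Env M.D Δ) (A : Fm K Γ) :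
    (A.subst s).Sat M γ ↔ A.Sat M fun _ x => (s _ x).eval M γ := by
  induction A generalizing Δ with
  | eq t u => simp only [Fm.subst, Fm.Sat, Tm.eval_subst]
  | lt t u => simp only [Fm.subst, Fm.Sat, Tm.eval_subst]
  | bot => rfl
  | imp A B ihA ihB => simp only [Fm.subst, Fm.Sat, ihA, ihB]
  | all ρ A ih =>
    simp only [Fm.subst, Fm.Sat, ih]
    refine forall_congr' fun d => iff_of_eq (congrArg (fun γ' => A.Sat M γ') ?_)
    funext σ x
    cases x with
    | zero => rfl
    | succ x => exact Tm.eval_wk _ _ _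

theorem sat_close (A : Fm K Γ) : A.close.Sat M Env.nil ↔ ∀ γ, A.Sat M γ := by
  induction Γ with
  | nil => exact ⟨fun h γ => Env.eq_nil γ ▸ h, fun h => h _⟩
  | cons ρ Γ ih =>
    rw [Fm.close, ih]
    refine ⟨fun h γ => ?_, fun h γ d => h _⟩
    convert h (fun _ x => γ _ x.succ) (γ _ .zero)
    funext σ x
    cases x <;> rfl

/-- Pointwise equality. -/
def Str.EqAt {K : Ty → Type} (M : Str K) : ∀ τ : Ty, M.D τ → M.D τ → Prop
  | .nat, a, b => M.eqv a b
  | .arr σ τ, a, b => ∀ x : M.D σ, M.EqAt τ (M.app a x) (M.app b x)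

end Sat

/-! ### Division by pointwise equality; extensional models. -/

section Extensional

variable {M : Str LConst} {Γ : Ctx}

theorem sat_eqAt (τ : Ty) (s t : Term Γ τ) (γ : Env M.D Γ) :
    (eqAt τ s t).Sat M γ ↔ M.EqAt τ (s.eval M γ) (t.eval M γ) := by
  induction τ generalizing Γ with
  | nat => rfl
  | arr σ τ _ ih =>
    simp only [eqAt, sat_all, ih, Tm.eval_app, Tm.eval_wk, eval_v0]
    rfl

theorem sat_semiring (hM : ∀ φ ∈ RCA, φ.Sat M Env.nil) (i : ℕ) (hi : i < semiringAxioms.length)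
    (a b c : M.D T0) :
    (semiringAxioms[i]).Sat M (Env.cons a (Env.cons b (Env.cons c Env.nil))) :=
  (sat_close _).1 (hM _ (.semiring (List.getElem_mem hi))) _

theorem eqAt_equivalence (hM : ∀ φ ∈ RCA, φ.Sat M Env.nil) (τ : Ty) : Equivalence (M.EqAt τ) := by
  induction τ with
  | nat =>
    have h₀ := fun a b c => sat_semiring hM 0 (by decide) a b c
    have h₁ := fun a b c => sat_semiring hM 1 (by decide) a b c
    have h₂ := fun a b c => sat_semiring hM 2 (by decide) a b c
    exact ⟨fun a => h₀ a a a, fun {a b} => h₁ a b a, fun {a b c} => h₂ a b c⟩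
  | arr σ τ _ ih =>
    exact ⟨fun a x => ih.refl _, fun h x => ih.symm (h x), fun h₁ h₂ x => ih.trans (h₁ x) (h₂ x)⟩

/-- This is where the extensionality axiom enters: it changes the argument, while a change of the
function is pointwise equality itself. Application therefore descends to the quotient. -/
theorem eqAt_app (hM : ∀ φ ∈ RCA, φ.Sat M Env.nil) {σ τ : Ty} {f g : M.D (σ ⇾ τ)} {x y : M.D σ}
    (hf : M.EqAt (σ ⇾ τ) f g) (hx : M.EqAt σ x y) : M.EqAt τ (M.app f x) (M.app g y) := by
  have h := (sat_close _).1 (hM _ (.ext σ τ)) (Env.cons f (Env.cons y (Env.cons x Env.nil)))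
  simp only [sat_imp, sat_eqAt, eval_v0, eval_v1, eval_v2, Tm.eval_app] at h
  exact (eqAt_equivalence hM τ).trans (h hx) (hf y)

def eqAtSetoid (hM : ∀ φ ∈ RCA, φ.Sat M Env.nil) (τ : Ty) : Setoid (M.D τ) :=
  ⟨M.EqAt τ, eqAt_equivalence hM τ⟩

/-- The quotient by pointwise equality. -/
def Str.collapse (M : Str LConst) (hM : ∀ φ ∈ RCA, φ.Sat M Env.nil) : Str LConst where
  D τ := Quotient (eqAtSetoid hM τ)
  app := Quotient.map₂ M.app fun _ _ hf _ _ hx => eqAt_app hM hf hx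
  const c := Quotient.mk _ (M.const c)
  eqv := Eq
  lt := Quotient.lift₂ M.lt fun a b a' b' ha hb => propext (by
    have l := fun a b c => sat_semiring hM 3 (by decide) a b c
    have r := fun a b c => sat_semiring hM 4 (by decide) a b c
    have ha' := (eqAt_equivalence hM T0).symm ha
    have hb' := (eqAt_equivalence hM T0).symm hb
    exact ⟨fun h => r b b' a' hb (l a a' b ha h), fun h => r b' b a hb' (l a' a b' ha' h)⟩)

variable (hM : ∀ φ ∈ RCA, φ.Sat M Env.nil)

theorem eval_collapse {ρ : Ty} (γ : Env M.D Γ) (t : Term Γ ρ) :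
    t.eval (M.collapse hM) (fun _ x => Quotient.mk _ (γ _ x)) = Quotient.mk _ (t.eval M γ) := by
  induction t with
  | var x => rfl
  | const c => rfl
  | app t u iht ihu => simp only [Tm.eval, iht, ihu]; rfl

theorem sat_collapse (γ : Env M.D Γ) (A : Formula Γ) :
    A.Sat (M.collapse hM) (fun _ x => Quotient.mk _ (γ _ x)) ↔ A.Sat M γ := by
  induction A with
  | eq t u =>
    simp only [Fm.Sat, eval_collapse]
    exact Quotient.eq
  | lt t u =>
    simp only [Fm.Sat, eval_collapse]
    rfl
  | bot => rfl
  | imp A B ihA ihB => simp only [Fm.Sat, ihA, ihB]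
  | all ρ A ih =>
    simp only [Fm.Sat]
    refine Quotient.forall.trans (forall_congr' fun d => ?_)
    rw [← ih]
    refine iff_of_eq (congrArg (fun γ' => A.Sat (M.collapse hM) γ') ?_)
    funext σ x
    cases x <;> rfl

/-- Extensional models of `RCA₀^ω`. -/
structure Model extends Str LConst where
  eqv_iff : ∀ {a b : D T0}, eqv a b ↔ a = b
  ext : ∀ {σ τ : Ty} {f g : D (σ ⇾ τ)}, (∀ x, app f x = app g x) → f = g
  rca : ∀ φ ∈ RCA, φ.Sat toStr Env.nil

/-- At a fixed type the type parameters of a constant are determined, so the kind of the constant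
identifies it. -/
def LConst.tag : ∀ ρ : Ty, LConst ρ → ℕ
  | _, .zero => 0
  | _, .one => 1
  | _, .add => 2
  | _, .mul => 3
  | _, .combK _ _ => 4
  | _, .combS _ _ _ => 5
  | _, .recursor _ => 6

theorem LConst.tag_injective (ρ : Ty) : Function.Injective (LConst.tag ρ) := by
  intro a b h
  cases a <;> cases b <;> first | rfl | simp [LConst.tag] at h

def closedTerm : ∀ ρ : Ty, Term [] ρ
  | .nat => tZero
  | .arr σ τ => .const (.combK τ σ) ⬝ closedTerm τ

/-- Completeness with respect to extensional models. -/
theorem proves_of_models {T : Set Sentence} (hT : RCA ⊆ T) {ψ : Sentence}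
    (h : ∀ M : Model, (∀ φ ∈ T, φ.Sat M.toStr Env.nil) → ψ.Sat M.toStr Env.nil) : T ⊢ᶠ ψ := by
  refine proves_of_valid LConst.tag_injective closedTerm fun M hM => ?_
  have hR : ∀ φ ∈ RCA, φ.Sat M Env.nil := fun φ hφ => hM φ (hT hφ)
  have key : ∀ φ : Sentence, φ.Sat (M.collapse hR) Env.nil ↔ φ.Sat M Env.nil := by
    intro φ
    rw [← sat_collapse hR]
    exact iff_of_eq (congrArg (fun γ => φ.Sat (M.collapse hR) γ) (Env.eq_nil _).symm)
  rw [← key]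
  refine h ⟨M.collapse hR, Iff.rfl, ?_, fun φ hφ => (key φ).2 (hR φ hφ)⟩
    fun φ hφ => (key φ).2 (hM φ hφ)
  intro σ τ f g hfg
  induction f using Quotient.inductionOn with | _ f
  induction g using Quotient.inductionOn with | _ g
  exact Quotient.sound fun x => Quotient.exact (hfg (Quotient.mk _ x))

end Extensional

/-! ### Basic properties of models -/

namespace Model

variable (M : Model)

instance (σ τ : Ty) : CoeFun (M.D (σ ⇾ τ)) fun _ => M.D σ → M.D τ := ⟨M.app⟩

variable {M} {Γ : Ctx}

@[simp] theorem sat_eq (γ : Env M.D Γ) (t u : Term Γ T0) :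
    (t =₀ u).Sat M.toStr γ ↔ t.eval M.toStr γ = u.eval M.toStr γ :=
  M.eqv_iff

theorem eqAt_iff {τ : Ty} {a b : M.D τ} : M.EqAt τ a b ↔ a = b := by
  induction τ with
  | nat => exact M.eqv_iff
  | arr σ τ _ ih => exact ⟨fun h => M.ext fun x => ih.1 (h x), fun h x => ih.2 (h ▸ rfl)⟩

@[simp] theorem sat_eqAt {τ : Ty} (γ : Env M.D Γ) (t u : Term Γ τ) :
    (eqAt τ t u).Sat M.toStr γ ↔ t.eval M.toStr γ = u.eval M.toStr γ := by
  rw [HOA.sat_eqAt, eqAt_iff]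

instance : Zero (M.D T0) := ⟨M.const .zero⟩
instance : One (M.D T0) := ⟨M.const .one⟩
instance : Add (M.D T0) := ⟨fun a b => (M.const .add : M.D (T0 ⇾ T0 ⇾ T0)) a b⟩
instance : Mul (M.D T0) := ⟨fun a b => (M.const .mul : M.D (T0 ⇾ T0 ⇾ T0)) a b⟩
instance : LT (M.D T0) := ⟨M.lt⟩
instance : LE (M.D T0) := ⟨fun a b => a < b ∨ a = b⟩

@[simp] theorem eval_zero (γ : Env M.D Γ) : tZero.eval M.toStr γ = 0 := rfl
@[simp] theorem eval_one (γ : Env M.D Γ) : tOne.eval M.toStr γ = 1 := rfl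
@[simp] theorem eval_add (γ : Env M.D Γ) (s t : Term Γ T0) :
    (s +₀ t).eval M.toStr γ = s.eval M.toStr γ + t.eval M.toStr γ := rfl
@[simp] theorem eval_mul (γ : Env M.D Γ) (s t : Term Γ T0) :
    (s *₀ t).eval M.toStr γ = s.eval M.toStr γ * t.eval M.toStr γ := rfl
@[simp] theorem sat_lt' (γ : Env M.D Γ) (s t : Term Γ T0) :
    (s <₀ t).Sat M.toStr γ ↔ s.eval M.toStr γ < t.eval M.toStr γ := Iff.rfl
@[simp] theorem sat_le (γ : Env M.D Γ) (s t : Term Γ T0) :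
    (s ⩽₀ t).Sat M.toStr γ ↔ s.eval M.toStr γ ≤ t.eval M.toStr γ := by
  simp only [leF, sat_or, sat_lt', sat_eq]; rfl

theorem axiom_at (i : ℕ) (hi : i < semiringAxioms.length) (a b c : M.D T0) :
    (semiringAxioms[i]).Sat M.toStr (Env.cons a (Env.cons b (Env.cons c Env.nil))) :=
  sat_semiring M.rca i hi a b c

theorem combK_apply {ρ τ : Ty} (x : M.D ρ) (y : M.D τ) :
    (M.const (.combK ρ τ) : M.D (ρ ⇾ τ ⇾ ρ)) x y = x := by
  simpa using (sat_close _).1 (M.rca _ (.combK ρ τ)) (Env.cons y (Env.cons x Env.nil))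

theorem combS_apply {ρ σ τ : Ty} (x : M.D (ρ ⇾ σ ⇾ τ)) (y : M.D (ρ ⇾ σ)) (z : M.D ρ) :
    (M.const (.combS ρ σ τ) : M.D ((ρ ⇾ σ ⇾ τ) ⇾ (ρ ⇾ σ) ⇾ ρ ⇾ τ)) x y z = x z (y z) := by
  simpa using (sat_close _).1 (M.rca _ (.combS ρ σ τ))
    (Env.cons z (Env.cons y (Env.cons x Env.nil)))

/-- Primitive recursion. -/
def primRec (f : M.D (T0 ⇾ T0 ⇾ T0)) (a n : M.D T0) : M.D T0 :=
  (M.const (.recursor T0) : M.D ((T0 ⇾ T0 ⇾ T0) ⇾ T0 ⇾ T0 ⇾ T0)) f a n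

theorem primRec_zero (f : M.D (T0 ⇾ T0 ⇾ T0)) (a : M.D T0) : primRec f a 0 = a := by
  simpa [primRec] using (sat_close _).1 (M.rca _ .rec_zero) (Env.cons a (Env.cons f Env.nil))

theorem primRec_succ (f : M.D (T0 ⇾ T0 ⇾ T0)) (a n : M.D T0) : primRec f a (n + 1) = f n (primRec f a n) := by
  simpa [primRec] using (sat_close _).1 (M.rca _ .rec_succ) (Env.cons n (Env.cons a (Env.cons f Env.nil)))

/-! #### The ordered semiring of numbers -/

noncomputable instance : CommSemiring (M.D T0) :=
  have add_comm : ∀ a b : M.D T0, a + b = b + a := fun a b => by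
    simpa [semiringAxioms] using axiom_at 6 (by decide) a b a
  have add_zero : ∀ a : M.D T0, a + 0 = a := fun a => by
    simpa [semiringAxioms] using axiom_at 7 (by decide) a a a
  have mul_comm : ∀ a b : M.D T0, a * b = b * a := fun a b => by
    simpa [semiringAxioms] using axiom_at 9 (by decide) a b a
  have mul_one : ∀ a : M.D T0, a * 1 = a := fun a => by
    simpa [semiringAxioms] using axiom_at 10 (by decide) a a a
  have mul_zero : ∀ a : M.D T0, a * 0 = 0 := fun a => by
    simpa [semiringAxioms] using axiom_at 11 (by decide) a a a
  have mul_add : ∀ a b c : M.D T0, a * (b + c) = a * b + a * c := fun a b c => by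
    simpa [semiringAxioms] using axiom_at 12 (by decide) a b c
  { add_assoc := fun a b c => by simpa [semiringAxioms] using axiom_at 5 (by decide) a b c
    zero_add := fun a => by rw [add_comm, add_zero]
    add_zero
    add_comm
    nsmul := nsmulRec
    mul_assoc := fun a b c => by simpa [semiringAxioms] using axiom_at 8 (by decide) a b c
    one_mul := fun a => by rw [mul_comm, mul_one]
    mul_one
    mul_comm
    zero_mul := fun a => by rw [mul_comm, mul_zero]
    mul_zero
    left_distrib := mul_add
    right_distrib := fun a b c => by rw [mul_comm, mul_add, mul_comm c a, mul_comm c b] }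

theorem lt_irrefl' (a : M.D T0) : ¬ a < a := by
  simpa [semiringAxioms] using axiom_at 13 (by decide) a a a

theorem lt_trans' {a b c : M.D T0} : a < b → b < c → a < c := by
  simpa [semiringAxioms] using axiom_at 14 (by decide) a b c

theorem trichotomy (a b : M.D T0) : a < b ∨ a = b ∨ b < a := by
  simpa [semiringAxioms] using axiom_at 15 (by decide) a b a

noncomputable instance : LinearOrder (M.D T0) where
  le_refl a := Or.inr rfl
  le_trans a b c hab hbc := by
    rcases hab with hab | rfl
    · rcases hbc with hbc | rfl
      · exact Or.inl (lt_trans' hab hbc)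
      · exact Or.inl hab
    · exact hbc
  le_antisymm a b hab hba := by
    rcases hab with hab | rfl
    · rcases hba with hba | rfl
      · exact absurd (lt_trans' hab hba) (lt_irrefl' a)
      · rfl
    · rfl
  lt_iff_le_not_ge a b := by
    constructor
    · refine fun h => ⟨Or.inl h, ?_⟩
      rintro (h' | rfl)
      · exact lt_irrefl' _ (lt_trans' h h')
      · exact lt_irrefl' _ h
    · rintro ⟨h | rfl, h'⟩
      · exact h
      · exact absurd (Or.inr rfl) h'
  le_total a b := by
    rcases trichotomy a b with h | rfl | h
    · exact Or.inl (Or.inl h)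
    · exact Or.inl (Or.inr rfl)
    · exact Or.inr (Or.inl h)
  toDecidableLE := Classical.decRel _

theorem zero_le' (a : M.D T0) : 0 ≤ a := by
  simpa [semiringAxioms] using axiom_at 18 (by decide) a a a

theorem lt_iff_add_one_le {a b : M.D T0} : a < b ↔ a + 1 ≤ b := by
  simpa [semiringAxioms] using axiom_at 19 (by decide) a b a

theorem add_lt_add_right' {a b : M.D T0} (h : a < b) (c : M.D T0) : a + c < b + c := by
  have : a < b → a + c < b + c := by
    simpa [semiringAxioms] using axiom_at 16 (by decide) a b c
  exact this h

theorem mul_lt_mul_right' {a b c : M.D T0} (h : a < b) (hc : 0 < c) : a * c < b * c := by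
  have : a < b → 0 < c → a * c < b * c := by
    simpa [semiringAxioms] using axiom_at 17 (by decide) a b c
  exact this h hc

instance : IsOrderedCancelAddMonoid (M.D T0) where
  add_le_add_left a b h c := by
    rcases h with h | rfl
    · exact Or.inl (add_lt_add_right' h c)
    · exact le_rfl
  le_of_add_le_add_left a b c h := by
    by_contra hbc
    have := add_lt_add_right' (not_le.1 hbc) a
    rw [add_comm c, add_comm b] at this
    exact absurd h (not_le.2 this)

theorem lt_add_one' (a : M.D T0) : a < a + 1 := lt_iff_add_one_le.2 le_rfl

instance : Nontrivial (M.D T0) := ⟨0, 0 + 1, (lt_add_one' 0).ne⟩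

instance : IsStrictOrderedRing (M.D T0) where
  zero_le_one := zero_le' 1
  mul_lt_mul_of_pos_left c hc a b h := by
    have := mul_lt_mul_right' h hc
    rwa [mul_comm a, mul_comm b] at this
  mul_lt_mul_of_pos_right c hc a b h := mul_lt_mul_right' h hc

theorem lt_add_one_iff' {a b : M.D T0} : a < b + 1 ↔ a ≤ b := by
  rw [lt_iff_add_one_le, add_le_add_iff_right]

/-! ### Definable maps -/

/-- The structure in which every element is named by a constant. -/
def par (M : Model) : Str M.D where
  D := M.D
  app := M.app
  const c := c
  eqv := M.eqv
  lt := M.lt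

/-- Environment-indexed families given by terms with parameters. -/
def IsTerm {Γ : Ctx} {τ : Ty} (f : Env M.D Γ → M.D τ) : Prop :=
  ∃ t : Tm M.D Γ τ, ∀ γ, f γ = t.eval M.par γ

/-- Combinatory completeness by bracket abstraction, `Σ Π Π` being the identity. -/
theorem exists_abstraction {Γ : Ctx} {σ τ : Ty} (t : Tm M.D (σ :: Γ) τ) :
    ∃ u : Tm M.D Γ (σ ⇾ τ), ∀ (γ : Env M.D Γ) (x : M.D σ),
      M.app (u.eval M.par γ) x = t.eval M.par (Env.cons x γ) := by
  induction t with
  | var x =>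
    cases x with
    | zero =>
      refine ⟨.const (M.app (M.app (M.const (.combS σ (σ ⇾ σ) σ)) (M.const (.combK σ (σ ⇾ σ))))
        (M.const (.combK σ σ))), fun γ x => ?_⟩
      exact (combS_apply _ _ _).trans (combK_apply _ _)
    | succ y => exact ⟨.const (M.const (.combK _ _)) ⬝ .var y, fun γ x => combK_apply _ _⟩
  | const c => exact ⟨.const (M.const (.combK _ _)) ⬝ .const c, fun γ x => combK_apply _ _⟩
  | app t₁ t₂ ih₁ ih₂ =>
    obtain ⟨u₁, h₁⟩ := ih₁
    obtain ⟨u₂, h₂⟩ := ih₂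
    refine ⟨.const (M.const (.combS _ _ _)) ⬝ u₁ ⬝ u₂, fun γ x => (combS_apply _ _ _).trans ?_⟩
    rw [h₁, h₂]
    rfl

/-- Types with a notion of definable family. -/
class Obj (M : Model) (X : Type) where
  curve : ∀ Γ : Ctx, (Env M.D Γ → X) → Prop
  const : ∀ (Γ : Ctx) (x : X), curve Γ fun _ => x
  wk : ∀ {Γ : Ctx} {c : Env M.D Γ → X} (σ : Ty), curve Γ c →
    curve (σ :: Γ) fun γ => c fun _ x => γ _ x.succ

/-- Families are indexed by environments of arbitrary contexts, so a definable map can be evaluated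
under additional variables; `Dfn.lam` depends on this. -/
instance (τ : Ty) : Obj M (M.D τ) where
  curve _ f := IsTerm f
  const _ x := ⟨.const x, fun _ => rfl⟩
  wk _ := fun ⟨t, ht⟩ => ⟨t.wk, fun _ => (ht _).trans (Tm.eval_rename _ _ _).symm⟩

instance {X Y : Type} [Obj M X] [Obj M Y] : Obj M (X × Y) where
  curve Γ c := Obj.curve Γ (fun γ => (c γ).1) ∧ Obj.curve Γ fun γ => (c γ).2
  const Γ x := ⟨Obj.const Γ x.1, Obj.const Γ x.2⟩
  wk σ h := ⟨Obj.wk σ h.1, Obj.wk σ h.2⟩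

/-- Decidable predicates: those with a definable characteristic function. -/
instance : Obj M Prop where
  curve _ P := ∃ f, IsTerm (τ := T0) f ∧ ∀ γ, P γ ↔ f γ = 0
  const _ p := by
    by_cases h : p
    · exact ⟨fun _ => 0, ⟨.const 0, fun _ => rfl⟩, fun _ => by simp [h]⟩
    · exact ⟨fun _ => 1, ⟨.const 1, fun _ => rfl⟩, fun _ => by simp [h]⟩
  wk _ := fun ⟨f, ⟨t, ht⟩, h⟩ => ⟨fun γ => f fun _ x => γ _ x.succ,
    ⟨t.wk, fun _ => (ht _).trans (Tm.eval_rename _ _ _).symm⟩, fun _ => h _⟩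

/-- Definable maps. -/
@[fun_prop]
def Dfn (M : Model) {X Y : Type} [Obj M X] [Obj M Y] (f : X → Y) : Prop :=
  ∀ (Γ : Ctx) (c : Env M.D Γ → X), Obj.curve Γ c → Obj.curve Γ fun γ => f (c γ)

section Dfn

variable {X Y Z : Type} [Obj M X] [Obj M Y] [Obj M Z] {σ τ : Ty}

@[fun_prop] theorem Dfn.id : Dfn M fun x : X => x := fun _ _ h => h

@[fun_prop] theorem Dfn.const (y : Y) : Dfn M fun _ : X => y := fun Γ _ _ => Obj.const Γ y

@[fun_prop] theorem Dfn.comp {f : Y → Z} {g : X → Y} (hf : Dfn M f) (hg : Dfn M g) :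
    Dfn M fun x => f (g x) := fun Γ _ h => hf Γ _ (hg Γ _ h)

@[fun_prop] theorem Dfn.fst : Dfn M fun p : X × Y => p.1 := fun _ _ h => h.1

@[fun_prop] theorem Dfn.snd : Dfn M fun p : X × Y => p.2 := fun _ _ h => h.2

@[fun_prop] theorem Dfn.prodMk {f : X → Y} {g : X → Z} (hf : Dfn M f) (hg : Dfn M g) :
    Dfn M fun x => (f x, g x) := fun Γ c h => ⟨hf Γ c h, hg Γ c h⟩

@[fun_prop] theorem Dfn.app {f : X → M.D (σ ⇾ τ)} {g : X → M.D σ} (hf : Dfn M f) (hg : Dfn M g) :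
    Dfn M fun x => M.app (f x) (g x) := by
  intro Γ c h
  obtain ⟨t, ht⟩ := hf Γ c h
  obtain ⟨u, hu⟩ := hg Γ c h
  exact ⟨t ⬝ u, fun γ => congrArg₂ M.app (ht γ) (hu γ)⟩

theorem Dfn.exists_rep {f : M.D σ → M.D τ} (hf : Dfn M f) :
    ∃ e : M.D (σ ⇾ τ), ∀ x, e x = f x := by
  obtain ⟨t, ht⟩ := hf [σ] (fun γ => γ _ .zero) ⟨.var .zero, fun _ => rfl⟩
  obtain ⟨u, hu⟩ := exists_abstraction t
  exact ⟨u.eval M.par Env.nil, fun x => (hu _ x).trans (ht _).symm⟩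

open Classical in
/-- The element of the model that represents the definable map `f`. -/
noncomputable def lam (f : M.D σ → M.D τ) : M.D (σ ⇾ τ) :=
  if h : Dfn M f then h.exists_rep.choose else (closedTerm _).eval M.toStr Env.nil

theorem lam_apply {f : M.D σ → M.D τ} (hf : Dfn M f) (x : M.D σ) : lam f x = f x := by
  rw [lam, dif_pos hf]
  exact hf.exists_rep.choose_spec x

theorem Dfn.section {f : X → Y → Z} (hf : Dfn M fun p : X × Y => f p.1 p.2) (x : X) :
    Dfn M (f x) :=
  hf.comp (g := fun y => (x, y)) (by fun_prop)

-- The abstracted term and the representative chosen by `lam` agree pointwise, and extensionality of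
-- the model identifies them.
@[fun_prop] theorem Dfn.lam {f : X → M.D σ → M.D τ} (hf : Dfn M fun p : X × M.D σ => f p.1 p.2) :
    Dfn M fun x => lam (f x) := by
  intro Γ c hc
  obtain ⟨t, ht⟩ := hf (σ :: Γ) (fun γ => (c fun _ x => γ _ x.succ, γ _ .zero))
    ⟨Obj.wk σ hc, ⟨.var .zero, fun _ => rfl⟩⟩
  obtain ⟨u, hu⟩ := exists_abstraction t
  refine ⟨u, fun γ => M.ext fun x => ?_⟩
  rw [lam_apply (hf.section (c γ)), hu]
  exact ht (Env.cons x γ)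

@[fun_prop] theorem Dfn.add {f g : X → M.D T0} (hf : Dfn M f) (hg : Dfn M g) :
    Dfn M fun x => f x + g x :=
  Dfn.app (Dfn.app (Dfn.const (M.const .add : M.D (T0 ⇾ T0 ⇾ T0))) hf) hg

@[fun_prop] theorem Dfn.mul {f g : X → M.D T0} (hf : Dfn M f) (hg : Dfn M g) :
    Dfn M fun x => f x * g x :=
  Dfn.app (Dfn.app (Dfn.const (M.const .mul : M.D (T0 ⇾ T0 ⇾ T0))) hf) hg

/-- Primitive recursion for definable step functions. -/
noncomputable def natRec (f : M.D T0 → M.D T0 → M.D T0) (a n : M.D T0) : M.D T0 :=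
  primRec (Model.lam fun k => Model.lam fun r => f k r) a n

theorem natRec_zero (f : M.D T0 → M.D T0 → M.D T0) (a : M.D T0) : natRec f a 0 = a := primRec_zero _ _

theorem natRec_succ {f : M.D T0 → M.D T0 → M.D T0}
    (hf : Dfn M fun p : M.D T0 × M.D T0 => f p.1 p.2) (a n : M.D T0) :
    natRec f a (n + 1) = f n (natRec f a n) := by
  rw [natRec, primRec_succ, lam_apply (by fun_prop), lam_apply (hf.section n)]
  rfl

@[fun_prop] theorem Dfn.natRec {f : X → M.D T0 → M.D T0 → M.D T0} {a n : X → M.D T0}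
    (hf : Dfn M fun p : (X × M.D T0) × M.D T0 => f p.1.1 p.1.2 p.2) (ha : Dfn M a) (hn : Dfn M n) :
    Dfn M fun x => natRec (f x) (a x) (n x) :=
  Dfn.app (Dfn.app (Dfn.app (Dfn.const _) (Dfn.lam (Dfn.lam hf))) ha) hn

end Dfn

/-! ### Induction, decidable predicates, choice -/

/-- The first facts about predecessor and truncated subtraction need induction on explicit formulas,
because the calculus of decidable predicates rests on them; `induct` takes over afterwards. -/
theorem induction_formula {Γ : Ctx} (A : Formula (T0 :: Γ)) (hA : A.QF) (γ : Env M.D Γ)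
    (h₀ : A.Sat M.toStr (Env.cons (0 : M.D T0) γ))
    (hs : ∀ n : M.D T0, A.Sat M.toStr (Env.cons n γ) → A.Sat M.toStr (Env.cons (n + 1) γ))
    (n : M.D T0) : A.Sat M.toStr (Env.cons n γ) := by
  have h := (sat_close _).1 (M.rca _ (.induction A hA)) γ
  simp only [inductionFor, sat_imp, sat_all, Fm.inst, sat_subst] at h
  refine h ?_ (fun k hk => ?_) n
  · convert h₀ using 1
    funext σ x
    cases x <;> rfl
  · convert hs k hk using 1
    funext σ x
    cases x <;> rfl

noncomputable def pred (n : M.D T0) : M.D T0 := natRec (fun k _ => k) 0 n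

section
variable {X : Type} [Obj M X]

@[fun_prop] theorem Dfn.pred {f : X → M.D T0} (hf : Dfn M f) : Dfn M fun x => pred (f x) := by
  unfold Model.pred
  fun_prop

theorem pred_zero : pred (0 : M.D T0) = 0 := natRec_zero _ _

theorem pred_succ (n : M.D T0) : pred (n + 1) = n := natRec_succ (by fun_prop) _ _

/-- Truncated subtraction. -/
noncomputable def monus (a b : M.D T0) : M.D T0 := natRec (fun _ r => pred r) a b

@[fun_prop] theorem Dfn.monus {f g : X → M.D T0} (hf : Dfn M f) (hg : Dfn M g) :
    Dfn M fun x => monus (f x) (g x) := by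
  unfold Model.monus
  fun_prop

theorem monus_zero (a : M.D T0) : monus a 0 = a := natRec_zero _ _

theorem monus_succ (a b : M.D T0) : monus a (b + 1) = pred (monus a b) :=
  natRec_succ (by fun_prop) _ _

theorem eq_zero_or_pred_add_one (n : M.D T0) : n = 0 ∨ pred n + 1 = n := by
  have h := induction_formula (M := M) (Γ := [T1])
    (v0 =₀ tZero ∨ᶠ v1 ⬝ v0 +₀ tOne =₀ v0) (by simp [Fm.or, Fm.neg, Fm.QF])
    (Env.cons (lam pred) Env.nil)
  have e : ∀ m : M.D T0, lam (M := M) pred m = pred m := lam_apply (by fun_prop)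
  simp only [sat_or, sat_eq, eval_v0, eval_v1, eval_zero, eval_add, eval_one, Tm.eval_app, e] at h
  exact h (Or.inl trivial) (fun m _ => Or.inr (by rw [pred_succ])) n

theorem monus_spec (a n : M.D T0) : monus a n + n = a ∨ monus a n = 0 ∧ a < n := by
  have h := induction_formula (M := M) (Γ := [T0, T1])
    (v2 ⬝ v0 +₀ v0 =₀ v1 ∨ᶠ v2 ⬝ v0 =₀ tZero ∧ᶠ v1 <₀ v0)
    (by simp [Fm.or, Fm.and, Fm.neg, Fm.QF]) (Env.cons a (Env.cons (lam (monus a)) Env.nil))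
  have e : ∀ m : M.D T0, lam (M := M) (monus a) m = monus a m := lam_apply (by fun_prop)
  simp only [sat_or, sat_and, sat_eq, sat_lt', eval_v0, eval_v1, eval_v2, eval_zero, eval_add,
    Tm.eval_app, e] at h
  refine h (Or.inl (by rw [monus_zero, add_zero])) (fun m hm => ?_) n
  rw [monus_succ]
  rcases hm with hm | ⟨hm, hlt⟩
  · rcases eq_zero_or_pred_add_one (monus a m) with h0 | h1
    · refine Or.inr ⟨by rw [h0, pred_zero], ?_⟩
      rw [h0, zero_add] at hm
      rw [← hm]
      exact lt_add_one' m
    · refine Or.inl ?_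
      rw [add_comm m 1, ← add_assoc, h1, hm]
  · exact Or.inr ⟨by rw [hm, pred_zero], hlt.trans (lt_add_one' m)⟩

theorem monus_eq_zero_iff {a b : M.D T0} : monus a b = 0 ↔ a ≤ b := by
  rcases monus_spec a b with h | ⟨h, hlt⟩
  · constructor
    · intro h0
      rw [h0, zero_add] at h
      exact h.ge
    · intro hle
      rw [← h] at hle
      exact le_antisymm (by simpa using hle) (zero_le' _)
  · exact iff_of_true h hlt.le

theorem monus_add_cancel {a b : M.D T0} (h : b ≤ a) : monus a b + b = a :=
  (monus_spec a b).resolve_right fun h' => not_lt.2 h h'.2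

instance : CanonicallyOrderedAdd (M.D T0) where
  exists_add_of_le {a b} h := ⟨monus b a, by rw [add_comm, monus_add_cancel h]⟩
  le_add_self a b := by simpa using zero_le' b
  le_self_add a b := by simpa using zero_le' b

open Classical in
/-- The characteristic value of a proposition: `0` if it is true. -/
noncomputable def chi (p : Prop) : M.D T0 := if p then 0 else 1

theorem chi_eq_zero {p : Prop} : (chi p : M.D T0) = 0 ↔ p := by
  by_cases h : p <;> simp [chi, h]

/-- Any characteristic function `f` becomes `0`-`1`-valued as `1 ∸ (1 ∸ f)`. -/
theorem Dfn.chi' : Dfn M (chi : Prop → M.D T0) := by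
  rintro Γ P ⟨f, ⟨t, ht⟩, h⟩
  have hd : Dfn M fun x : M.D T0 => Model.monus 1 (Model.monus 1 x) := by fun_prop
  obtain ⟨u, hu⟩ := hd Γ f ⟨t, ht⟩
  refine ⟨u, fun γ => ?_⟩
  refine Eq.trans ?_ (hu γ)
  change Model.chi (P γ) = Model.monus 1 (Model.monus 1 (f γ))
  by_cases hp : P γ
  · rw [chi_eq_zero.2 hp, (h γ).1 hp, monus_zero, monus_eq_zero_iff.2 le_rfl]
  · have h1 : 1 ≤ f γ := by
      have := lt_iff_add_one_le.1 (pos_iff_ne_zero.2 fun h0 => hp ((h γ).2 h0))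
      rwa [zero_add] at this
    rw [monus_eq_zero_iff.2 h1, monus_zero, Model.chi, if_neg hp]

@[fun_prop] theorem Dfn.chi {P : X → Prop} (hP : Dfn M P) : Dfn M fun x => (chi (P x) : M.D T0) :=
  Dfn.chi'.comp hP

theorem Dfn.of_char {P : X → Prop} {f : X → M.D T0} (hf : Dfn M f) (h : ∀ x, P x ↔ f x = 0) :
    Dfn M P := fun Γ c hc => ⟨_, hf Γ c hc, fun γ => h (c γ)⟩

theorem Dfn.congr {Y : Type} [Obj M Y] {f g : X → Y} (hg : Dfn M g) (h : ∀ x, f x = g x) :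
    Dfn M f := (funext h : f = g) ▸ hg

@[fun_prop] theorem Dfn.not {P : X → Prop} (hP : Dfn M P) : Dfn M fun x => ¬ P x :=
  .of_char (f := fun x => Model.monus 1 (Model.chi (P x))) (by fun_prop) fun x => by
    by_cases h : P x <;> simp [Model.chi, h, monus_eq_zero_iff]

@[fun_prop] theorem Dfn.and {P Q : X → Prop} (hP : Dfn M P) (hQ : Dfn M Q) :
    Dfn M fun x => P x ∧ Q x :=
  .of_char (f := fun x => Model.chi (P x) + Model.chi (Q x)) (by fun_prop) fun x => by
    simp [chi_eq_zero]

@[fun_prop] theorem Dfn.or {P Q : X → Prop} (hP : Dfn M P) (hQ : Dfn M Q) :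
    Dfn M fun x => P x ∨ Q x :=
  .of_char (f := fun x => Model.chi (P x) * Model.chi (Q x)) (by fun_prop) fun x => by
    simp [chi_eq_zero]

theorem Dfn.imp {P Q : X → Prop} (hP : Dfn M P) (hQ : Dfn M Q) :
    Dfn M fun x => P x → Q x :=
  (hP.not.or hQ).congr fun _ => propext imp_iff_not_or

@[fun_prop] theorem Dfn.le {f g : X → M.D T0} (hf : Dfn M f) (hg : Dfn M g) :
    Dfn M fun x => f x ≤ g x :=
  .of_char (f := fun x => Model.monus (f x) (g x)) (by fun_prop) fun _ => monus_eq_zero_iff.symm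

@[fun_prop] theorem Dfn.lt {f g : X → M.D T0} (hf : Dfn M f) (hg : Dfn M g) :
    Dfn M fun x => f x < g x :=
  (hg.le hf).not.congr fun _ => propext not_le.symm

@[fun_prop] theorem Dfn.eq {f g : X → M.D T0} (hf : Dfn M f) (hg : Dfn M g) :
    Dfn M fun x => f x = g x :=
  ((hf.le hg).and (hg.le hf)).congr fun _ => propext le_antisymm_iff

/-- Induction for decidable predicates. -/
theorem induct {P : M.D T0 → Prop} (hP : Dfn M P) (h₀ : P 0) (hs : ∀ n, P n → P (n + 1))
    (n : M.D T0) : P n := by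
  have h := induction_formula (M := M) (Γ := [T1]) (v1 ⬝ v0 =₀ tZero) trivial
    (Env.cons (lam fun n => chi (P n)) Env.nil)
  have e : ∀ m : M.D T0, lam (M := M) (fun n => chi (P n)) m = chi (P m) :=
    lam_apply (by fun_prop)
  simp only [sat_eq, eval_v0, eval_v1, eval_zero, Tm.eval_app, e, chi_eq_zero] at h
  exact h h₀ hs n

/-- `f 0 + ⋯ + f (n - 1)` -/
noncomputable def sum (f : M.D T0 → M.D T0) (n : M.D T0) : M.D T0 :=
  natRec (fun k r => r + f k) 0 n

theorem Dfn.sum {f : X → M.D T0 → M.D T0} {n : X → M.D T0}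
    (hf : Dfn M fun p : X × M.D T0 => f p.1 p.2) (hn : Dfn M n) :
    Dfn M fun x => sum (f x) (n x) :=
  Dfn.natRec (Dfn.add .snd (hf.comp (g := fun p : (X × M.D T0) × M.D T0 => (p.1.1, p.1.2))
    (by fun_prop))) (.const 0) hn

theorem sum_zero (f : M.D T0 → M.D T0) : sum f 0 = 0 := natRec_zero _ _

theorem sum_succ {f : M.D T0 → M.D T0} (hf : Dfn M f) (n : M.D T0) :
    sum f (n + 1) = sum f n + f n :=
  natRec_succ (by fun_prop) _ _

theorem Dfn.sum' {f : M.D T0 → M.D T0} (hf : Dfn M f) : Dfn M fun n => Model.sum f n :=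
  Dfn.sum (X := M.D T0) (f := fun _ => f) (hf.comp .snd) .id

theorem le_sum {f : M.D T0 → M.D T0} (hf : Dfn M f) {i n : M.D T0} (hi : i < n) :
    f i ≤ sum f n := by
  have hd : Dfn M fun n => i < n → f i ≤ Model.sum f n :=
    Dfn.imp (by fun_prop) (Dfn.le (by fun_prop) hf.sum')
  refine induct hd (fun h => absurd h (not_lt.2 (zero_le' _))) (fun n ih h => ?_) n hi
  rw [sum_succ hf]
  rcases (lt_add_one_iff'.1 h).lt_or_eq with h | rfl
  · exact (ih h).trans (by simp)
  · simp

/-- A bounded universal quantifier is the vanishing of a sum of characteristic values, hence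
decidable. -/
theorem sum_eq_zero_iff {f : M.D T0 → M.D T0} (hf : Dfn M f) {n : M.D T0} :
    sum f n = 0 ↔ ∀ i, i < n → f i = 0 := by
  constructor
  · intro h i hi
    exact le_antisymm (h ▸ le_sum hf hi) (zero_le' _)
  · intro h
    have hd : Dfn M fun m => m ≤ n → Model.sum f m = 0 :=
      Dfn.imp (by fun_prop) (Dfn.eq hf.sum' (by fun_prop))
    refine induct hd (fun _ => sum_zero f) (fun m ih hm => ?_) n le_rfl
    have hm' := lt_iff_add_one_le.2 hm
    rw [sum_succ hf, ih hm'.le, h m hm', add_zero]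

theorem Dfn.ballLt {P : X → M.D T0 → Prop} {b : X → M.D T0} (hb : Dfn M b)
    (hP : Dfn M fun p : X × M.D T0 => P p.1 p.2) : Dfn M fun x => ∀ i, i < b x → P x i :=
  .of_char (f := fun x => Model.sum (fun i => Model.chi (P x i)) (b x)) (Dfn.sum hP.chi hb)
    fun x => by simp only [sum_eq_zero_iff (hP.section x).chi, chi_eq_zero]

theorem Dfn.bexLt {P : X → M.D T0 → Prop} {b : X → M.D T0} (hb : Dfn M b)
    (hP : Dfn M fun p : X × M.D T0 => P p.1 p.2) : Dfn M fun x => ∃ i, i < b x ∧ P x i :=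
  (Dfn.ballLt (P := fun x i => ¬ P x i) hb hP.not).not.congr fun x => by simp

open Classical in
/-- Definition by cases. -/
noncomputable def sel (p : Prop) (a b : M.D T0) : M.D T0 := if p then a else b

theorem sel_pos {p : Prop} (h : p) (a b : M.D T0) : sel p a b = a := if_pos h

theorem sel_neg {p : Prop} (h : ¬ p) (a b : M.D T0) : sel p a b = b := if_neg h

-- Recursion with a constant step separates `0` from successors.
@[fun_prop] theorem Dfn.sel {P : X → Prop} {f g : X → M.D T0} (hP : Dfn M P) (hf : Dfn M f)
    (hg : Dfn M g) : Dfn M fun x => sel (P x) (f x) (g x) := by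
  have h : Dfn M fun x => Model.natRec (fun _ _ => g x) (f x) (Model.chi (P x)) :=
    Dfn.natRec (hg.comp (g := fun p : (X × M.D T0) × M.D T0 => p.1.1) (by fun_prop)) hf hP.chi
  refine h.congr fun x => ?_
  by_cases hp : P x
  · rw [sel_pos hp, chi_eq_zero.2 hp, natRec_zero]
  · have h1 : (Model.chi (P x) : M.D T0) = 0 + 1 := by rw [Model.chi, if_neg hp, zero_add]
    rw [sel_neg hp, h1, natRec_succ (by fun_prop)]

/-! #### Choice -/

/-- Quantifier-free choice in the model. -/
def Choice (M : Model) (σ τ : Ty) : Prop :=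
  ∀ E : M.D (σ ⇾ τ ⇾ T0), (∀ x, ∃ y, E x y = 0) → ∃ Y : M.D (σ ⇾ τ), ∀ x, E x (Y x) = 0

theorem choice_of_sat {σ τ : Ty} (h : ∀ φ ∈ QFAC σ τ, φ.Sat M.toStr Env.nil) : M.Choice σ τ := by
  intro E hE
  have h' := (sat_close _).1 (h _ ⟨[σ ⇾ τ ⇾ T0], (v2 ⬝ v1 ⬝ v0 =₀ tZero), trivial, rfl⟩)
    (Env.cons E Env.nil)
  simp only [choiceFor, sat_imp, sat_all, sat_ex, sat_subst, sat_eq, Tm.eval_app, eval_v0, eval_v1,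
    eval_v2, eval_zero] at h'
  exact h' hE

theorem Choice.exists_functional {σ τ : Ty} (h : M.Choice σ τ) {P : M.D σ → M.D τ → Prop}
    (hP : Dfn M fun p : M.D σ × M.D τ => P p.1 p.2) (hex : ∀ x, ∃ y, P x y) :
    ∃ Y : M.D (σ ⇾ τ), ∀ x, P x (Y x) := by
  have e : ∀ x y, lam (M := M) (fun x => lam fun y => chi (P x y)) x y = chi (P x y) := by
    intro x y
    have h₁ : Dfn M fun x => Model.lam fun y => (Model.chi (P x y) : M.D T0) := Dfn.lam hP.chi
    rw [lam_apply h₁, lam_apply (hP.section x).chi]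
  have := h (lam fun x => lam fun y => chi (P x y))
  simpa only [e, chi_eq_zero] using this (by simpa only [e, chi_eq_zero] using hex)

theorem choice_one_zero (M : Model) : M.Choice T1 T0 := choice_of_sat fun φ hφ => M.rca φ (.qfac hφ)

/-- Definable retracts of the type `1`. -/
class Coded (M : Model) (X : Type) [Obj M X] : Prop where
  coded : ∃ (enc : X → M.D T1) (dec : M.D T1 → X), Dfn M enc ∧ Dfn M dec ∧ ∀ x, dec (enc x) = x

instance : Coded M (M.D T1) := ⟨fun x => x, fun x => x, Dfn.id, Dfn.id, fun _ => rfl⟩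

instance : Coded M (M.D T0) :=
  ⟨fun n => lam fun _ => n, fun f => f 0, by fun_prop, by fun_prop, fun n =>
    lam_apply (by fun_prop) _⟩

instance [Coded M X] : Coded M (X × M.D T0) := by
  obtain ⟨enc, dec, he, hd, h⟩ := Coded.coded (M := M) (X := X)
  -- The number is put at position `0` and the sequence is shifted by one; the recursion ignores its
  -- previous value and only distinguishes the cases.
  refine ⟨fun p => lam fun i => natRec (fun k _ => enc p.1 k) p.2 i,
    fun f => (dec (lam fun i => f (i + 1)), f 0), by fun_prop, by fun_prop, fun p => ?_⟩
  have hn : Dfn M fun i : M.D T0 => Model.natRec (fun k _ => enc p.1 k) p.2 i := by fun_prop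
  refine Prod.ext ?_ ?_
  · refine Eq.trans (congrArg dec (M.ext fun i => ?_)) (h p.1)
    rw [lam_apply (by fun_prop), lam_apply hn, natRec_succ (by fun_prop)]
  · exact (lam_apply hn 0).trans (natRec_zero _ _)

/-- `QF-AC^{1,0}` is carried along the retraction onto `X`. It stands in for unbounded search:
whenever a decidable condition is satisfiable for each `x`, a definable solution exists. -/
theorem exists_dfn_choice [Coded M X] {P : X → M.D T0 → Prop}
    (hP : Dfn M fun p : X × M.D T0 => P p.1 p.2) (h : ∀ x, ∃ n, P x n) :
    ∃ F : X → M.D T0, Dfn M F ∧ ∀ x, P x (F x) := by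
  obtain ⟨enc, dec, he, hd, hde⟩ := Coded.coded (M := M) (X := X)
  obtain ⟨Y, hY⟩ := (choice_one_zero M).exists_functional (P := fun f n => P (dec f) n)
    (hP.comp (g := fun p : M.D T1 × M.D T0 => (dec p.1, p.2)) (by fun_prop)) fun f => h (dec f)
  exact ⟨fun x => Y (enc x), by fun_prop, fun x => by simpa only [hde] using hY (enc x)⟩

end
end Model

/-! ### The ordered field of fractions of a canonically ordered semiring -/

section Fractions

variable (R : Type) [CommSemiring R] [LinearOrder R] [IsStrictOrderedRing R]

/-- Formal differences, `⟨a, b⟩` standing for `a - b`, are identified when they are equal. -/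
def diffCon : RingCon (QuadraticAlgebra R 1 0) where
  -- The generator `ω` of this quadratic algebra satisfies `ω ^ 2 = 1` and plays the role of `-1`,
  -- so the product is already the product of formal differences.
  r x y := x.re + y.im = y.re + x.im
  iseqv := by
    refine ⟨fun x => rfl, fun h => h.symm, fun {x y z} h₁ h₂ => ?_⟩
    refine add_right_cancel (b := y.re + y.im) ?_
    calc x.re + z.im + (y.re + y.im) = (x.re + y.im) + (y.re + z.im) := by ring
      _ = (y.re + x.im) + (z.re + y.im) := by rw [h₁, h₂]
      _ = _ := by ring
  add' {a b c d} h₁ h₂ := by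
    simp only [QuadraticAlgebra.re_add, QuadraticAlgebra.im_add]
    calc a.re + c.re + (b.im + d.im) = (a.re + b.im) + (c.re + d.im) := by ring
      _ = (b.re + a.im) + (d.re + c.im) := by rw [h₁, h₂]
      _ = _ := by ring
  mul' {a b c d} h₁ h₂ := by
    simp only [QuadraticAlgebra.re_mul, QuadraticAlgebra.im_mul]
    have e₁ : a.re * c.re + a.im * c.im + (b.re * c.im + b.im * c.re) =
        b.re * c.re + b.im * c.im + (a.re * c.im + a.im * c.re) := by
      calc _ = (a.re + b.im) * c.re + (b.re + a.im) * c.im := by ring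
        _ = (b.re + a.im) * c.re + (a.re + b.im) * c.im := by rw [h₁]
        _ = _ := by ring
    have e₂ : b.re * c.re + b.im * c.im + (b.re * d.im + b.im * d.re) =
        b.re * d.re + b.im * d.im + (b.re * c.im + b.im * c.re) := by
      calc _ = b.re * (c.re + d.im) + b.im * (d.re + c.im) := by ring
        _ = b.re * (d.re + c.im) + b.im * (c.re + d.im) := by rw [h₂]
        _ = _ := by ring
    refine add_right_cancel (b := b.re * c.re + b.im * c.im + (b.re * c.im + b.im * c.re)) ?_
    calc _ = (a.re * c.re + a.im * c.im + (b.re * c.im + b.im * c.re)) +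
          (b.re * c.re + b.im * c.im + (b.re * d.im + b.im * d.re)) := by ring
      _ = _ := by rw [e₁, e₂]; ring

/-- The ring of differences. -/
abbrev Diff : Type := (diffCon R).Quotient

variable {R}

theorem Diff.mk_eq {x y : QuadraticAlgebra R 1 0} :
    ((x : Diff R) = (y : Diff R)) ↔ x.re + y.im = y.re + x.im :=
  RingCon.eq _

instance : Neg (Diff R) where
  neg := Quotient.map (fun x => ⟨x.im, x.re⟩) fun x y (h : x.re + y.im = y.re + x.im) => by
    change x.im + y.re = y.im + x.re
    rw [add_comm, ← h, add_comm]

instance : CommRing (Diff R) :=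
  { (inferInstance : CommSemiring (Diff R)) with
    zsmul := zsmulRec
    neg_add_cancel := fun x => by
      induction x using Quotient.inductionOn with | _ x
      refine Diff.mk_eq.2 ?_
      simp [add_comm] }

/-- The embedding of the semiring into its ring of differences. -/
def Diff.of : R →+* Diff R where
  toFun a := ((⟨a, 0⟩ : QuadraticAlgebra R 1 0) : Diff R)
  map_zero' := rfl
  map_one' := rfl
  map_add' a b := Diff.mk_eq.2 (by simp)
  map_mul' a b := Diff.mk_eq.2 (by simp)

theorem Diff.of_injective : Function.Injective (Diff.of : R → Diff R) := fun a b h => by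
  simpa using Diff.mk_eq.1 h

theorem Diff.exists_sub (x : Diff R) : ∃ a b : R, x = Diff.of a - Diff.of b := by
  induction x using Quotient.inductionOn with | _ x
  refine ⟨x.re, x.im, ?_⟩
  rw [sub_eq_add_neg]
  exact Diff.mk_eq.2 (by simp [add_comm])

variable [CanonicallyOrderedAdd R]

/-- Of two elements of a canonically ordered semiring, the smaller can be subtracted from the
larger. Absence of zero divisors and totality of the order on fractions both reduce to this. -/
theorem Diff.eq_or_eq_neg (x : Diff R) : ∃ a : R, x = Diff.of a ∨ x = -Diff.of a := by
  obtain ⟨a, b, rfl⟩ := Diff.exists_sub x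
  rcases le_total a b with h | h
  · obtain ⟨c, rfl⟩ := exists_add_of_le h
    exact ⟨c, Or.inr (by rw [map_add]; ring)⟩
  · obtain ⟨c, rfl⟩ := exists_add_of_le h
    exact ⟨c, Or.inl (by rw [map_add]; ring)⟩

instance : Nontrivial (Diff R) := Diff.of_injective.nontrivial

instance : NoZeroDivisors (Diff R) where
  eq_zero_or_eq_zero_of_mul_eq_zero {x y} h := by
    have key : ∀ a b : R, Diff.of a * Diff.of b = 0 → a = 0 ∨ b = 0 := fun a b h => by
      rw [← map_mul, ← map_zero (Diff.of (R := R))] at h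
      exact mul_eq_zero.1 (Diff.of_injective h)
    obtain ⟨a, ha⟩ := Diff.eq_or_eq_neg x
    obtain ⟨b, hb⟩ := Diff.eq_or_eq_neg y
    have h' : Diff.of a * Diff.of b = 0 := by
      rcases ha with rfl | rfl <;> rcases hb with rfl | rfl <;> simpa using h
    rcases key a b h' with rfl | rfl
    · left; simpa using ha
    · right; simpa using hb

instance : IsDomain (Diff R) := NoZeroDivisors.to_isDomain _

variable (R) in
/-- The field of fractions of the ring of differences. -/
def Frac : Type := FractionRing (Diff R)

noncomputable instance : Field (Frac R) := inferInstanceAs (Field (FractionRing (Diff R)))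

noncomputable def Frac.of : R →+* Frac R := (algebraMap (Diff R) (FractionRing (Diff R))).comp Diff.of

theorem Frac.of_injective : Function.Injective (Frac.of : R → Frac R) :=
  (IsFractionRing.injective (Diff R) (FractionRing (Diff R))).comp Diff.of_injective

theorem Frac.of_ne_zero {a : R} (h : 0 < a) : (Frac.of a : Frac R) ≠ 0 := fun h' =>
  h.ne' (Frac.of_injective (h'.trans (map_zero _).symm))

theorem Frac.exists_rep (q : Frac R) :
    ∃ p w : R, 0 < w ∧ (q * Frac.of w = Frac.of p ∨ -q * Frac.of w = Frac.of p) := by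
  obtain ⟨x, y, hy, rfl⟩ := IsFractionRing.div_surjective (A := Diff R) (K := FractionRing (Diff R)) q
  obtain ⟨a, ha⟩ := Diff.eq_or_eq_neg x
  obtain ⟨b, hb⟩ := Diff.eq_or_eq_neg y
  have hb0 : 0 < b := by
    refine pos_iff_ne_zero.2 fun h => nonZeroDivisors.ne_zero hy ?_
    rw [h] at hb
    simpa using hb
  have hb' := Frac.of_ne_zero hb0
  refine ⟨a, b, hb0, ?_⟩
  have e : ∀ c : R, algebraMap (Diff R) (FractionRing (Diff R)) (Diff.of c) = Frac.of c := fun _ => rfl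
  rcases ha with rfl | rfl <;> rcases hb with rfl | rfl <;> simp only [map_neg, e]
  · left; exact div_mul_cancel₀ _ hb'
  · right
    change -(Frac.of a / -Frac.of b : Frac R) * Frac.of b = Frac.of a
    rw [div_neg, neg_neg, div_mul_cancel₀ _ hb']
  · right
    change -(-Frac.of a / Frac.of b : Frac R) * Frac.of b = Frac.of a
    rw [neg_div, neg_neg, div_mul_cancel₀ _ hb']
  · left
    change (-Frac.of a / -Frac.of b : Frac R) * Frac.of b = Frac.of a
    rw [neg_div_neg_eq, div_mul_cancel₀ _ hb']

/-- The non-negative fractions. -/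
def Frac.cone : RingCone (Frac R) where
  carrier := {q | ∃ p w : R, 0 < w ∧ q * Frac.of w = Frac.of p}
  zero_mem' := ⟨0, 1, one_pos, by simp⟩
  one_mem' := ⟨1, 1, one_pos, by simp⟩
  add_mem' := by
    rintro x y ⟨p, w, hw, h⟩ ⟨p', w', hw', h'⟩
    refine ⟨p * w' + p' * w, w * w', mul_pos hw hw', ?_⟩
    rw [map_add, map_mul, map_mul, map_mul, ← h, ← h']
    ring
  mul_mem' := by
    rintro x y ⟨p, w, hw, h⟩ ⟨p', w', hw', h'⟩
    refine ⟨p * p', w * w', mul_pos hw hw', ?_⟩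
    rw [map_mul, map_mul, ← h, ← h']
    ring
  eq_zero_of_mem_of_neg_mem' := by
    rintro x ⟨p, w, hw, h⟩ ⟨p', w', hw', h'⟩
    have h₀ : Frac.of (p * w' + p' * w) = (Frac.of 0 : Frac R) := by
      rw [map_add, map_mul, map_mul, ← h, ← h', map_zero]
      ring
    have h₁ := (add_eq_zero.1 (Frac.of_injective h₀)).1
    rw [(mul_eq_zero.1 h₁).resolve_right hw'.ne', map_zero] at h
    exact (mul_eq_zero.1 h).resolve_right (Frac.of_ne_zero hw)

instance : HasMemOrNegMem (Frac.cone (R := R)) where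
  mem_or_neg_mem q := by
    obtain ⟨p, w, hw, h | h⟩ := Frac.exists_rep q
    · exact Or.inl ⟨p, w, hw, h⟩
    · exact Or.inr ⟨p, w, hw, h⟩

theorem Frac.exists_linearOrder : ∃ _ : LinearOrder (Frac R),
    IsStrictOrderedRing (Frac R) ∧ Monotone (Frac.of : R → Frac R) := by
  classical
  let o : LinearOrder (Frac R) := LinearOrder.mkOfAddGroupCone (Frac.cone (R := R))
  have : IsOrderedRing (Frac R) := IsOrderedRing.mkOfCone (Frac.cone (R := R))
  refine ⟨o, IsOrderedRing.toIsStrictOrderedRing _, fun a b h => ?_⟩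
  obtain ⟨c, rfl⟩ := exists_add_of_le h
  exact ⟨c, 1, one_pos, by rw [map_add]; simp⟩

noncomputable instance : LinearOrder (Frac R) := Frac.exists_linearOrder.choose

instance : IsStrictOrderedRing (Frac R) := Frac.exists_linearOrder.choose_spec.1

theorem Frac.of_strictMono : StrictMono (Frac.of : R → Frac R) :=
  Frac.exists_linearOrder.choose_spec.2.strictMono_of_injective Frac.of_injective

end Fractions
namespace Model

variable {M : Model}

/-! ### The rational numbers of a model -/

/-- The ordered field of the rational numbers of the model. -/
abbrev Q (M : Model) : Type := Frac (M.D T0)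

/-- Numbers as rational numbers. -/
@[coe] noncomputable def cast (a : M.D T0) : M.Q := Frac.of a

noncomputable instance : Coe (M.D T0) M.Q := ⟨cast⟩

@[simp, norm_cast] theorem cast_zero : ((0 : M.D T0) : M.Q) = 0 := map_zero Frac.of
@[simp, norm_cast] theorem cast_one : ((1 : M.D T0) : M.Q) = 1 := map_one Frac.of
@[simp, norm_cast] theorem cast_ofNat (n : ℕ) [n.AtLeastTwo] :
    ((OfNat.ofNat n : M.D T0) : M.Q) = OfNat.ofNat n := map_ofNat Frac.of n
@[simp, norm_cast] theorem cast_add (a b : M.D T0) : ((a + b : M.D T0) : M.Q) = a + b :=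
  map_add Frac.of a b
@[simp, norm_cast] theorem cast_mul (a b : M.D T0) : ((a * b : M.D T0) : M.Q) = a * b :=
  map_mul Frac.of a b
@[simp, norm_cast] theorem cast_le {a b : M.D T0} : (a : M.Q) ≤ b ↔ a ≤ b :=
  Frac.of_strictMono.le_iff_le
@[simp, norm_cast] theorem cast_lt {a b : M.D T0} : (a : M.Q) < b ↔ a < b :=
  Frac.of_strictMono.lt_iff_lt
theorem cast_nonneg (a : M.D T0) : (0 : M.Q) ≤ a := by
  rw [← cast_zero, cast_le]
  exact zero_le' a

theorem lt_of_cast_lt_add_one {a b : M.D T0} (h : (a : M.Q) < b + 1) : a ≤ b := by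
  rw [← cast_one, ← cast_add, cast_lt] at h
  exact lt_add_one_iff'.1 h

theorem cast_monus {a b : M.D T0} (h : b ≤ a) : ((monus a b : M.D T0) : M.Q) = a - b := by
  have := congrArg (cast (M := M)) (monus_add_cancel h)
  rw [cast_add] at this
  linarith

/-! #### Powers of two -/

/-- `2 ^ n` -/
noncomputable def pw (n : M.D T0) : M.D T0 := (tPowTwo v0).eval M.toStr (Env.cons n Env.nil)

@[simp] theorem eval_powTwo {Γ : Ctx} (γ : Env M.D Γ) (t : Term Γ T0) :
    (tPowTwo t).eval M.toStr γ = pw (t.eval M.toStr γ) := rfl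

theorem pw_zero : pw (0 : M.D T0) = 1 := primRec_zero _ _

theorem pw_succ (n : M.D T0) : pw (n + 1) = 2 * pw n := by
  refine (primRec_succ _ _ _).trans ?_
  have : ∀ x y : M.D T0, (M.const (.combK T1 T0) : M.D (T1 ⇾ T0 ⇾ T1))
      ((M.const .mul : M.D (T0 ⇾ T0 ⇾ T0)) (1 + 1)) x y = 2 * y := by
    intro x y
    rw [combK_apply, ← one_add_one_eq_two]
    rfl
  exact this _ _

section
variable {X : Type} [Obj M X]

@[fun_prop] theorem Dfn.pw {f : X → M.D T0} (hf : Dfn M f) : Dfn M fun x => pw (f x) :=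
  Dfn.app (Dfn.const (M.app (M.app (M.const (.recursor T0)) (M.app (M.const (.combK T1 T0))
    (M.app (M.const .mul) (1 + 1 : M.D T0)))) (1 : M.D T0))) hf

theorem pw_pos (n : M.D T0) : 0 < pw n := by
  refine induct (P := fun n => 0 < Model.pw n) (by fun_prop) (by rw [pw_zero]; exact one_pos) (fun n ih => ?_) n
  rw [pw_succ]
  exact mul_pos two_pos ih

theorem pw_add (m n : M.D T0) : pw (m + n) = pw m * pw n := by
  refine induct (P := fun n => Model.pw (m + n) = Model.pw m * Model.pw n) (by fun_prop)
    (by rw [pw_zero, add_zero, mul_one]) (fun n ih => ?_) n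
  rw [← add_assoc, pw_succ, pw_succ, ih]
  ring

theorem one_le_pw (n : M.D T0) : 1 ≤ pw n := by
  simpa using lt_iff_add_one_le.1 (pw_pos n)

theorem pw_mono : Monotone (pw : M.D T0 → M.D T0) := by
  intro a b h
  obtain ⟨c, rfl⟩ := exists_add_of_le h
  rw [pw_add]
  exact le_mul_of_one_le_right (zero_le' _) (one_le_pw c)

theorem cast_pw_pos (n : M.D T0) : (0 : M.Q) < (pw n : M.D T0) := by
  rw [← cast_zero, cast_lt]
  exact pw_pos n

/-- `2 ^ (-n)` -/
noncomputable def eps (n : M.D T0) : M.Q := 1 / (pw n : M.D T0)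

theorem eps_pos (n : M.D T0) : 0 < eps n := one_div_pos.2 (cast_pw_pos n)

theorem eps_zero : eps (0 : M.D T0) = 1 := by simp [eps, pw_zero]

theorem eps_add (m n : M.D T0) : eps (m + n) = eps m * eps n := by
  rw [eps, pw_add, cast_mul, eps, eps, one_div_mul_one_div]

theorem eps_one : eps (1 : M.D T0) = 1 / 2 := by
  have := pw_succ (0 : M.D T0)
  rw [zero_add, pw_zero, mul_one] at this
  rw [eps, this, cast_ofNat]

theorem eps_succ (n : M.D T0) : eps (n + 1) = eps n / 2 := by
  rw [eps_add, eps_one]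
  ring

theorem eps_anti {m n : M.D T0} (h : m ≤ n) : eps n ≤ eps m :=
  one_div_le_one_div_of_le (cast_pw_pos m) (cast_le.2 (pw_mono h))

theorem eps_le_iff {m n : M.D T0} : eps n ≤ eps m ↔ m ≤ n := by
  refine ⟨fun h => ?_, eps_anti⟩
  by_contra hlt
  have h₁ := eps_anti (lt_iff_add_one_le.1 (not_le.1 hlt))
  rw [eps_succ] at h₁
  have := eps_pos n
  linarith

theorem eps_mul_pw (n : M.D T0) : eps n * (pw n : M.D T0) = 1 :=
  one_div_mul_cancel (cast_pw_pos n).ne'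

/-! #### Definability for rational numbers -/

/-- `(p - m) / (d + 1)` -/
noncomputable def frac (v : M.D T0 × M.D T0 × M.D T0) : M.Q := (v.1 - v.2.1) / (v.2.2 + 1)

theorem cast_add_one_pos (d : M.D T0) : (0 : M.Q) < d + 1 := by
  linarith [cast_nonneg d]

theorem frac_surjective (q : M.Q) : ∃ v, frac v = q := by
  obtain ⟨p, w, hw, h⟩ := Frac.exists_rep q
  obtain ⟨d, rfl⟩ := exists_add_of_le (lt_iff_add_one_le.1 hw)
  have hd := (cast_add_one_pos d).ne'
  have e : Frac.of (0 + 1 + d) = (d : M.Q) + 1 := by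
    rw [← cast_one, ← cast_add, zero_add, add_comm]; rfl
  rw [e] at h
  rcases h with h | h
  · refine ⟨(p, 0, d), ?_⟩
    rw [frac, div_eq_iff hd, h, cast_zero, sub_zero]
    rfl
  · refine ⟨(0, p, d), ?_⟩
    rw [frac, div_eq_iff hd, cast_zero, zero_sub]
    change - Frac.of p = _
    rw [← h]
    ring

/-- A family of rationals is definable if numerators and denominators can be chosen definably. A map
out of `M.Q` may then be tested on triples of numbers, as in `Dfn.of_frac`. -/
noncomputable instance : Obj M M.Q where
  curve Γ q := ∃ v : Env M.D Γ → M.D T0 × M.D T0 × M.D T0, Obj.curve Γ v ∧ ∀ γ, q γ = frac (v γ)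
  const Γ q := by
    obtain ⟨v, hv⟩ := frac_surjective q
    exact ⟨fun _ => v, Obj.const Γ v, fun _ => hv.symm⟩
  wk σ := fun ⟨_, hv, h⟩ => ⟨_, Obj.wk σ hv, fun _ => h _⟩

theorem Dfn.frac : Dfn M (frac : M.D T0 × M.D T0 × M.D T0 → M.Q) :=
  fun _ v hv => ⟨v, hv, fun _ => rfl⟩

theorem Dfn.of_frac {Y : Type} [Obj M Y] {f : M.Q → Y}
    (h : Dfn M fun v : M.D T0 × M.D T0 × M.D T0 => f (Model.frac v)) : Dfn M f := by
  rintro Γ c ⟨v, hv, e⟩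
  rw [funext e]
  exact h Γ v hv

theorem Dfn.of_frac₂ {Y : Type} [Obj M Y] {f : M.Q → M.Q → Y}
    (h : Dfn M fun p : (M.D T0 × M.D T0 × M.D T0) × (M.D T0 × M.D T0 × M.D T0) =>
      f (Model.frac p.1) (Model.frac p.2)) : Dfn M fun p : M.Q × M.Q => f p.1 p.2 := by
  rintro Γ c ⟨⟨v, hv, e⟩, ⟨w, hw, e'⟩⟩
  have : (fun γ => f (c γ).1 (c γ).2) = fun γ => f (Model.frac (v γ)) (Model.frac (w γ)) := by
    funext γ
    rw [← e, ← e']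
  rw [this]
  exact h Γ (fun γ => (v γ, w γ)) ⟨hv, hw⟩

@[fun_prop] theorem Dfn.cast {f : X → M.D T0} (hf : Dfn M f) : Dfn M fun x => (f x : M.Q) :=
  (Dfn.frac.comp (g := fun x => (f x, 0, 0)) (by fun_prop)).congr fun x => by simp [Model.frac]

@[fun_prop] theorem Dfn.qadd {f g : X → M.Q} (hf : Dfn M f) (hg : Dfn M g) :
    Dfn M fun x => f x + g x := by
  have : Dfn M fun p : M.Q × M.Q => p.1 + p.2 := by
    refine Dfn.of_frac₂ ((Dfn.frac.comp (g := fun p => (p.1.1 * (p.2.2.2 + 1) + p.2.1 * (p.1.2.2 + 1),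
      p.1.2.1 * (p.2.2.2 + 1) + p.2.2.1 * (p.1.2.2 + 1),
      p.1.2.2 * p.2.2.2 + p.1.2.2 + p.2.2.2)) (by fun_prop)).congr fun p => ?_)
    have h₁ := (cast_add_one_pos p.1.2.2).ne'
    have h₂ := (cast_add_one_pos p.2.2.2).ne'
    have h₃ : (p.1.2.2 : M.Q) * p.2.2.2 + p.1.2.2 + p.2.2.2 + 1 =
        (p.1.2.2 + 1) * (p.2.2.2 + 1) := by ring
    simp only [Model.frac, cast_add, cast_mul, cast_one]
    rw [h₃, div_add_div _ _ h₁ h₂]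
    congr 1
    ring
  exact this.comp (hf.prodMk hg)

@[fun_prop] theorem Dfn.qneg {f : X → M.Q} (hf : Dfn M f) : Dfn M fun x => -f x := by
  have : Dfn M fun q : M.Q => -q :=
    Dfn.of_frac ((Dfn.frac.comp (g := fun v => (v.2.1, v.1, v.2.2)) (by fun_prop)).congr
      fun v => by simp only [Model.frac]; ring)
  exact this.comp hf

@[fun_prop] theorem Dfn.qsub {f g : X → M.Q} (hf : Dfn M f) (hg : Dfn M g) :
    Dfn M fun x => f x - g x :=
  (hf.qadd hg.qneg).congr fun _ => sub_eq_add_neg _ _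

@[fun_prop] theorem Dfn.qmul {f g : X → M.Q} (hf : Dfn M f) (hg : Dfn M g) :
    Dfn M fun x => f x * g x := by
  have : Dfn M fun p : M.Q × M.Q => p.1 * p.2 := by
    refine Dfn.of_frac₂ ((Dfn.frac.comp (g := fun p => (p.1.1 * p.2.1 + p.1.2.1 * p.2.2.1,
      p.1.1 * p.2.2.1 + p.1.2.1 * p.2.1,
      p.1.2.2 * p.2.2.2 + p.1.2.2 + p.2.2.2)) (by fun_prop)).congr fun p => ?_)
    have h₃ : (p.1.2.2 : M.Q) * p.2.2.2 + p.1.2.2 + p.2.2.2 + 1 =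
        (p.1.2.2 + 1) * (p.2.2.2 + 1) := by ring
    simp only [Model.frac, cast_add, cast_mul]
    rw [h₃, div_mul_div_comm]
    congr 1
    ring
  exact this.comp (hf.prodMk hg)

@[fun_prop] theorem Dfn.qdiv {f : X → M.Q} (hf : Dfn M f) (c : M.Q) : Dfn M fun x => f x / c :=
  (hf.qmul (.const c⁻¹)).congr fun _ => div_eq_mul_inv _ _

@[fun_prop] theorem Dfn.qle {f g : X → M.Q} (hf : Dfn M f) (hg : Dfn M g) :
    Dfn M fun x => f x ≤ g x := by
  have : Dfn M fun p : M.Q × M.Q => p.1 ≤ p.2 := by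
    refine Dfn.of_frac₂ (f := fun a b => a ≤ b) (Dfn.congr (g := fun p =>
      p.1.1 * (p.2.2.2 + 1) + p.2.2.1 * (p.1.2.2 + 1) ≤
        p.2.1 * (p.1.2.2 + 1) + p.1.2.1 * (p.2.2.2 + 1)) (by fun_prop) fun p => ?_)
    rw [Model.frac, Model.frac, div_le_div_iff₀ (cast_add_one_pos _) (cast_add_one_pos _),
      ← cast_le (M := M)]
    simp only [cast_add, cast_mul, cast_one]
    exact propext ⟨fun h => by linarith, fun h => by linarith⟩
  exact this.comp (hf.prodMk hg)

@[fun_prop] theorem Dfn.qlt {f g : X → M.Q} (hf : Dfn M f) (hg : Dfn M g) :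
    Dfn M fun x => f x < g x :=
  (hg.qle hf).not.congr fun _ => propext not_le.symm

@[fun_prop] theorem Dfn.eps {f : X → M.D T0} (hf : Dfn M f) : Dfn M fun x => eps (f x) :=
  (Dfn.frac.comp (g := fun x => (1, 0, Model.monus (Model.pw (f x)) 1)) (by fun_prop)).congr
    fun x => by rw [Model.frac, cast_monus (one_le_pw _), Model.eps]; simp

/-! #### Integral parts -/

/-- A map with a decidable graph is found by choice, since each value is the only solution. -/
theorem Dfn.of_graph [Coded M X] {f : X → M.D T0}
    (h : Dfn M fun p : X × M.D T0 => p.2 = f p.1) : Dfn M f := by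
  obtain ⟨F, hF, e⟩ := exists_dfn_choice (P := fun x n => n = f x) h fun x => ⟨_, rfl⟩
  exact hF.congr fun x => (e x).symm

/-- Without an integral part, induction on the decidable inequality `k ≤ q` would put all numbers
below `q`; but `p + 1` lies above `(p - m) / (d + 1)`. -/
theorem exists_floor {q : M.Q} (hq : 0 ≤ q) : ∃ k : M.D T0, (k : M.Q) ≤ q ∧ q < k + 1 := by
  by_contra! h
  have hall : ∀ k : M.D T0, (k : M.Q) ≤ q := by
    refine induct (by fun_prop) (by simpa using hq) fun k hk => ?_
    simpa using h k hk
  obtain ⟨⟨p, m, d⟩, rfl⟩ := frac_surjective q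
  have h₁ := hall (p + 1)
  rw [frac, le_div_iff₀ (cast_add_one_pos d), cast_add, cast_one] at h₁
  have hp := cast_nonneg p
  have hm := cast_nonneg m
  have hd := cast_nonneg d
  nlinarith

open Classical in
/-- The integral part; `0` for negative numbers. -/
noncomputable def floor (q : M.Q) : M.D T0 := if h : 0 ≤ q then (exists_floor h).choose else 0

theorem floor_le {q : M.Q} (hq : 0 ≤ q) : (floor q : M.Q) ≤ q := by
  rw [floor, dif_pos hq]
  exact (exists_floor hq).choose_spec.1

theorem lt_floor_add_one (q : M.Q) : q < floor q + 1 := by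
  by_cases hq : 0 ≤ q
  · rw [floor, dif_pos hq]
    exact (exists_floor hq).choose_spec.2
  · linarith [cast_nonneg (floor q)]

theorem floor_of_neg {q : M.Q} (hq : q < 0) : floor q = 0 := dif_neg (not_le.2 hq)

theorem floor_eq_of {q : M.Q} {k : M.D T0} (h₁ : (k : M.Q) ≤ q) (h₂ : q < k + 1) : floor q = k := by
  have hq : 0 ≤ q := (cast_nonneg k).trans h₁
  exact le_antisymm (lt_of_cast_lt_add_one ((floor_le hq).trans_lt h₂))
    (lt_of_cast_lt_add_one (h₁.trans_lt (lt_floor_add_one q)))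

theorem eq_floor_iff {q : M.Q} {k : M.D T0} :
    k = floor q ↔ 0 ≤ q ∧ ((k : M.Q) ≤ q ∧ q < k + 1) ∨ q < 0 ∧ k = 0 := by
  rcases le_or_gt 0 q with h | h
  · simp only [h, true_and, not_lt.2 h, false_and, or_false]
    exact ⟨fun e => e ▸ ⟨floor_le h, lt_floor_add_one q⟩, fun e => (floor_eq_of e.1 e.2).symm⟩
  · simp [h, not_le.2 h, floor_of_neg h]

@[fun_prop] theorem Dfn.floor {f : X → M.Q} (hf : Dfn M f) : Dfn M fun x => floor (f x) := by
  have hg : Dfn M fun p : M.Q × M.D T0 => p.2 = Model.floor p.1 := by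
    simp only [eq_floor_iff]
    fun_prop
  refine Dfn.comp (Dfn.of_frac ?_) hf
  have e : Coded M (M.D T0 × M.D T0 × M.D T0) := by
    obtain ⟨enc, dec, he, hd, h⟩ := Coded.coded (M := M) (X := (M.D T0 × M.D T0) × M.D T0)
    exact ⟨fun v => enc ((v.1, v.2.1), v.2.2), fun f => ((dec f).1.1, (dec f).1.2, (dec f).2),
      by fun_prop, by fun_prop, fun v => by simp [h]⟩
  exact Dfn.of_graph (hg.comp (g := fun p : (M.D T0 × M.D T0 × M.D T0) × M.D T0 => (Model.frac p.1, p.2))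
    (.prodMk (Dfn.frac.comp .fst) .snd))

end

/-! ### Codes of rational numbers, real numbers -/

/-- `0 + 1 + ⋯ + s` -/
noncomputable def tri (s : M.D T0) : M.D T0 := natRec (fun k r => r + (k + 1)) 0 s

/-- The Cantor pairing function. -/
noncomputable def pr (u d : M.D T0) : M.D T0 := tri (u + d) + u

section
variable {X : Type} [Obj M X]

@[fun_prop] theorem Dfn.tri {f : X → M.D T0} (hf : Dfn M f) : Dfn M fun x => tri (f x) := by
  unfold Model.tri
  fun_prop

@[fun_prop] theorem Dfn.pr {f g : X → M.D T0} (hf : Dfn M f) (hg : Dfn M g) :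
    Dfn M fun x => pr (f x) (g x) := by
  unfold Model.pr
  fun_prop

theorem tri_zero : tri (0 : M.D T0) = 0 := natRec_zero _ _

theorem tri_succ (s : M.D T0) : tri (s + 1) = tri s + (s + 1) := natRec_succ (by fun_prop) _ _

theorem two_mul_tri (s : M.D T0) : 2 * tri s = s * s + s := by
  refine induct (P := fun s => 2 * Model.tri s = s * s + s) (by fun_prop) (by simp [tri_zero])
    (fun s ih => ?_) s
  rw [tri_succ, mul_add, ih]
  ring

theorem tri_mono : Monotone (tri : M.D T0 → M.D T0) := by
  intro a b h
  have : 2 * tri a ≤ 2 * tri b := by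
    rw [two_mul_tri, two_mul_tri]
    exact add_le_add (mul_le_mul' h h) h
  exact le_of_mul_le_mul_left this two_pos

theorem two_mul_pr (u d : M.D T0) : 2 * pr u d = (u + d) * (u + d) + 3 * u + d := by
  rw [pr, mul_add, two_mul_tri]
  ring

theorem pr_lt_tri_succ (u d : M.D T0) : pr u d < tri (u + d + 1) := by
  rw [tri_succ, pr, add_lt_add_iff_left, lt_add_one_iff']
  simp

theorem pr_injective {u d u' d' : M.D T0} (h : pr u d = pr u' d') : u = u' ∧ d = d' := by
  have key : ∀ {u d u' d' : M.D T0}, pr u d = pr u' d' → u + d ≤ u' + d' := by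
    intro u d u' d' h
    by_contra hlt
    have h₁ := tri_mono (lt_iff_add_one_le.1 (not_le.1 hlt))
    have h₂ := (pr_lt_tri_succ u' d').trans_le h₁
    have h₃ : tri (u + d) ≤ pr u d := by simp [pr]
    exact absurd (h₂.trans_le h₃) (by rw [h]; exact lt_irrefl _)
  have e := le_antisymm (key h) (key h.symm)
  have hu : u = u' := by
    rw [pr, pr, e] at h
    exact add_left_cancel h
  exact ⟨hu, by rw [hu] at e; exact add_left_cancel e⟩

/-- The induction walks along the antidiagonals: `(u, d + 1)` is followed by `(u + 1, d)`, and `(u,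
0)` by `(0, u + 1)`. The bounds on `u` and `d` keep the induction predicate decidable. -/
theorem exists_pr (c : M.D T0) : ∃ u, u < c + 1 ∧ ∃ d, d < c + 1 ∧ c = pr u d := by
  refine induct (P := fun c => ∃ u, u < c + 1 ∧ ∃ d, d < c + 1 ∧ c = Model.pr u d)
    (Dfn.bexLt (by fun_prop) (Dfn.bexLt (by fun_prop) (by fun_prop)))
    ⟨0, by simp, 0, by simp, by simp [pr, tri_zero]⟩ (fun c ih => ?_) c
  obtain ⟨u, hu, d, hd, e⟩ := ih
  rcases eq_zero_or_pred_add_one d with h0 | h1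
  · refine ⟨0, by simp, u + 1, by simpa using hu, ?_⟩
    rw [e, h0, pr, pr, add_zero, zero_add, tri_succ, add_zero]
    ring
  · refine ⟨u + 1, by simpa using hu, pred d, ?_, ?_⟩
    · refine lt_of_le_of_lt ?_ (hd.trans (by simp))
      rw [← h1]
      simp [pred_succ]
    · rw [e, pr, pr, add_assoc u 1, add_comm 1, h1]
      ring

/-- `c` codes `(p - m) / (d + 1)`. -/
def RatCode (c p m d : M.D T0) : Prop :=
  m = 0 ∧ c = pr (2 * p) d ∨ p = 0 ∧ ∃ u, u + 1 = 2 * m ∧ c = pr u d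

theorem two_mul_add_one_ne (a b : M.D T0) : 2 * a + 1 ≠ 2 * b := by
  intro h
  rcases lt_or_ge a b with hab | hab
  · have h₁ := mul_le_mul' le_rfl (lt_iff_add_one_le.1 hab) (a := (2 : M.D T0))
    rw [← h, mul_add, mul_one, add_le_add_iff_left, ← one_add_one_eq_two] at h₁
    exact absurd h₁ (not_le.2 (lt_add_one' 1))
  · have h₁ := mul_le_mul' le_rfl hab (a := (2 : M.D T0))
    rw [← h] at h₁
    exact absurd h₁ (not_le.2 (lt_add_one' _))

theorem exists_half (u : M.D T0) : ∃ h, u = 2 * h ∨ u = 2 * h + 1 := by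
  have h₀ : (0 : M.Q) ≤ (u : M.Q) / 2 := div_nonneg (cast_nonneg u) two_pos.le
  refine ⟨floor ((u : M.Q) / 2), ?_⟩
  have h₁ := floor_le h₀
  have h₂ := lt_floor_add_one ((u : M.Q) / 2)
  rw [le_div_iff₀ two_pos] at h₁
  rw [div_lt_iff₀ two_pos] at h₂
  have h₃ : 2 * floor ((u : M.Q) / 2) ≤ u := by
    rw [← cast_le (M := M), cast_mul, cast_ofNat]; linarith
  rcases h₃.lt_or_eq with h | h
  · right
    refine le_antisymm (lt_of_cast_lt_add_one ?_) (lt_iff_add_one_le.1 h)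
    rw [cast_add, cast_mul, cast_ofNat, cast_one]
    linarith
  · exact Or.inl h.symm

/-- Decoding splits the pair and halves its first component, whose parity is the sign. Since every
number codes exactly one rational, formulas about codes can be evaluated as statements about `M.Q`.
-/
theorem exists_val (M : Model) : ∃ val : M.D T0 → M.Q, Dfn M val ∧
    (∀ c p m d : M.D T0, RatCode c p m d → ((p : M.Q) - m) / (d + 1) = val c) ∧
      ∀ c : M.D T0, ∃ p m d : M.D T0, RatCode c p m d := by
  obtain ⟨U, hU, hU'⟩ := exists_dfn_choice (M := M)
    (P := fun c u => ∃ d, d < c + 1 ∧ c = Model.pr u d)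
    (Dfn.bexLt (by fun_prop) (by fun_prop)) fun c => by
      obtain ⟨u, -, h⟩ := exists_pr c
      exact ⟨u, h⟩
  obtain ⟨D, hD, hD'⟩ := exists_dfn_choice (M := M) (P := fun c d => c = Model.pr (U c) d)
    (by fun_prop) fun c => by
      obtain ⟨d, -, h⟩ := hU' c
      exact ⟨d, h⟩
  obtain ⟨H, hH, hH'⟩ := exists_dfn_choice (M := M) (P := fun u h => u = 2 * h ∨ u = 2 * h + 1)
    (by fun_prop) exists_half
  refine ⟨fun c => Model.frac (sel (U c = 2 * H (U c)) (H (U c)) 0,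
    sel (U c = 2 * H (U c)) 0 (H (U c) + 1), D c), Dfn.frac.comp (by fun_prop), ?_, fun c => ?_⟩
  · intro c p m d hc
    rcases hc with ⟨rfl, hc⟩ | ⟨rfl, u, hu, hc⟩
    · obtain ⟨h₁, h₂⟩ := pr_injective ((hD' c).symm.trans hc)
      dsimp only
      rw [h₁, h₂]
      rcases hH' (2 * p) with h | h
      · rw [sel_pos h, sel_pos h, frac, ← mul_left_cancel₀ two_ne_zero h]
      · exact absurd h.symm (two_mul_add_one_ne _ _)
    · obtain ⟨h₁, h₂⟩ := pr_injective ((hD' c).symm.trans hc)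
      dsimp only
      rw [h₁, h₂]
      rcases hH' u with h | h
      · rw [h] at hu
        exact absurd hu (two_mul_add_one_ne _ _)
      · have hne : ¬ u = 2 * H u := fun h' => two_mul_add_one_ne (H u) (H u) (h.symm.trans h')
        have hm : m = H u + 1 := by
          generalize H u = v at h ⊢
          refine mul_left_cancel₀ (two_ne_zero (α := M.D T0)) ?_
          rw [← hu, h]
          ring
        rw [sel_neg hne, sel_neg hne, frac, hm]
  · rcases hH' (U c) with h | h
    · exact ⟨H (U c), 0, D c, Or.inl ⟨rfl, by rw [← h]; exact hD' c⟩⟩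
    · refine ⟨0, H (U c) + 1, D c, Or.inr ⟨rfl, U c, ?_, hD' c⟩⟩
      conv_lhs => rw [h]
      ring

/-- The rational number coded by `c`. -/
noncomputable def val (c : M.D T0) : M.Q := (exists_val M).choose c

@[fun_prop] theorem Dfn.val {f : X → M.D T0} (hf : Dfn M f) : Dfn M fun x => val (f x) :=
  (exists_val M).choose_spec.1.comp hf

theorem RatCode.val_eq {c p m d : M.D T0} (h : RatCode c p m d) :
    ((p : M.Q) - m) / (d + 1) = val c := (exists_val M).choose_spec.2.1 _ _ _ _ h

theorem exists_ratCode (c : M.D T0) : ∃ p m d, RatCode c p m d := (exists_val M).choose_spec.2.2 c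

/-- A code of `p / 2 ^ n`. -/
noncomputable def dyad (p n : M.D T0) : M.D T0 := pr (2 * p) (monus (pw n) 1)

@[fun_prop] theorem Dfn.dyad {f g : X → M.D T0} (hf : Dfn M f) (hg : Dfn M g) :
    Dfn M fun x => dyad (f x) (g x) := by
  unfold Model.dyad
  fun_prop

theorem val_dyad (p n : M.D T0) : val (dyad p n) = p * eps n := by
  rw [← RatCode.val_eq (c := dyad p n) (Or.inl ⟨rfl, rfl⟩), cast_monus (one_le_pw n), eps]
  simp [div_eq_mul_inv]

/-! #### Satisfaction of formulas about rational numbers -/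

variable {Γ : Ctx}

/-- The value of a rational expression. -/
noncomputable def ratVal (γ : Env M.D Γ) (a : RatTm Γ) : M.Q :=
  ((a.pos.eval M.toStr γ : M.D T0) - (a.neg.eval M.toStr γ : M.D T0)) / (a.den.eval M.toStr γ : M.D T0)

/-- The denominator is positive. -/
def RatPos (γ : Env M.D Γ) (a : RatTm Γ) : Prop := 0 < (a.den.eval M.toStr γ : M.D T0)

section
variable {γ : Env M.D Γ} {a b c : RatTm Γ}

@[simp] theorem ratVal_wk {τ : Ty} (x : M.D τ) : ratVal (Env.cons x γ) a.wk = ratVal γ a := by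
  simp [ratVal, RatTm.wk]

theorem RatPos.wk {τ : Ty} (x : M.D τ) (h : RatPos γ a) : RatPos (Env.cons x γ) a.wk := by
  simpa [RatPos, RatTm.wk] using h

theorem RatPos.add (ha : RatPos γ a) (hb : RatPos γ b) : RatPos γ (a.add b) := mul_pos ha hb

theorem RatPos.sub (ha : RatPos γ a) (hb : RatPos γ b) : RatPos γ (a.sub b) := mul_pos ha hb

theorem RatPos.cast (ha : RatPos γ a) : (0 : M.Q) < (a.den.eval M.toStr γ : M.D T0) := by
  rw [← cast_zero, cast_lt]
  exact ha

theorem ratVal_add (ha : RatPos γ a) (hb : RatPos γ b) :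
    ratVal γ (a.add b) = ratVal γ a + ratVal γ b := by
  simp only [ratVal, RatTm.add, eval_add, eval_mul, cast_add, cast_mul]
  rw [div_add_div _ _ ha.cast.ne' hb.cast.ne']
  congr 1
  ring

theorem ratVal_sub (ha : RatPos γ a) (hb : RatPos γ b) :
    ratVal γ (a.sub b) = ratVal γ a - ratVal γ b := by
  simp only [ratVal, RatTm.sub, RatTm.opp, RatTm.add, eval_add, eval_mul, cast_add, cast_mul]
  rw [div_sub_div _ _ ha.cast.ne' hb.cast.ne']
  congr 1
  ring

theorem sat_ratLt (ha : RatPos γ a) (hb : RatPos γ b) :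
    (a.lt b).Sat M.toStr γ ↔ ratVal γ a < ratVal γ b := by
  rw [RatTm.lt, sat_lt', ratVal, ratVal, div_lt_div_iff₀ ha.cast hb.cast, ← cast_lt (M := M)]
  simp only [eval_add, eval_mul, cast_add, cast_mul]
  constructor <;> intro h <;> linarith

theorem sat_ratLe (ha : RatPos γ a) (hb : RatPos γ b) :
    (a.le b).Sat M.toStr γ ↔ ratVal γ a ≤ ratVal γ b := by
  rw [RatTm.le, sat_le, ratVal, ratVal, div_le_div_iff₀ ha.cast hb.cast, ← cast_le (M := M)]
  simp only [eval_add, eval_mul, cast_add, cast_mul]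
  constructor <;> intro h <;> linarith

theorem sat_distLt (ha : RatPos γ a) (hb : RatPos γ b) (hc : RatPos γ c) :
    (a.distLt b c).Sat M.toStr γ ↔ |ratVal γ a - ratVal γ b| < ratVal γ c := by
  rw [RatTm.distLt, sat_and, sat_ratLt (ha.sub hb) hc, sat_ratLt (hb.sub ha) hc, ratVal_sub ha hb,
    ratVal_sub hb ha, abs_lt]
  constructor <;> rintro ⟨h₁, h₂⟩ <;> constructor <;> linarith

theorem sat_distLe (ha : RatPos γ a) (hb : RatPos γ b) (hc : RatPos γ c) :
    (a.distLe b c).Sat M.toStr γ ↔ |ratVal γ a - ratVal γ b| ≤ ratVal γ c := by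
  rw [RatTm.distLe, sat_and, sat_ratLe (ha.sub hb) hc, sat_ratLe (hb.sub ha) hc, ratVal_sub ha hb,
    ratVal_sub hb ha, abs_le]
  constructor <;> rintro ⟨h₁, h₂⟩ <;> constructor <;> linarith

end

@[simp] theorem eval_two (γ : Env M.D Γ) : tTwo.eval M.toStr γ = 2 := one_add_one_eq_two

theorem ratPos_zero (γ : Env M.D Γ) : RatPos γ ratZero := one_pos (α := M.D T0)
theorem ratPos_one (γ : Env M.D Γ) : RatPos γ ratOne := one_pos (α := M.D T0)
theorem ratPos_eps (γ : Env M.D Γ) (n : Term Γ T0) : RatPos γ (ratEps n) := pw_pos (M := M) _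
theorem ratPos_twoEps (γ : Env M.D Γ) (n : Term Γ T0) : RatPos γ (ratTwoEps n) := pw_pos (M := M) _

@[simp] theorem ratVal_zero (γ : Env M.D Γ) : ratVal γ ratZero = 0 := by simp [ratVal, ratZero]
@[simp] theorem ratVal_one (γ : Env M.D Γ) : ratVal γ ratOne = 1 := by simp [ratVal, ratOne]
@[simp] theorem ratVal_eps (γ : Env M.D Γ) (n : Term Γ T0) :
    ratVal γ (ratEps n) = eps (n.eval M.toStr γ) := by simp [ratVal, ratEps, eps]
@[simp] theorem ratVal_twoEps (γ : Env M.D Γ) (n : Term Γ T0) :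
    ratVal γ (ratTwoEps n) = 2 * eps (n.eval M.toStr γ) := by
  simp only [ratVal, ratTwoEps, eps, div_eq_mul_inv, eval_two, eval_zero, eval_powTwo, cast_zero,
    sub_zero, one_mul]
  rw [cast_ofNat]

theorem sat_isPair (γ : Env M.D Γ) (c u d : Term Γ T0) : (isPair c u d).Sat M.toStr γ ↔
    (c.eval M.toStr γ : M.D T0) = pr (u.eval M.toStr γ) (d.eval M.toStr γ) := by
  rw [isPair, sat_eq]
  simp only [eval_add, eval_mul, eval_two, eval_one]
  rw [two_add_one_eq_three, ← two_mul_pr]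
  exact (mul_right_injective₀ two_ne_zero).eq_iff

theorem sat_isRatCode (γ : Env M.D Γ) (c p m d : Term Γ T0) : (isRatCode c p m d).Sat M.toStr γ ↔
    RatCode (c.eval M.toStr γ) (p.eval M.toStr γ) (m.eval M.toStr γ) (d.eval M.toStr γ) := by
  simp [isRatCode, RatCode, sat_isPair]

/-- A rational number with a positive denominator read off from three bound variables. -/
theorem sat_withRat {γ : Env M.D Γ} {c : Term Γ T0}
    {A : RatTm (T0 :: T0 :: T0 :: Γ) → Formula (T0 :: T0 :: T0 :: Γ)} {Φ : M.Q → Prop}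
    (h : ∀ p m d : M.D T0, ∀ a : RatTm (T0 :: T0 :: T0 :: Γ),
      RatPos (Env.cons d (Env.cons m (Env.cons p γ))) a →
        ((A a).Sat M.toStr (Env.cons d (Env.cons m (Env.cons p γ))) ↔
          Φ (ratVal (Env.cons d (Env.cons m (Env.cons p γ))) a))) :
    (withRat c A).Sat M.toStr γ ↔ Φ (val (c.eval M.toStr γ)) := by
  have key : ∀ p m d : M.D T0, RatCode (c.eval M.toStr γ) p m d →
      ((A ⟨v2, v1, v0 +₀ tOne⟩).Sat M.toStr (Env.cons d (Env.cons m (Env.cons p γ))) ↔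
        Φ (val (c.eval M.toStr γ))) := by
    intro p m d hc
    rw [h p m d, ← hc.val_eq]
    · simp [ratVal]
    · change (0 : M.D T0) < d + 1
      exact lt_of_le_of_lt (zero_le' d) (lt_add_one' d)
  simp only [withRat, sat_ex, sat_and, sat_isRatCode, eval_v0, eval_v1, eval_v2, Tm.eval_wk]
  constructor
  · rintro ⟨p, m, d, hc, hA⟩
    exact (key p m d hc).1 hA
  · intro hΦ
    obtain ⟨p, m, d, hc⟩ := exists_ratCode (c.eval M.toStr γ : M.D T0)
    exact ⟨p, m, d, hc, (key p m d hc).2 hΦ⟩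

/-! #### Real numbers -/

/-- The `n`-th approximation. -/
noncomputable def ap (x : M.D T1) (n : M.D T0) : M.Q := val (x n)

@[fun_prop] theorem Dfn.ap {f : X → M.D T1} {g : X → M.D T0} (hf : Dfn M f) (hg : Dfn M g) :
    Dfn M fun x => ap (f x) (g x) := by
  unfold Model.ap
  fun_prop

def IsReal (x : M.D T1) : Prop := ∀ n i : M.D T0, |ap x n - ap x (n + i)| < eps n

def EqReal (x y : M.D T1) : Prop := ∀ n : M.D T0, |ap x n - ap y n| ≤ 2 * eps n

def IsPosReal (x : M.D T1) : Prop := ∃ n : M.D T0, 2 * eps n < ap x n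

def InUnit (x : M.D T1) : Prop :=
  (¬ ∃ n : M.D T0, ap x n + 2 * eps n < 0) ∧ ¬ ∃ n : M.D T0, 1 + 2 * eps n < ap x n

def InBall (x y r : M.D T1) : Prop :=
  (∃ n : M.D T0, ap y (n + 1) - ap r (n + 1) + 2 * eps n < ap x n) ∧
    ∃ n : M.D T0, ap x n + 2 * eps n < ap y (n + 1) + ap r (n + 1)

theorem sat_isReal (γ : Env M.D Γ) (x : Term Γ T1) :
    (isReal x).Sat M.toStr γ ↔ IsReal (x.eval M.toStr γ) := by
  simp only [isReal, sat_all]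
  refine forall_congr' fun n => forall_congr' fun i => ?_
  rw [sat_withRat (Φ := fun q => |q - ap (x.eval M.toStr γ) (n + i)| < eps n)]
  · simp [ap]
  intro p m d a ha
  rw [sat_withRat (Φ := fun q => |ratVal (Env.cons d (Env.cons m (Env.cons p
    (Env.cons i (Env.cons n γ))))) a - q| < eps n)]
  · simp [ap]
  intro p' m' d' b hb
  rw [sat_distLt (((ha.wk _).wk _).wk _) hb (ratPos_eps _ _)]
  simp

theorem sat_eqReal (γ : Env M.D Γ) (x y : Term Γ T1) :
    (eqReal x y).Sat M.toStr γ ↔ EqReal (x.eval M.toStr γ) (y.eval M.toStr γ) := by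
  simp only [eqReal, sat_all]
  refine forall_congr' fun n => ?_
  rw [sat_withRat (Φ := fun q => |q - ap (y.eval M.toStr γ) n| ≤ 2 * eps n)]
  · simp [ap]
  intro p m d a ha
  rw [sat_withRat (Φ := fun q => |ratVal (Env.cons d (Env.cons m (Env.cons p
    (Env.cons n γ)))) a - q| ≤ 2 * eps n)]
  · simp [ap]
  intro p' m' d' b hb
  rw [sat_distLe (((ha.wk _).wk _).wk _) hb (ratPos_twoEps _ _)]
  simp

theorem sat_isPosReal (γ : Env M.D Γ) (x : Term Γ T1) :
    (isPosReal x).Sat M.toStr γ ↔ IsPosReal (x.eval M.toStr γ) := by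
  simp only [isPosReal, sat_ex]
  refine exists_congr fun n => ?_
  rw [sat_withRat (Φ := fun q => 2 * eps n < q)]
  · simp [ap]
  intro p m d a ha
  rw [sat_ratLt (ratPos_twoEps _ _) ha]
  simp

theorem sat_inUnitInterval (γ : Env M.D Γ) (x : Term Γ T1) :
    (inUnitInterval x).Sat M.toStr γ ↔ InUnit (x.eval M.toStr γ) := by
  simp only [inUnitInterval, sat_and, sat_neg, sat_ex]
  refine and_congr (not_congr (exists_congr fun n => ?_)) (not_congr (exists_congr fun n => ?_))
  · rw [sat_withRat (Φ := fun q => q + 2 * eps n < 0)]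
    · simp [ap]
    intro p m d a ha
    rw [sat_ratLt (ha.add (ratPos_twoEps _ _)) (ratPos_zero _), ratVal_add ha (ratPos_twoEps _ _)]
    simp
  · rw [sat_withRat (Φ := fun q => 1 + 2 * eps n < q)]
    · simp [ap]
    intro p m d a ha
    rw [sat_ratLt ((ratPos_one _).add (ratPos_twoEps _ _)) ha,
      ratVal_add (ratPos_one _) (ratPos_twoEps _ _)]
    simp

theorem sat_inBall (γ : Env M.D Γ) (x y r : Term Γ T1) : (inBall x y r).Sat M.toStr γ ↔
    InBall (x.eval M.toStr γ) (y.eval M.toStr γ) (r.eval M.toStr γ) := by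
  simp only [inBall, sat_and, sat_ex]
  refine and_congr (exists_congr fun n => ?_) (exists_congr fun n => ?_)
  · rw [sat_withRat (Φ := fun q => ap (y.eval M.toStr γ) (n + 1) - ap (r.eval M.toStr γ) (n + 1) +
      2 * eps n < q)]
    · simp [ap]
    intro p m d a ha
    rw [sat_withRat (Φ := fun q => q - ap (r.eval M.toStr γ) (n + 1) + 2 * eps n <
      ratVal (Env.cons d (Env.cons m (Env.cons p (Env.cons n γ)))) a)]
    · simp [ap]
    intro p' m' d' b hb
    rw [sat_withRat (Φ := fun q => ratVal (Env.cons d' (Env.cons m' (Env.cons p'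
      (Env.cons d (Env.cons m (Env.cons p (Env.cons n γ))))))) b - q + 2 * eps n <
      ratVal (Env.cons d (Env.cons m (Env.cons p (Env.cons n γ)))) a)]
    · simp [ap]
    intro p'' m'' d'' c hc
    have hb' := ((hb.wk p'').wk m'').wk d''
    rw [sat_ratLt ((hb'.sub hc).add (ratPos_twoEps _ _))
      ((((((ha.wk _).wk _).wk _).wk _).wk _).wk _), ratVal_add (hb'.sub hc) (ratPos_twoEps _ _),
      ratVal_sub hb' hc]
    simp
  · rw [sat_withRat (Φ := fun q => q + 2 * eps n <
      ap (y.eval M.toStr γ) (n + 1) + ap (r.eval M.toStr γ) (n + 1))]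
    · simp [ap]
    intro p m d a ha
    rw [sat_withRat (Φ := fun q => ratVal (Env.cons d (Env.cons m (Env.cons p (Env.cons n γ)))) a +
      2 * eps n < q + ap (r.eval M.toStr γ) (n + 1))]
    · simp [ap]
    intro p' m' d' b hb
    rw [sat_withRat (Φ := fun q => ratVal (Env.cons d (Env.cons m (Env.cons p (Env.cons n γ)))) a +
      2 * eps n < ratVal (Env.cons d' (Env.cons m' (Env.cons p'
      (Env.cons d (Env.cons m (Env.cons p (Env.cons n γ))))))) b + q)]
    · simp [ap]
    intro p'' m'' d'' c hc
    have ha' := (((((ha.wk p').wk m').wk d').wk p'').wk m'').wk d''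
    have hb' := ((hb.wk p'').wk m'').wk d''
    rw [sat_ratLt (ha'.add (ratPos_twoEps _ _)) (hb'.add hc), ratVal_add ha' (ratPos_twoEps _ _),
      ratVal_add hb' hc]
    simp

end

/-! ### Cantor space -/

/-- Binary sequences. -/
def Bin (f : M.D T1) : Prop := ∀ n : M.D T0, f n ≤ 1

/-- `f` and `g` agree below `n`. -/
def Agree (f g : M.D T1) (n : M.D T0) : Prop := ∀ m, m < n → f m = g m

/-- The sequence `w 0, …, w (k - 1)` provides a covering of Cantor space. -/
def Covers (G : M.D T2) (k : M.D T0) (w : M.D (T0 ⇾ T1)) : Prop :=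
  ∀ f, Bin f → ∃ i, i < k ∧ Agree f (w i) (G (w i))

def Loc (F G : M.D T2) : Prop := ∀ f g, Bin f → Bin g → Agree g f (G f) → F g ≤ G f

theorem Agree.symm {f g : M.D T1} {n : M.D T0} (h : Agree f g n) : Agree g f n :=
  fun m hm => (h m hm).symm

theorem Agree.trans {f g h : M.D T1} {n : M.D T0} (h₁ : Agree f g n) (h₂ : Agree g h n) :
    Agree f h n := fun m hm => (h₁ m hm).trans (h₂ m hm)

theorem Agree.mono {f g : M.D T1} {m n : M.D T0} (h : Agree f g n) (hm : m ≤ n) : Agree f g m :=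
  fun i hi => h i (hi.trans_le hm)

section
variable {X : Type} [Obj M X]

@[fun_prop] theorem Dfn.agree {f g : X → M.D T1} {n : X → M.D T0} (hf : Dfn M f) (hg : Dfn M g)
    (hn : Dfn M n) : Dfn M fun x => Agree (f x) (g x) (n x) :=
  Dfn.ballLt hn (by fun_prop)

/-! #### Satisfaction of the principles -/

section
variable {Γ : Ctx}

@[simp] theorem sat_exBelow (γ : Env M.D Γ) (k : Term Γ T0) (A : Formula (T0 :: Γ)) :
    (exBelow k A).Sat M.toStr γ ↔
      ∃ i : M.D T0, i < k.eval M.toStr γ ∧ A.Sat M.toStr (Env.cons i γ) := by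
  simp [exBelow]

@[simp] theorem sat_allBelow (γ : Env M.D Γ) (k : Term Γ T0) (A : Formula (T0 :: Γ)) :
    (allBelow k A).Sat M.toStr γ ↔
      ∀ i : M.D T0, i < k.eval M.toStr γ → A.Sat M.toStr (Env.cons i γ) := by
  simp [allBelow]

@[simp] theorem sat_inCantor (γ : Env M.D Γ) (f : Term Γ T1) :
    (inCantor f).Sat M.toStr γ ↔ Bin (f.eval M.toStr γ) := by
  simp [inCantor, Bin]

@[simp] theorem sat_inNbhd (γ : Env M.D Γ) (g f : Term Γ T1) (n : Term Γ T0) :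
    (inNbhd g f n).Sat M.toStr γ ↔
      Agree (g.eval M.toStr γ) (f.eval M.toStr γ) (n.eval M.toStr γ) := by
  simp [inNbhd, Agree]

@[simp] theorem sat_locF (γ : Env M.D Γ) (F G : Term Γ T2) :
    (locF F G).Sat M.toStr γ ↔ Loc (F.eval M.toStr γ) (G.eval M.toStr γ) := by
  simp [locF, Loc]

@[simp] theorem sat_boundedOnCantor (γ : Env M.D Γ) (F : Term Γ T2) (N : Term Γ T0) :
    (boundedOnCantor F N).Sat M.toStr γ ↔
      ∀ g, Bin g → (F.eval M.toStr γ : M.D T2) g ≤ N.eval M.toStr γ := by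
  simp [boundedOnCantor]

@[simp] theorem sat_coversCantor (γ : Env M.D Γ) (G : Term Γ T2) (k : Term Γ T0)
    (w : Term Γ (T0 ⇾ T1)) : (coversCantor G k w).Sat M.toStr γ ↔
      Covers (G.eval M.toStr γ) (k.eval M.toStr γ) (w.eval M.toStr γ) := by
  simp [coversCantor, Covers]

end

theorem sat_PITu : PITu.Sat M.toStr Env.nil ↔
    ∀ G : M.D T2, ∃ N, ∀ F : M.D T2, Loc F G → ∀ g, Bin g → F g ≤ N := by
  simp [PITu]

theorem sat_HBUc : HBUc.Sat M.toStr Env.nil ↔ ∀ G : M.D T2, ∃ k w, Covers G k w := by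
  simp [HBUc]

theorem sat_existsSCF : existsSCF.Sat M.toStr Env.nil ↔
    ∃ (K : M.D T3) (W : M.D (T2 ⇾ T0 ⇾ T1)), ∀ G, Covers G (K G) (W G) := by
  simp [existsSCF]

theorem sat_existsPR : existsPR.Sat M.toStr Env.nil ↔
    ∃ R : M.D T3, ∀ F G : M.D T2, Loc F G → ∀ g, Bin g → F g ≤ R G := by
  simp [existsPR]

/-- `Ψ` maps reals to positive reals and equal reals to equal reals. -/
def PosRealFunction (Ψ : M.D (T1 ⇾ T1)) : Prop :=
  (∀ x, IsReal x → IsReal (Ψ x) ∧ IsPosReal (Ψ x)) ∧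
    ∀ x y, IsReal x → IsReal y → EqReal x y → EqReal (Ψ x) (Ψ y)

theorem sat_HBU : HBU.Sat M.toStr Env.nil ↔ ∀ Ψ : M.D (T1 ⇾ T1), PosRealFunction Ψ →
    ∃ (k : M.D T0) (w : M.D (T0 ⇾ T1)), (∀ i, i < k → IsReal (w i)) ∧
      ∀ x, IsReal x → InUnit x → ∃ i, i < k ∧ InBall x (w i) (Ψ (w i)) := by
  simp [HBU, isPosRealFunction, sat_isReal, sat_isPosReal, sat_eqReal, sat_inUnitInterval,
    sat_inBall, PosRealFunction]

/-! #### Finite binary sequences -/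

/-- The sequence `min (f i) 1`. -/
noncomputable def clip (f : M.D T1) : M.D T1 := lam fun i => sel (f i = 0) 0 1

@[fun_prop] theorem Dfn.clip {f : X → M.D T1} (hf : Dfn M f) : Dfn M fun x => clip (f x) := by
  unfold Model.clip
  fun_prop

theorem clip_apply (f : M.D T1) (i : M.D T0) : clip f i = sel (f i = 0) 0 1 :=
  lam_apply (by fun_prop) i

theorem bin_clip (f : M.D T1) : Bin (clip f) := by
  intro i
  rw [clip_apply]
  by_cases h : f i = 0
  · rw [sel_pos h]
    exact zero_le' 1
  · rw [sel_neg h]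

theorem eq_zero_or_one {a : M.D T0} (h : a ≤ 1) : a = 0 ∨ a = 1 := by
  rcases h.lt_or_eq with h | h
  · left
    rw [← zero_add (1 : M.D T0), lt_add_one_iff'] at h
    exact le_antisymm h (zero_le' a)
  · exact Or.inr h

theorem clip_apply_of_le {f : M.D T1} {i : M.D T0} (h : f i ≤ 1) : clip f i = f i := by
  rw [clip_apply]
  rcases eq_zero_or_one h with h | h
  · rw [sel_pos h, h]
  · rw [sel_neg (by rw [h]; exact one_ne_zero), h]

theorem Bin.clip_eq {f : M.D T1} (h : Bin f) : clip f = f := M.ext fun i => clip_apply_of_le (h i)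

/-- The value of the first `n` entries of `f` as digits in the base `b`. -/
noncomputable def digits (b : M.D T0) (f : M.D T1) (n : M.D T0) : M.D T0 :=
  natRec (fun k r => b * r + f k) 0 n

@[fun_prop] theorem Dfn.digits {b : X → M.D T0} {f : X → M.D T1} {n : X → M.D T0} (hb : Dfn M b)
    (hf : Dfn M f) (hn : Dfn M n) : Dfn M fun x => digits (b x) (f x) (n x) := by
  unfold Model.digits
  fun_prop

theorem digits_zero (b : M.D T0) (f : M.D T1) : digits b f 0 = 0 := natRec_zero _ _

theorem digits_succ (b : M.D T0) (f : M.D T1) (n : M.D T0) :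
    digits b f (n + 1) = b * digits b f n + f n := natRec_succ (by fun_prop) _ _

theorem digits_congr (b : M.D T0) {f g : M.D T1} {n : M.D T0} (h : Agree f g n) :
    digits b f n = digits b g n := by
  have hd : Dfn M fun m => Agree f g m → digits b f m = digits b g m :=
    Dfn.imp (by fun_prop) (by fun_prop)
  refine induct hd (fun _ => by rw [digits_zero, digits_zero]) (fun m ih h => ?_) n h
  rw [digits_succ, digits_succ, ih (h.mono (lt_add_one' m).le), h m (lt_add_one' m)]

theorem digit_unique {b a a' x y : M.D T0} (hb : 2 ≤ b) (hx : x ≤ 1) (hy : y ≤ 1)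
    (h : b * a + x = b * a' + y) : a = a' ∧ x = y := by
  have key : ∀ {a a' x y : M.D T0}, x ≤ 1 → b * a + x = b * a' + y → a' ≤ a := by
    intro a a' x y hx h
    by_contra hlt
    have h₁ : b * a + b ≤ b * a' := by
      have := mul_le_mul' (le_refl b) (lt_iff_add_one_le.1 (not_le.1 hlt))
      rwa [mul_add, mul_one] at this
    have h₂ : b * a + 2 ≤ b * a + 1 :=
      calc b * a + 2 ≤ b * a + b := add_le_add le_rfl hb
        _ ≤ b * a' := h₁
        _ ≤ b * a' + y := le_self_add
        _ = b * a + x := h.symm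
        _ ≤ b * a + 1 := add_le_add le_rfl hx
    rw [add_le_add_iff_left, ← one_add_one_eq_two] at h₂
    exact absurd h₂ (not_le.2 (lt_add_one' 1))
  have e := le_antisymm (key hy h.symm) (key hx h)
  subst e
  exact ⟨rfl, add_left_cancel h⟩

/-- Base `2` is used to enumerate finite binary sequences, base `4` to embed them in the line with
gaps. -/
theorem agree_of_digits_eq {b : M.D T0} (hb : 2 ≤ b) {f g : M.D T1} (hf : Bin f) (hg : Bin g)
    {n : M.D T0} (h : digits b f n = digits b g n) : Agree f g n := by
  have hd : Dfn M fun m => digits b f m = digits b g m → Agree f g m :=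
    Dfn.imp (by fun_prop) (by fun_prop)
  refine induct hd (fun _ m hm => absurd hm (not_lt.2 (zero_le' m))) (fun m ih h i hi => ?_) n h
  rw [digits_succ, digits_succ] at h
  obtain ⟨h₁, h₂⟩ := digit_unique hb (hf m) (hg m) h
  rcases (lt_add_one_iff'.1 hi).lt_or_eq with hi | rfl
  · exact ih h₁ i hi
  · exact h₂

theorem digits_two_lt {f : M.D T1} (hf : Bin f) (n : M.D T0) : digits 2 f n < pw n := by
  refine induct (P := fun n => digits 2 f n < Model.pw n) (by fun_prop)
    (by rw [digits_zero, pw_zero]; exact one_pos) (fun n ih => ?_) n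
  rw [digits_succ, pw_succ]
  calc 2 * digits 2 f n + f n ≤ 2 * digits 2 f n + 1 := add_le_add le_rfl (hf n)
    _ < 2 * (digits 2 f n + 1) := by
      rw [mul_add, mul_one, add_lt_add_iff_left, ← one_add_one_eq_two]
      exact lt_add_one' 1
    _ ≤ 2 * pw n := mul_le_mul' le_rfl (lt_iff_add_one_le.1 ih)

/-- `c / 2 ^ k`, rounded down. -/
noncomputable def shr (c k : M.D T0) : M.D T0 := floor ((c : M.Q) * eps k)

@[fun_prop] theorem Dfn.shr {f g : X → M.D T0} (hf : Dfn M f) (hg : Dfn M g) :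
    Dfn M fun x => shr (f x) (g x) := by
  unfold Model.shr
  fun_prop

theorem shr_zero (c : M.D T0) : shr c 0 = c :=
  floor_eq_of (by rw [eps_zero, mul_one]) (by rw [eps_zero, mul_one]; exact lt_add_one _)

theorem shr_eq (c k : M.D T0) :
    shr c k = 2 * shr c (k + 1) ∨ shr c k = 2 * shr c (k + 1) + 1 := by
  have h₀ : (0 : M.Q) ≤ (c : M.Q) * eps (k + 1) := mul_nonneg (cast_nonneg c) (eps_pos _).le
  have e : (c : M.Q) * eps k = 2 * ((c : M.Q) * eps (k + 1)) := by rw [eps_succ]; ring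
  have h₁ := floor_le h₀
  have h₂ := lt_floor_add_one ((c : M.Q) * eps (k + 1))
  rcases lt_or_ge ((c : M.Q) * eps k) (2 * (shr c (k + 1) : M.D T0) + 1) with h | h
  · left
    refine floor_eq_of ?_ ?_
    · rw [cast_mul, cast_ofNat, e]
      exact mul_le_mul_of_nonneg_left h₁ two_pos.le
    · rwa [cast_mul, cast_ofNat]
  · right
    refine floor_eq_of ?_ ?_
    · rwa [cast_add, cast_mul, cast_ofNat, cast_one]
    · rw [cast_add, cast_mul, cast_ofNat, cast_one, e]
      change _ < 2 * ((floor ((c : M.Q) * eps (k + 1)) : M.D T0) : M.Q) + 1 + 1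
      linarith

/-- The binary sequence of length `n` with value `c`. -/
noncomputable def dec (c n : M.D T0) : M.D T1 :=
  lam fun i => monus (shr c (monus n (i + 1))) (2 * shr c (monus n i))

@[fun_prop] theorem Dfn.dec {f g : X → M.D T0} (hf : Dfn M f) (hg : Dfn M g) :
    Dfn M fun x => dec (f x) (g x) := by
  unfold Model.dec
  fun_prop

theorem dec_apply (c n i : M.D T0) :
    dec c n i = monus (shr c (monus n (i + 1))) (2 * shr c (monus n i)) :=
  lam_apply (by fun_prop) i

theorem monus_add_left (a b : M.D T0) : monus (a + b) a = b := by
  have := monus_add_cancel (a := a + b) (b := a) le_self_add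
  rw [add_comm] at this
  exact add_left_cancel this

theorem monus_of_lt {n i : M.D T0} (h : i < n) : monus n i = monus n (i + 1) + 1 := by
  refine add_right_cancel (b := i) ?_
  rw [monus_add_cancel h.le, add_assoc, add_comm 1, monus_add_cancel (lt_iff_add_one_le.1 h)]

theorem shr_monus {c n i : M.D T0} (h : i < n) :
    shr c (monus n (i + 1)) = 2 * shr c (monus n i) + dec c n i ∧ dec c n i ≤ 1 := by
  rw [dec_apply, monus_of_lt h]
  rcases shr_eq c (monus n (i + 1)) with h | h <;> rw [h]
  · rw [monus_eq_zero_iff.2 le_rfl, add_zero]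
    exact ⟨rfl, zero_le' 1⟩
  · rw [monus_add_left]
    exact ⟨rfl, le_rfl⟩

theorem bin_dec (c n : M.D T0) : Bin (dec c n) := by
  intro i
  rcases lt_or_ge i n with h | h
  · exact (shr_monus h).2
  · rw [dec_apply, monus_eq_zero_iff.2 h, monus_eq_zero_iff.2 (h.trans (lt_add_one' i).le),
      monus_eq_zero_iff.2]
    · exact zero_le' 1
    · rw [two_mul]
      exact le_self_add

/-- The first `i` of the `n` binary digits of `c` have the value of `c` shifted right by `n - i`
places. -/
theorem digits_dec {c n : M.D T0} (hc : c < pw n) : digits 2 (dec c n) n = c := by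
  have hd : Dfn M fun i => i ≤ n → digits 2 (dec c n) i = shr c (monus n i) :=
    Dfn.imp (by fun_prop) (by fun_prop)
  have h := induct hd (fun _ => ?_) (fun i ih hi => ?_) n le_rfl
  · rwa [monus_eq_zero_iff.2 le_rfl, shr_zero] at h
  · rw [digits_zero, monus_zero]
    refine (floor_eq_of ?_ ?_).symm
    · rw [cast_zero]
      exact mul_nonneg (cast_nonneg c) (eps_pos _).le
    · rw [cast_zero, zero_add, eps, mul_one_div, div_lt_one (cast_pw_pos n), cast_lt]
      exact hc
  · have hi' := lt_iff_add_one_le.2 hi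
    rw [digits_succ, ih hi'.le, (shr_monus hi').1]

theorem agree_dec {f : M.D T1} (hf : Bin f) (n : M.D T0) : Agree (dec (digits 2 f n) n) f n :=
  agree_of_digits_eq le_rfl (bin_dec _ _) hf (digits_dec (digits_two_lt hf n))

end

/-! ### Coverings and realisers -/

/-- A sufficient condition for a covering: all members of Cantor space have neighbourhoods of
uniformly bounded length. -/
theorem exists_covers (hc : M.Choice T0 T1) {G : M.D T2} {N : M.D T0}
    (h : ∀ g, Bin g → ∃ f, Bin f ∧ Agree f g (G f) ∧ G f ≤ N) : ∃ k w, Covers G k w := by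
  -- Being a binary sequence is not a bounded condition, so the matrix speaks of `clip f` for
  -- arbitrary `f` and stays decidable.
  obtain ⟨Y, hY⟩ := hc.exists_functional
    (P := fun c f => Agree (clip f) (dec c N) (G (clip f)) ∧ G (clip f) ≤ N) (by fun_prop)
    fun c => by
      obtain ⟨f, hf, h₁, h₂⟩ := h (dec c N) (bin_dec c N)
      exact ⟨f, by rw [hf.clip_eq]; exact ⟨h₁, h₂⟩⟩
  have e : ∀ c, lam (M := M) (fun c => clip (Y c)) c = clip (Y c) := lam_apply (by fun_prop)
  -- There is one centre for each binary sequence of length `N`, and `f` is referred to the one with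
  -- its own first `N` entries.
  refine ⟨pw N, lam fun c => clip (Y c), fun f hf => ⟨digits 2 f N, digits_two_lt hf N, ?_⟩⟩
  rw [e]
  obtain ⟨h₁, h₂⟩ := hY (digits 2 f N)
  exact (h₁.trans ((agree_dec hf N).mono h₂)).symm

/-- The functional `G ∘ clip`. -/
noncomputable def clipped (G : M.D T2) : M.D T2 := lam fun f => G (clip f)

theorem clipped_apply (G : M.D T2) (f : M.D T1) : clipped G f = G (clip f) :=
  lam_apply (by fun_prop) f

theorem Agree.clip {f g : M.D T1} {n : M.D T0} (h : Agree f g n) (hf : Bin f) :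
    Agree f (clip g) n := fun m hm => by
  rw [clip_apply_of_le (by rw [← h m hm]; exact hf m), h m hm]

/-- On each neighbourhood `F` is bounded by the value of `G` at the centre. Centres of a covering
need not be binary while `LOC` concerns Cantor space only; `clipped` makes the neighbourhoods use
the values at the clipped centres, and clipping a centre loses no binary member of its
neighbourhood. -/
theorem Loc.bounded {F G : M.D T2} (hF : Loc F G) {k : M.D T0} {w : M.D (T0 ⇾ T1)}
    (hw : Covers (clipped G) k w) (g : M.D T1) (hg : Bin g) :
    F g ≤ sum (fun i => G (clip (w i))) k := by
  obtain ⟨i, hi, h⟩ := hw g hg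
  rw [clipped_apply] at h
  exact (hF (clip (w i)) g (bin_clip _) hg (h.clip hg)).trans
    (le_sum (f := fun i => G (clip (w i))) (by fun_prop) hi)

theorem PITu_of_HBUc (h : HBUc.Sat M.toStr Env.nil) : PITu.Sat M.toStr Env.nil := by
  rw [sat_HBUc] at h
  rw [sat_PITu]
  intro G
  obtain ⟨k, w, hw⟩ := h (clipped G)
  exact ⟨_, fun F hF => hF.bounded hw⟩

/-- If `g` were in no neighbourhood of length at most `N`, the functional equal to `N + 1` on the
sequences that agree with `g` below `N + 1`, and to `0` elsewhere, would violate the bound at `g`.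
It satisfies `LOC`: if a neighbourhood given by `f` meets the set where the value is `N + 1` and `G
f ≤ N`, then `g` itself lies in that neighbourhood. -/
theorem HBUc_of_PITu (hc : M.Choice T0 T1) (h : PITu.Sat M.toStr Env.nil) :
    HBUc.Sat M.toStr Env.nil := by
  rw [sat_PITu] at h
  rw [sat_HBUc]
  intro G
  obtain ⟨N, hN⟩ := h G
  refine exists_covers hc (N := N) fun g hg => ?_
  by_contra! hno
  have e : ∀ f, lam (M := M) (fun f => sel (Agree f g (N + 1)) (N + 1) 0) f =
      sel (Agree f g (N + 1)) (N + 1) 0 := lam_apply (by fun_prop)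
  refine absurd (hN (lam fun f => sel (Agree f g (N + 1)) (N + 1) 0) (fun f f' hf hf' hff' => ?_)
    g hg) ?_
  · rw [e]
    by_cases h : Agree f' g (N + 1)
    · rw [sel_pos h, ← lt_iff_add_one_le]
      by_contra hle
      have hle := not_lt.1 hle
      exact absurd (hno f hf (hff'.symm.trans (h.mono (hle.trans (lt_add_one' N).le))))
        (not_lt.2 hle)
    · rw [sel_neg h]
      exact zero_le' _
  · rw [e, sel_pos (show Agree g g (N + 1) from fun _ _ => rfl)]
    exact not_le.2 (lt_add_one' N)

/-- Membership in the given neighbourhoods depends only on the first `N` entries, so being a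
covering is checked on finitely many sequences. This decidability is what makes quantifier-free
choice applicable to coverings. -/
theorem covers_iff (G : M.D T2) (k : M.D T0) (w : M.D (T0 ⇾ T1)) {N : M.D T0}
    (hN : ∀ i, i < k → G (w i) ≤ N) :
    Covers G k w ↔ ∀ c, c < pw N → ∃ i, i < k ∧ Agree (dec c N) (w i) (G (w i)) := by
  refine ⟨fun h c _ => h _ (bin_dec c N), fun h f hf => ?_⟩
  obtain ⟨i, hi, hi'⟩ := h _ (digits_two_lt hf N)
  exact ⟨i, hi, ((agree_dec hf N).mono (hN i hi)).symm.trans hi'⟩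

/-- The `i`-th entry of the finite sequence coded by `Y`. -/
noncomputable def row (Y : M.D T1) : M.D (T0 ⇾ T1) := lam fun i => lam fun j => Y (pr i j + 1)

section
variable {X : Type} [Obj M X]

@[fun_prop] theorem Dfn.row {Y : X → M.D T1} (hY : Dfn M Y) : Dfn M fun x => row (Y x) := by
  unfold Model.row
  fun_prop

theorem row_apply (Y : M.D T1) (i j : M.D T0) : row Y i j = Y (pr i j + 1) := by
  have h : Dfn M fun i => Model.lam fun j => Y (Model.pr i j + 1) := by fun_prop
  rw [row, lam_apply h, lam_apply (by fun_prop)]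

/-- A length and a sequence of functions are packed into one function: the length at position `0`,
the paired entries after it. A single application of choice then selects both. -/
theorem exists_row (k : M.D T0) (w : M.D (T0 ⇾ T1)) : ∃ Y : M.D T1, Y 0 = k ∧ row Y = w := by
  obtain ⟨U, hU, hU'⟩ := exists_dfn_choice (M := M)
    (P := fun c u => ∃ d, d < c + 1 ∧ c = Model.pr u d)
    (Dfn.bexLt (by fun_prop) (by fun_prop)) fun c => by
      obtain ⟨u, -, h⟩ := exists_pr c
      exact ⟨u, h⟩
  obtain ⟨V, hV, hV'⟩ := exists_dfn_choice (M := M) (P := fun c d => c = Model.pr (U c) d)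
    (by fun_prop) fun c => by
      obtain ⟨d, -, h⟩ := hU' c
      exact ⟨d, h⟩
  have hd : Dfn M fun n : M.D T0 => Model.natRec (fun c _ => w (U c) (V c)) k n := by fun_prop
  refine ⟨lam fun n => natRec (fun c _ => w (U c) (V c)) k n, ?_, M.ext fun i => M.ext fun j => ?_⟩
  · rw [lam_apply hd, natRec_zero]
  · obtain ⟨h₁, h₂⟩ := pr_injective (hV' (pr i j))
    rw [row_apply, lam_apply hd, natRec_succ (by fun_prop), ← h₁, ← h₂]

theorem Dfn.covers {G : X → M.D T2} {k : X → M.D T0} {w : X → M.D (T0 ⇾ T1)} (hG : Dfn M G)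
    (hk : Dfn M k) (hw : Dfn M w) : Dfn M fun x => Covers (G x) (k x) (w x) := by
  have hs : Dfn M fun x => Model.sum (fun i => G x (w x i)) (k x) := Dfn.sum (by fun_prop) hk
  refine (Dfn.ballLt (P := fun x c => ∃ i, i < k x ∧
    Agree (Model.dec c (Model.sum (fun i => G x (w x i)) (k x))) (w x i) (G x (w x i)))
    hs.pw (Dfn.bexLt (by fun_prop) (Dfn.agree (Dfn.dec (by fun_prop)
      (hs.comp (g := fun p : (X × M.D T0) × M.D T0 => p.1.1) (by fun_prop)))
      (by fun_prop) (by fun_prop)))).congr fun x => propext ?_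
  exact covers_iff _ _ _ fun i hi => le_sum (f := fun i => G x (w x i)) (by fun_prop) hi

end

/-- With finite sequences coded at type `1` and covering decidable, `HBUc` is the premise of an
instance of `QF-AC^{2,1}`, whose conclusion is `Θ`. -/
theorem existsSCF_of_HBUc (hc : M.Choice T2 T1) (h : HBUc.Sat M.toStr Env.nil) :
    existsSCF.Sat M.toStr Env.nil := by
  rw [sat_HBUc] at h
  rw [sat_existsSCF]
  obtain ⟨Y, hY⟩ := hc.exists_functional (P := fun G Y => Covers G (Y 0) (row Y))
    (Dfn.covers (by fun_prop) (by fun_prop) (by fun_prop)) fun G => by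
      obtain ⟨k, w, hw⟩ := h G
      obtain ⟨Y, rfl, rfl⟩ := exists_row k w
      exact ⟨Y, hw⟩
  refine ⟨lam fun G => Y G 0, lam fun G => row (Y G), fun G => ?_⟩
  rw [lam_apply (by fun_prop), lam_apply (by fun_prop)]
  exact hY G

theorem HBUc_of_existsSCF (h : existsSCF.Sat M.toStr Env.nil) : HBUc.Sat M.toStr Env.nil := by
  rw [sat_existsSCF] at h
  rw [sat_HBUc]
  obtain ⟨K, W, h⟩ := h
  exact fun G => ⟨K G, W G, h G⟩

theorem existsPR_of_existsSCF (h : existsSCF.Sat M.toStr Env.nil) :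
    existsPR.Sat M.toStr Env.nil := by
  rw [sat_existsSCF] at h
  rw [sat_existsPR]
  obtain ⟨K, W, h⟩ := h
  have hd : Dfn M fun G : M.D T2 => clipped G := by
    unfold clipped
    fun_prop
  have hs : Dfn M fun G => Model.sum (fun i => G (clip (W (clipped G) i))) (K (clipped G)) :=
    Dfn.sum (by fun_prop) (by fun_prop)
  refine ⟨lam fun G => sum (fun i => G (clip (W (clipped G) i))) (K (clipped G)),
    fun F G hF g hg => ?_⟩
  rw [lam_apply hs]
  exact hF.bounded (h _) g hg

theorem PITu_of_existsPR (h : existsPR.Sat M.toStr Env.nil) : PITu.Sat M.toStr Env.nil := by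
  rw [sat_existsPR] at h
  rw [sat_PITu]
  obtain ⟨R, hR⟩ := h
  exact fun G => ⟨R G, fun F hF => hR F G hF⟩

/-- Numbers are a retract of type `2`: a number becomes a constant functional and is recovered by
evaluation at the zero function. -/
theorem Choice.zero_one (h : M.Choice T2 T1) : M.Choice T0 T1 := by
  intro E hE
  obtain ⟨Y, hY⟩ := h.exists_functional (P := fun G y => E (G (lam fun _ => 0)) y = 0) (by fun_prop)
    fun G => hE _
  have e : ∀ n, lam (M := M) (fun n => Y (lam fun _ => n)) n = Y (lam fun _ => n) :=
    lam_apply (by fun_prop)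
  refine ⟨lam fun n => Y (lam fun _ => n), fun n => ?_⟩
  have := hY (lam fun _ => n)
  rw [e]
  rwa [lam_apply (by fun_prop)] at this

/-! ### From Cantor space to the unit interval -/

/-- Of the margin `4 * eps n`, half is demanded by the strict inequality between reals; the rest
pays for passing from `n` to `n + 1` in `y` and in `r`. -/
theorem inBall_of {x y r : M.D T1} (hy : IsReal y) (hr : IsReal r) {n : M.D T0}
    (h : |ap x n - ap y n| + 4 * eps n ≤ ap r n) : InBall x y r := by
  have h₁ := abs_lt.1 (hy n 1)
  have h₂ := abs_lt.1 (hr n 1)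
  have h₃ := abs_le.1 (le_refl |ap x n - ap y n|)
  exact ⟨⟨n, by linarith⟩, n, by linarith⟩

theorem IsReal.lt_add {r : M.D T1} (hr : IsReal r) {m n : M.D T0} (h : m ≤ n) :
    |ap r m - ap r n| < eps m := by
  obtain ⟨i, rfl⟩ := exists_add_of_le h
  exact hr m i

/-- The real number with binary expansion `f`. -/
noncomputable def binReal (f : M.D T1) : M.D T1 := lam fun n => dyad (digits 2 f n) n

section
variable {X : Type} [Obj M X]

@[fun_prop] theorem Dfn.binReal {f : X → M.D T1} (hf : Dfn M f) : Dfn M fun x => binReal (f x) := by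
  unfold Model.binReal
  fun_prop

theorem ap_binReal (f : M.D T1) (n : M.D T0) : ap (binReal f) n = digits 2 f n * eps n := by
  rw [ap, binReal, lam_apply (by fun_prop), val_dyad]

theorem cast_le_one {a : M.D T0} (h : a ≤ 1) : (a : M.Q) ≤ 1 := by
  rw [← cast_one, cast_le]
  exact h

theorem binReal_bounds {f : M.D T1} (hf : Bin f) (n i : M.D T0) :
    ap (binReal f) n ≤ ap (binReal f) (n + i) ∧
      ap (binReal f) (n + i) + eps (n + i) ≤ ap (binReal f) n + eps n := by
  refine induct (P := fun i => ap (Model.binReal f) n ≤ ap (Model.binReal f) (n + i) ∧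
      ap (Model.binReal f) (n + i) + Model.eps (n + i) ≤ ap (Model.binReal f) n + Model.eps n)
    (by fun_prop) (by simp) (fun i ih => ?_) i
  have e : ap (binReal f) (n + (i + 1)) = ap (binReal f) (n + i) + f (n + i) * (eps (n + i) / 2) := by
    rw [← add_assoc, ap_binReal, ap_binReal, digits_succ, eps_succ, cast_add, cast_mul, cast_ofNat]
    ring
  have h₀ := cast_nonneg (f (n + i))
  have h₁ := cast_le_one (hf (n + i))
  have h₂ := eps_pos (n + i)
  have h₃ : (0 : M.Q) ≤ f (n + i) * (eps (n + i) / 2) := by positivity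
  have h₄ : f (n + i) * (eps (n + i) / 2) ≤ 1 * (eps (n + i) / 2) := by gcongr
  rw [e]
  rw [← add_assoc, eps_succ]
  constructor <;> linarith

theorem isReal_binReal {f : M.D T1} (hf : Bin f) : IsReal (binReal f) := by
  intro n i
  have h := binReal_bounds hf n i
  have h₁ := eps_pos (n + i)
  rw [abs_lt]
  constructor <;> linarith [eps_pos n]

theorem Agree.binReal {f g : M.D T1} {m n : M.D T0} (h : Agree f g m) (hf : Bin f) (hg : Bin g)
    (hmn : m ≤ n) : |ap (binReal f) n - ap (binReal g) n| ≤ eps m := by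
  obtain ⟨i, rfl⟩ := exists_add_of_le hmn
  have h₁ := binReal_bounds hf m i
  have h₂ := binReal_bounds hg m i
  have e : ap (Model.binReal f) m = ap (Model.binReal g) m := by
    rw [ap_binReal, ap_binReal, digits_congr 2 h]
  have h₃ := eps_pos (m + i)
  rw [abs_le]
  constructor <;> linarith

theorem exists_near {q : M.Q} {K : M.D T0} (hK : 0 < K) (h₁ : -2 ≤ q) (h₂ : q ≤ K + 2) :
    ∃ c, c < K ∧ |q - c| ≤ 3 := by
  rcases lt_or_ge q 0 with h | h
  · refine ⟨0, hK, ?_⟩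
    rw [cast_zero, sub_zero, abs_le]
    constructor <;> linarith
  · have h₃ := floor_le h
    have h₄ := lt_floor_add_one q
    rcases lt_or_ge q K with h' | h'
    · refine ⟨floor q, ?_, ?_⟩
      · rw [← cast_lt (M := M)]
        exact h₃.trans_lt h'
      · rw [abs_le]
        constructor <;> linarith
    · have h₅ : (1 : M.D T0) ≤ K := by
        rw [← zero_add (1 : M.D T0), ← lt_iff_add_one_le]
        exact hK
      refine ⟨monus K 1, ?_, ?_⟩
      · rw [← cast_lt (M := M), cast_monus h₅, cast_one]
        linarith
      · rw [cast_monus h₅, cast_one, abs_le]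
        constructor <;> linarith

/-- A binary sequence is needed at one precision only, so no expansion of `x` itself is sought: `2 ^
n` times the approximation lies in `[-2, 2 ^ n + 2]`, hence within `3` of an admissible numerator.
-/
theorem InUnit.exists_binReal {x : M.D T1} (h : InUnit x) (n : M.D T0) :
    ∃ f, Bin f ∧ |ap x n - ap (binReal f) n| ≤ 3 * eps n := by
  have h₁ : -(2 * eps n) ≤ ap x n := by
    have := not_lt.1 (not_exists.1 h.1 n)
    linarith
  have h₂ := not_lt.1 (not_exists.1 h.2 n)
  have hp := cast_pw_pos n
  have e := eps_mul_pw n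
  obtain ⟨c, hc, hc'⟩ := exists_near (q := ap x n * ((pw n : M.D T0) : M.Q)) (pw_pos n)
    (by
      have := mul_le_mul_of_nonneg_right h₁ hp.le
      calc (-2 : M.Q) = -(2 * eps n) * ((pw n : M.D T0) : M.Q) := by rw [neg_mul, mul_assoc, e]; ring
        _ ≤ _ := this)
    (by
      refine (mul_le_mul_of_nonneg_right h₂ hp.le).trans_eq ?_
      rw [add_mul, mul_assoc, e]
      ring)
  refine ⟨dec c n, bin_dec c n, ?_⟩
  rw [ap_binReal, digits_dec hc]
  have e' : ap x n - c * eps n = (ap x n * ((pw n : M.D T0) : M.Q) - c) * eps n := by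
    rw [sub_mul, mul_assoc, mul_comm ((pw n : M.D T0) : M.Q), e, mul_one]
  rw [e', abs_mul, abs_of_pos (eps_pos n)]
  exact mul_le_mul_of_nonneg_right hc' (eps_pos n).le

/-- `G f` is an index that witnesses positivity of `Ψ` at the real with expansion `f`. A covering of
Cantor space for slightly longer neighbourhoods then yields the centres of the intervals. -/
theorem HBU_of_HBUc (h : HBUc.Sat M.toStr Env.nil) : HBU.Sat M.toStr Env.nil := by
  rw [sat_HBUc] at h
  rw [sat_HBU]
  rintro Ψ ⟨hΨ, -⟩
  have hR : ∀ f : M.D T1, IsReal (binReal (clip f)) := fun f => isReal_binReal (bin_clip f)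
  obtain ⟨G, hG, hG'⟩ := exists_dfn_choice (M := M)
    (P := fun f n => 2 * Model.eps n < ap (Ψ (Model.binReal (Model.clip f))) n) (by fun_prop)
    fun f => (hΨ _ (hR f)).2
  have hd : Dfn M fun f => G f + 3 := by fun_prop
  -- Three more digits give the factor `1 / 8`. The errors, in units of `eps (G (w i) + 3)`, are at
  -- most `1` from the common initial segment, `3` from approximating `x` and `4` from `inBall_of`:
  -- together at most `eps (G (w i))`, which the radius exceeds.
  obtain ⟨k, w, hw⟩ := h (lam fun f => G f + 3)
  have e : ∀ i, lam (M := M) (fun i => binReal (clip (w i))) i = binReal (clip (w i)) :=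
    lam_apply (by fun_prop)
  refine ⟨k, lam fun i => binReal (clip (w i)), fun i _ => by rw [e]; exact hR _,
    fun x _ hx' => ?_⟩
  obtain ⟨f, hf, hfx⟩ := hx'.exists_binReal (sum (fun i => G (w i) + 3) k)
  obtain ⟨i, hi, hfi⟩ := hw f hf
  have hle := le_sum (f := fun i => G (w i) + 3) (by fun_prop) hi
  refine ⟨i, hi, ?_⟩
  rw [e]
  refine inBall_of (n := sum (fun i => G (w i) + 3) k) (hR _) (hΨ _ (hR _)).1 ?_
  generalize sum (fun i => G (w i) + 3) k = n at hfx hle ⊢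
  rw [lam_apply hd] at hfi
  have h₁ := (hfi.clip hf).binReal hf (bin_clip _) hle
  have h₂ := (hΨ _ (hR (w i))).1.lt_add ((le_self_add (a := G (w i)) (b := 3)).trans hle)
  have h₃ := hG' (w i)
  have h₄ := eps_anti hle
  have h₅ : eps (G (w i) + 3) = eps (G (w i)) / 8 := by
    rw [← two_add_one_eq_three, ← one_add_one_eq_two, ← add_assoc, ← add_assoc, eps_succ, eps_succ,
      eps_succ]
    ring
  have h₆ := abs_sub_le (ap x n) (ap (binReal f) n) (ap (binReal (clip (w i))) n)
  have h₇ := abs_lt.1 h₂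
  linarith

end

/-! ### A sparse copy of Cantor space in the unit interval -/

theorem eps_natCast (n : ℕ) : eps (n : M.D T0) = (1 / 2) ^ n := by
  induction n with
  | zero => rw [Nat.cast_zero, eps_zero, pow_zero]
  | succ n ih => rw [Nat.cast_succ, eps_succ, ih, pow_succ]; ring

theorem eps_ofNat (n : ℕ) [n.AtLeastTwo] : eps (OfNat.ofNat n : M.D T0) = (1 / 2) ^ n := by
  rw [← Nat.cast_ofNat, eps_natCast]
  rfl

theorem eps_add_ofNat (m : M.D T0) (n : ℕ) [n.AtLeastTwo] :
    eps (m + OfNat.ofNat n) = eps m * (1 / 2) ^ n := by rw [eps_add, eps_ofNat]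

theorem two_mul_eps_double_succ (m : M.D T0) : eps (m + 1 + (m + 1)) = eps (m + m) / 4 := by
  rw [add_add_add_comm, one_add_one_eq_two, eps_add_ofNat]
  ring

/-- The real number whose expansion in the base `4` is `f`. -/
noncomputable def quatReal (f : M.D T1) : M.D T1 := lam fun n => dyad (digits 4 f n) (n + n)

theorem ap_quatReal (f : M.D T1) (n : M.D T0) : ap (quatReal f) n = digits 4 f n * eps (n + n) := by
  rw [ap, quatReal, lam_apply (by fun_prop), val_dyad]

/-- The tail of a base-`4` expansion with digits `0, 1` is at most a third of the unit `4 ^ (-n)`;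
the weaker bound `1 / 2` passes through the induction since `1 / 4 + 1 / 8 ≤ 1 / 2`. Intervals of
different nodes of one length are thus at least half a unit apart. -/
theorem quatReal_bounds {f : M.D T1} (hf : Bin f) (n i : M.D T0) :
    ap (quatReal f) n ≤ ap (quatReal f) (n + i) ∧
      ap (quatReal f) (n + i) + eps (n + i + (n + i)) / 2 ≤
        ap (quatReal f) n + eps (n + n) / 2 := by
  refine induct (P := fun i => ap (quatReal f) n ≤ ap (quatReal f) (n + i) ∧
      ap (quatReal f) (n + i) + eps (n + i + (n + i)) / 2 ≤
        ap (quatReal f) n + eps (n + n) / 2) (by fun_prop) (by simp) (fun i ih => ?_) i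
  have e : ap (quatReal f) (n + (i + 1)) =
      ap (quatReal f) (n + i) + f (n + i) * (eps (n + i + (n + i)) / 4) := by
    rw [← add_assoc, ap_quatReal, ap_quatReal, digits_succ, two_mul_eps_double_succ, cast_add,
      cast_mul, cast_ofNat]
    ring
  have h₂ := eps_pos (n + i + (n + i))
  have h₃ : (0 : M.Q) ≤ f (n + i) * (eps (n + i + (n + i)) / 4) :=
    mul_nonneg (cast_nonneg _) (by positivity)
  have h₄ : f (n + i) * (eps (n + i + (n + i)) / 4) ≤ 1 * (eps (n + i + (n + i)) / 4) :=
    mul_le_mul_of_nonneg_right (cast_le_one (hf (n + i))) (by positivity)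
  rw [e, ← add_assoc n i 1, two_mul_eps_double_succ]
  constructor <;> linarith

theorem isReal_quatReal {f : M.D T1} (hf : Bin f) : IsReal (quatReal f) := by
  intro n i
  have h := quatReal_bounds hf n i
  have h₁ := eps_pos (n + i + (n + i))
  have h₂ : eps (n + n) ≤ eps n := eps_anti le_self_add
  rw [abs_lt]
  constructor <;> linarith [eps_pos n]

theorem inUnit_quatReal {f : M.D T1} (hf : Bin f) : InUnit (quatReal f) := by
  have h : ∀ n, 0 ≤ ap (quatReal f) n ∧ ap (quatReal f) n ≤ 1 := by
    intro n
    have h := quatReal_bounds hf 0 n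
    have h₁ := eps_pos (0 + n + (0 + n))
    have h₂ : ap (quatReal f) 0 = 0 := by rw [ap_quatReal, digits_zero, cast_zero, zero_mul]
    rw [h₂, zero_add, zero_add, zero_add, eps_zero] at h
    rw [zero_add] at h₁
    constructor <;> linarith
  constructor <;> rintro ⟨n, hn⟩ <;> linarith [h n, eps_pos n]

/-- The slack `2 * eps a` of an inequality at index `a` covers the later movements: `eps a` for `x`
and `eps (a + 1)` for each of `y` and `r`. -/
theorem InBall.exists_forall {x y r : M.D T1} (hx : IsReal x) (hy : IsReal y) (hr : IsReal r)
    (h : InBall x y r) : ∃ N, ∀ n, N ≤ n → |ap x n - ap y n| < ap r n := by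
  obtain ⟨⟨a, ha⟩, b, hb⟩ := h
  refine ⟨a + 1 + (b + 1), fun n hn => ?_⟩
  have hna : a + 1 ≤ n := le_self_add.trans hn
  have hnb : b + 1 ≤ n := le_add_self.trans hn
  have h₁ := abs_lt.1 (hx.lt_add ((lt_add_one' a).le.trans hna))
  have h₂ := abs_lt.1 (hx.lt_add ((lt_add_one' b).le.trans hnb))
  have h₃ := abs_lt.1 (hy.lt_add hna)
  have h₄ := abs_lt.1 (hy.lt_add hnb)
  have h₅ := abs_lt.1 (hr.lt_add hna)
  have h₆ := abs_lt.1 (hr.lt_add hnb)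
  rw [eps_succ] at h₃ h₄ h₅ h₆
  rw [abs_lt]
  constructor <;> linarith

/-- Decidable sets of finite binary sequences. -/
structure BinTree (M : Model) where
  /-- The first `m` entries of `f` belong to the set. -/
  mem : M.D T1 → M.D T0 → Prop
  dfn : Dfn M fun p : M.D T1 × M.D T0 => mem p.1 p.2
  congr : ∀ {f g : M.D T1} {m : M.D T0}, Agree f g m → mem f m → mem g m

/-! ### Distance from a set of nodes, and branches at distance zero. -/

namespace BinTree

variable (T : M.BinTree)

/-- The point `q` has distance at least `2 t` from the intervals of the members of `T` of
length `m`, and `t` is at most `2 ^ (-m)`. -/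
def Apart (q t : M.Q) (m : M.D T0) : Prop :=
  -- The bound on `t` makes deep levels count for little: a given positive `t` can only come from
  -- levels `m` with `t ≤ 2 ^ (-m)`. This keeps the search for `m` finite and later bounds the depth
  -- at which a sequence leaves `T`.
  t ≤ eps m ∧ ∀ c, c < pw m → T.mem (dec c m) m →
    q ≤ digits 4 (dec c m) m * eps (m + m) - 2 * t ∨
      digits 4 (dec c m) m * eps (m + m) + eps (m + m) / 2 + 2 * t ≤ q

section
variable {X : Type} [Obj M X]

theorem dfn_mem {f : X → M.D T1} {m : X → M.D T0} (hf : Dfn M f) (hm : Dfn M m) :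
    Dfn M fun x => T.mem (f x) (m x) :=
  T.dfn.comp (g := fun x => (f x, m x)) (by fun_prop)

theorem dfn_apart {q t : X → M.Q} {m : X → M.D T0} (hq : Dfn M q) (ht : Dfn M t) (hm : Dfn M m) :
    Dfn M fun x => T.Apart (q x) (t x) (m x) :=
  (Dfn.qle (by fun_prop) (by fun_prop)).and (Dfn.ballLt (by fun_prop)
    (Dfn.imp (T.dfn_mem (by fun_prop) (by fun_prop)) (by fun_prop)))

end

variable {T}

theorem Apart.mono {q t t' : M.Q} {m : M.D T0} (h : T.Apart q t m) (ht : t' ≤ t) :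
    T.Apart q t' m := by
  refine ⟨ht.trans h.1, fun c hc hcm => ?_⟩
  rcases h.2 c hc hcm with h | h
  · left; linarith
  · right; linarith

theorem Apart.shift {q q' t : M.Q} {m : M.D T0} (h : T.Apart q t m) :
    T.Apart q' (t - |q - q'| / 2) m := by
  have h₀ := abs_le.1 (le_refl |q - q'|)
  refine ⟨(by linarith [abs_nonneg (q - q')] : _ ≤ t).trans h.1, fun c hc hcm => ?_⟩
  rcases h.2 c hc hcm with h | h
  · left; linarith
  · right; linarith

theorem Apart.le {q : M.Q} {b m n : M.D T0} (hb : 1 ≤ b) (h : T.Apart q (b * eps n) m) : m ≤ n := by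
  rw [← eps_le_iff (M := M)]
  refine le_trans ?_ h.1
  refine le_mul_of_one_le_left (eps_pos n).le ?_
  rw [← cast_one, cast_le]
  exact hb

variable (T)

/-- `u p` is a multiple `b` of `eps n` that is still attained as a distance while `b + 1` is not. By
`Apart.le` only levels `m ≤ n` matter, so the condition is decidable. The value `0` is exempted
because the point may be apart from no level at all. -/
theorem exists_gap : ∃ u : M.D T1 × M.D T0 → M.D T0, Dfn M u ∧ ∀ p,
    (u p = 0 ∨ ∃ m, T.Apart (ap p.1 p.2) (u p * eps p.2) m) ∧
      ∀ m, ¬ T.Apart (ap p.1 p.2) ((u p + 1) * eps p.2) m := by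
  have hd : Dfn M fun v : (M.D T1 × M.D T0) × M.D T0 =>
      ∃ m, m < v.1.2 + 1 ∧ T.Apart (ap v.1.1 v.1.2) (v.2 * eps v.1.2) m :=
    Dfn.bexLt (by fun_prop) (T.dfn_apart (by fun_prop) (by fun_prop) (by fun_prop))
  have hd' : Dfn M fun v : (M.D T1 × M.D T0) × M.D T0 =>
      ∃ m, m < v.1.2 + 1 ∧ T.Apart (ap v.1.1 v.1.2) ((v.2 + 1 : M.D T0) * eps v.1.2) m :=
    hd.comp (g := fun v : (M.D T1 × M.D T0) × M.D T0 => (v.1, v.2 + 1)) (by fun_prop)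
  obtain ⟨u, hu, h⟩ := exists_dfn_choice (M := M) (P := fun (p : M.D T1 × M.D T0) (b : M.D T0) =>
      (b = 0 ∨ ∃ m, m < p.2 + 1 ∧ T.Apart (ap p.1 p.2) (b * eps p.2) m) ∧
        ¬ ∃ m, m < p.2 + 1 ∧ T.Apart (ap p.1 p.2) ((b + 1 : M.D T0) * eps p.2) m)
    ((Dfn.or (by fun_prop) hd).and hd'.not) fun p => by
      by_contra hno
      push Not at hno
      -- If every attained `b` had an attained successor, so would `2 ^ n + 1` be attained, giving
      -- `t > 1`; but `t ≤ eps m ≤ 1`.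
      have hall := induct (P := fun b : M.D T0 =>
          b = 0 ∨ ∃ m, m < p.2 + 1 ∧ T.Apart (ap p.1 p.2) (b * eps p.2) m)
        (Dfn.or (by fun_prop) (hd.comp (g := fun b : M.D T0 => (p, b)) (by fun_prop))) (Or.inl rfl) (fun b hb => Or.inr (hno b hb))
        (pw p.2 + 1)
      rcases hall with h0 | ⟨m, -, h, -⟩
      · exact absurd h0 (by positivity)
      · have h₁ := eps_anti (zero_le' m)
        have h₂ := eps_mul_pw p.2
        have h₃ := eps_pos p.2
        rw [eps_zero] at h₁
        rw [cast_add, cast_one] at h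
        linarith
  refine ⟨u, hu, fun p => ⟨(h p).1.imp_right fun ⟨m, _, hm⟩ => ⟨m, hm⟩, fun m hm => ?_⟩⟩
  have hm' : T.Apart (ap p.1 p.2) ((u p + 1 : M.D T0) * eps p.2) m := by
    rwa [cast_add, cast_one]
  exact (h p).2 ⟨m, lt_add_one_iff'.2 (hm'.le le_add_self), hm'⟩

/-- Half the distance of the `n`-th approximation of `x` from `T`, up to `2 ^ (-n)`. -/
noncomputable def gap (x : M.D T1) (n : M.D T0) : M.D T0 := T.exists_gap.choose (x, n)

/-- Half the distance of `x` from `T`. -/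
noncomputable def radius (x : M.D T1) : M.D T1 := lam fun n => dyad (T.gap x (n + 1)) (n + 1)

theorem gap_spec (x : M.D T1) (n : M.D T0) :
    (T.gap x n = 0 ∨ ∃ m, T.Apart (ap x n) (T.gap x n * eps n) m) ∧
      ∀ m, ¬ T.Apart (ap x n) ((T.gap x n + 1) * eps n) m := T.exists_gap.choose_spec.2 (x, n)

section
variable {X : Type} [Obj M X]

@[fun_prop] theorem dfn_gap {x : X → M.D T1} {n : X → M.D T0} (hx : Dfn M x) (hn : Dfn M n) :
    Dfn M fun a => T.gap (x a) (n a) :=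
  T.exists_gap.choose_spec.1.comp (g := fun a => (x a, n a)) (by fun_prop)

@[fun_prop] theorem dfn_radius {x : X → M.D T1} (hx : Dfn M x) : Dfn M fun a => T.radius (x a) := by
  unfold radius
  fun_prop

end

theorem ap_radius (x : M.D T1) (n : M.D T0) :
    ap (T.radius x) n = (T.gap x (n + 1) : M.Q) * eps (n + 1) := by
  rw [ap, radius, lam_apply (by fun_prop), val_dyad]

/-- Half the distance is Lipschitz with constant `1 / 2`; the extra `eps n` is the rounding of
`gap`. Both that `radius` is a real and that it respects equality of reals follow. -/
theorem gap_lt (x y : M.D T1) (m n : M.D T0) :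
    (T.gap x m : M.Q) * eps m < T.gap y n * eps n + eps n + |ap x m - ap y n| / 2 := by
  have h₀ := mul_nonneg (cast_nonneg (T.gap y n)) (eps_pos n).le
  have h₁ := eps_pos n
  rcases (T.gap_spec x m).1 with h | ⟨i, h⟩
  · rw [h, cast_zero, zero_mul]
    linarith [abs_nonneg (ap x m - ap y n)]
  · by_contra hle
    refine (T.gap_spec y n).2 i (h.shift.mono ?_)
    rw [add_mul, one_mul]
    linarith [not_lt.1 hle]

/-- The shift by one index in `radius` is needed here: rounding and movement of `x` contribute at
most `eps (n + 1)` and `eps (n + 1) / 2`, together less than `eps n`. -/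
theorem isReal_radius {x : M.D T1} (hx : IsReal x) : IsReal (T.radius x) := by
  intro n i
  have h := hx (n + 1) i
  have h₁ := T.gap_lt x x (n + 1) (n + 1 + i)
  have h₂ := T.gap_lt x x (n + 1 + i) (n + 1)
  have h₃ : eps (n + 1 + i) ≤ eps (n + 1) := eps_anti le_self_add
  have h₄ := eps_pos n
  rw [abs_sub_comm] at h₂
  rw [ap_radius, ap_radius, add_right_comm, abs_lt]
  rw [eps_succ] at h h₃
  have e := eps_succ n
  constructor <;> linarith

theorem eqReal_radius {x y : M.D T1} (h : EqReal x y) : EqReal (T.radius x) (T.radius y) := by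
  intro n
  have h₀ := h (n + 1)
  have h₁ := T.gap_lt x y (n + 1) (n + 1)
  have h₂ := T.gap_lt y x (n + 1) (n + 1)
  have h₃ := eps_succ n
  have h₄ := eps_pos n
  rw [abs_sub_comm] at h₂
  rw [ap_radius, ap_radius, abs_le]
  constructor <;> linarith

/-- A point of the ball with a positive radius leaves `T`. -/
theorem exists_not_mem {g y : M.D T1} (hg : Bin g) (hy : IsReal y) {N : M.D T0}
    (hN : 2 * eps N < ap (T.radius y) N) (h : InBall (quatReal g) y (T.radius y)) :
    ∃ m, m < N ∧ ¬ T.mem g m := by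
  obtain ⟨N', hN'⟩ := h.exists_forall (isReal_quatReal hg) hy (T.isReal_radius hy)
  have hd := hN' (N + N') le_add_self
  have h₁ := abs_lt.1 ((T.isReal_radius hy).lt_add (le_self_add : N ≤ N + N'))
  have h₂ := abs_lt.1 (hy (N + N') 1)
  have h₃ : eps (N + N') ≤ eps N := eps_anti le_self_add
  generalize hk : N + N' = k at hd h₁ h₂ h₃
  have hNk : N ≤ k := hk ▸ le_self_add
  rw [ap_radius T y k] at hd h₁
  rcases (T.gap_spec y (k + 1)).1 with h0 | ⟨m, hm⟩
  · rw [h0, cast_zero, zero_mul] at h₁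
    linarith [eps_pos N]
  -- At index `k` the radius still exceeds `eps N`, so the level that witnesses it must be less than
  -- `N`.
  have hmN : m < N := by
    by_contra hle
    have := eps_anti (not_lt.1 hle)
    linarith [hm.1]
  refine ⟨m, hmN, fun hgm => ?_⟩
  obtain ⟨i, hi⟩ := exists_add_of_le (hmN.le.trans hNk)
  have hb := quatReal_bounds hg m i
  have hp := eps_pos (m + i + (m + i))
  rw [← hi] at hb hp
  have hag := agree_dec hg m
  -- If `g` belonged to `T` at level `m`, its approximation would be at least `2 t` away from that
  -- of `y` at `k + 1`. The ball allows less than `t`, and passing from `k` to `k + 1` in `y` costs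
  -- less than `eps N < t`.
  have hs := hm.2 _ (digits_two_lt hg m) (T.congr hag.symm hgm)
  rw [digits_congr 4 hag, ← ap_quatReal] at hs
  rw [abs_lt] at hd
  rcases hs with hs | hs <;> linarith

/-- The integral part of `4 ^ m * x`, for `x` close to `T`. -/
noncomputable def _root_.HOA.Model.quatFloor (x : M.D T1) (m : M.D T0) : M.D T0 :=
  -- Near a node with number `j` the scaled value lies between `j - 5 / 32` and `j + 21 / 32`.
  -- Adding `1 / 4` moves this range inside `[j, j + 1)`, away from the jumps of the floor.
  floor (ap x (m + m + 6) * (pw (m + m) : M.D T0) + 1 / 4)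

/-- The expansion of `x` in the base `4`. -/
noncomputable def _root_.HOA.Model.branch (x : M.D T1) : M.D T1 :=
  clip (lam fun m => monus (quatFloor x (m + 1)) (4 * quatFloor x m))

@[fun_prop] theorem _root_.HOA.Model.Dfn.quatFloor {X : Type} [Obj M X] {x : X → M.D T1}
    {m : X → M.D T0} (hx : Dfn M x) (hm : Dfn M m) : Dfn M fun a => quatFloor (x a) (m a) := by
  unfold Model.quatFloor
  fun_prop

@[fun_prop] theorem _root_.HOA.Model.Dfn.branch {X : Type} [Obj M X] {x : X → M.D T1}
    (hx : Dfn M x) : Dfn M fun a => branch (x a) := by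
  unfold Model.branch
  fun_prop

theorem _root_.HOA.Model.quatFloor_eq {x : M.D T1} {m j : M.D T0}
    (h₁ : ((j : M.Q) - 1 / 4) * eps (m + m) ≤ ap x (m + m + 6))
    (h₂ : ap x (m + m + 6) < (j + 3 / 4) * eps (m + m)) : quatFloor x m = j := by
  have hp := cast_pw_pos (m + m)
  rw [eps, mul_one_div, div_le_iff₀ hp] at h₁
  rw [eps, mul_one_div, lt_div_iff₀ hp] at h₂
  exact floor_eq_of (by linarith) (by linarith)

/-- If the radius is not positive, its approximation at `2 m + 5` is at most `2 * eps (2 m + 5)`,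
that is `4 / 64` of the unit `eps (m + m)`, and rounding adds `1 / 64`. So the point is not apart
from level `m` by `5 / 64`: it is within `5 / 32` of the interval of a node, whose length is `1 /
2`. -/
theorem exists_node {x : M.D T1} (h : ¬ IsPosReal (T.radius x)) (m : M.D T0) :
    ∃ f, Bin f ∧ T.mem f m ∧
      ((digits 4 f m : M.D T0) - 5 / 32) * eps (m + m) < ap x (m + m + 6) ∧
        ap x (m + m + 6) < ((digits 4 f m : M.D T0) + 21 / 32) * eps (m + m) := by
  have h₁ := not_lt.1 (not_exists.1 h (m + m + 5))
  have e : m + m + 5 + 1 = m + m + 6 := by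
    rw [add_assoc]
    norm_num
  have e₅ := eps_add_ofNat (m + m) 5
  have e₆ := eps_add_ofNat (m + m) 6
  rw [ap_radius, e] at h₁
  have h₂ := (T.gap_spec x (m + m + 6)).2 m
  have h₃ := eps_pos (m + m)
  have h₄ : eps (m + m) ≤ eps m := eps_anti le_self_add
  have h₅ : ¬ T.Apart (ap x (m + m + 6)) (5 / 64 * eps (m + m)) m := fun h' =>
    h₂ (h'.mono (by rw [add_mul]; norm_num at e₅ e₆; linarith))
  rw [Apart, not_and] at h₅
  have h₆ := h₅ (by linarith)
  push Not at h₆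
  obtain ⟨c, -, hc, h₇, h₈⟩ := h₆
  exact ⟨dec c m, bin_dec c m, hc, by linarith, by linarith⟩

variable {T}

/-- A node near `x` at level `m + 1` determines both floors, since the same `x` is also close to its
initial segment of length `m`. The floors therefore differ by a factor `4` and one bit, and their
differences are the digits of the branch. -/
theorem digits_branch {x : M.D T1} (hx : IsReal x) (h : ¬ IsPosReal (T.radius x)) (m : M.D T0) :
    digits 4 (branch x) m = quatFloor x m := by
  refine induct (P := fun m => digits 4 (branch x) m = quatFloor x m) (by fun_prop) ?_
    (fun m ih => ?_) m
  · obtain ⟨f, -, -, h₁, h₂⟩ := T.exists_node h 0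
    have h₃ := eps_pos (0 + 0 : M.D T0)
    rw [digits_zero] at h₁ h₂ ⊢
    exact (quatFloor_eq (by linarith) (by linarith)).symm
  · obtain ⟨f, hf, -, h₁, h₂⟩ := T.exists_node h (m + 1)
    have h₃ := eps_pos (m + m)
    have e : (m + 1 + (m + 1) + 6 : M.D T0) = m + m + 6 + 2 := by
      ring
    have h₅ : quatFloor x (m + 1) = digits 4 f (m + 1) := by
      have h₄ := eps_pos (m + 1 + (m + 1))
      exact quatFloor_eq (by linarith) (by linarith)
    have h₆ := abs_lt.1 (hx (m + m + 6) 2)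
    rw [e, two_mul_eps_double_succ, digits_succ, cast_add, cast_mul, cast_ofNat] at h₁ h₂
    rw [eps_add_ofNat] at h₆
    have hb : (f m : M.Q) * eps (m + m) ≤ 1 * eps (m + m) :=
      mul_le_mul_of_nonneg_right (cast_le_one (hf m)) h₃.le
    have hb' : (0 : M.Q) ≤ (f m : M.Q) * eps (m + m) := mul_nonneg (cast_nonneg _) h₃.le
    have h₇ : quatFloor x m = digits 4 f m := by
      norm_num at h₆
      exact quatFloor_eq (by linarith) (by linarith)
    have h₈ : branch x m = f m := by
      have h₉ : lam (M := M) (fun m => monus (quatFloor x (m + 1)) (4 * quatFloor x m)) m = f m := by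
        rw [lam_apply (by fun_prop), h₅, h₇, digits_succ, monus_add_left]
      rw [branch, clip_apply_of_le, h₉]
      rw [h₉]
      exact hf m
    rw [digits_succ, ih, h₈, h₅, h₇, digits_succ]

theorem bin_branch (x : M.D T1) : Bin (branch x) := bin_clip _

theorem branch_spec {x : M.D T1} (hx : IsReal x) (h : ¬ IsPosReal (T.radius x)) (m : M.D T0) :
    T.mem (branch x) m ∧
      ((digits 4 (branch x) m : M.D T0) - 5 / 32) * eps (m + m) < ap x (m + m + 6) ∧
        ap x (m + m + 6) < ((digits 4 (branch x) m : M.D T0) + 21 / 32) * eps (m + m) := by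
  obtain ⟨f, hf, hm, h₁, h₂⟩ := T.exists_node h m
  have h₃ := eps_pos (m + m)
  have h₄ : digits 4 (branch x) m = digits 4 f m := by
    rw [digits_branch hx h]
    exact quatFloor_eq (by linarith) (by linarith)
  rw [h₄]
  exact ⟨T.congr (agree_of_digits_eq (by norm_num) hf (bin_branch x) h₄.symm) hm, h₁, h₂⟩

end BinTree

/-! ### From the unit interval to Cantor space -/

/-- The functional `∃²`. -/
def IsExists (E : M.D T2) : Prop := ∀ f : M.D T1, E f = 0 ↔ ∃ n : M.D T0, f n = 0

theorem IsExists.dfn_ex {E : M.D T2} (hE : IsExists E) {X : Type} [Obj M X]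
    {P : X → M.D T0 → Prop} (hP : Dfn M fun p : X × M.D T0 => P p.1 p.2) :
    Dfn M fun x => ∃ n, P x n := by
  refine .of_char (f := fun x => E (lam fun n => chi (P x n)))
    (Dfn.app (by fun_prop) (Dfn.lam hP.chi)) fun x => ?_
  rw [hE]
  refine exists_congr fun n => ?_
  rw [lam_apply (hP.section x).chi, chi_eq_zero]

theorem EqReal.symm {x y : M.D T1} (h : EqReal x y) : EqReal y x := fun n => by
  rw [abs_sub_comm]
  exact h n

theorem EqReal.isPosReal {x y : M.D T1} (hx : IsReal x) (h : EqReal x y) (hpos : IsPosReal x) :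
    IsPosReal y := by
  obtain ⟨n, hn⟩ := hpos
  have h₁ := abs_lt.1 (hx n 3)
  have h₂ := abs_le.1 (h (n + 3))
  have h₃ := eps_pos n
  refine ⟨n + 3, ?_⟩
  rw [eps_add_ofNat] at h₂ ⊢
  norm_num at h₂ ⊢
  linarith

namespace BinTree

/-- At every level the numbers of the two nodes differ by less than one, because the tolerance of a
node and the permitted discrepancy `2 * eps (m + m + 6)` add up to less than a unit. So the branch
depends only on the real number, not on its representation. -/
theorem branch_congr {T : M.BinTree} {x y : M.D T1} (hx : IsReal x) (hy : IsReal y)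
    (hxy : EqReal x y) (h : ¬ IsPosReal (T.radius x)) : branch x = branch y := by
  have h' : ¬ IsPosReal (T.radius y) := fun hpos =>
    h ((T.eqReal_radius hxy).symm.isPosReal (T.isReal_radius hy) hpos)
  have key : ∀ m, digits 4 (branch x) m = digits 4 (branch y) m := by
    intro m
    obtain ⟨-, h₁, h₂⟩ := branch_spec hx h m
    obtain ⟨-, h₃, h₄⟩ := branch_spec hy h' m
    have h₅ := abs_le.1 (hxy (m + m + 6))
    have h₆ := eps_pos (m + m)
    rw [eps_add_ofNat] at h₅
    norm_num at h₅
    refine le_antisymm (lt_of_cast_lt_add_one ?_) (lt_of_cast_lt_add_one ?_)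
    · refine lt_of_mul_lt_mul_right ?_ h₆.le
      linarith
    · refine lt_of_mul_lt_mul_right ?_ h₆.le
      linarith
  exact M.ext fun i => agree_of_digits_eq (by norm_num) (bin_branch x) (bin_branch y) (key (i + 1)) i
    (lt_add_one' i)

/-- The set of all finite binary sequences. -/
def full (M : Model) : M.BinTree := ⟨fun _ _ => True, by fun_prop, fun _ h => h⟩

end BinTree

open BinTree

/-- For the set of all nodes, `∃²` decides whether the radius at `x` is positive. If so, `Ψ x` is
the radius and the ball misses the embedded Cantor set. If not, `Ψ x` is small enough that the ball
contains only sequences sharing `G (branch x)` digits with the branch of `x`. -/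
theorem exists_covers_of_isExists (h : HBU.Sat M.toStr Env.nil) {E : M.D T2} (hE : IsExists E)
    (G : M.D T2) : ∃ k w, Covers G k w := by
  set T := full M
  have hpos : Dfn M fun x => IsPosReal (T.radius x) := hE.dfn_ex (by fun_prop)
  have hd : ∀ x n, lam (M := M) (fun x => lam fun n => sel (IsPosReal (T.radius x)) (T.radius x n)
      (dyad 1 (G (branch x) + G (branch x) + 5))) x n = sel (IsPosReal (T.radius x)) (T.radius x n)
      (dyad 1 (G (branch x) + G (branch x) + 5)) := by
    intro x n
    have hd : Dfn M fun x => Model.lam fun n => Model.sel (IsPosReal (T.radius x)) (T.radius x n)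
        (Model.dyad 1 (G (Model.branch x) + G (Model.branch x) + 5)) :=
      Dfn.lam (Dfn.sel (hpos.comp (g := fun p : M.D T1 × M.D T0 => p.1) (by fun_prop))
        (by fun_prop) (by fun_prop))
    rw [lam_apply hd, lam_apply (by fun_prop)]
  rw [sat_HBU] at h
  generalize lam (M := M) (fun x => lam fun n => sel (IsPosReal (T.radius x)) (T.radius x n)
      (dyad 1 (G (branch x) + G (branch x) + 5))) = Ψ at hd
  have h₁ : ∀ x, IsPosReal (T.radius x) → Ψ x = T.radius x := fun x hx =>
    M.ext fun n => by rw [hd, sel_pos hx]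
  have h₂ : ∀ x, ¬ IsPosReal (T.radius x) → ∀ n,
      ap (Ψ x) n = eps (G (branch x) + G (branch x) + 5) := fun x hx n => by
    rw [ap, hd, sel_neg hx, val_dyad, cast_one, one_mul]
  have h₃ : ∀ x, IsReal x → IsReal (Ψ x) := by
    intro x hx
    by_cases hp : IsPosReal (T.radius x)
    · rw [h₁ x hp]
      exact T.isReal_radius hx
    · intro n i
      rw [h₂ x hp, h₂ x hp, sub_self, abs_zero]
      exact eps_pos n
  have h₄ : PosRealFunction Ψ := by
    refine ⟨fun x hx => ⟨h₃ x hx, ?_⟩, fun x y hx hy hxy => ?_⟩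
    · by_cases hp : IsPosReal (T.radius x)
      · rwa [h₁ x hp]
      · refine ⟨G (branch x) + G (branch x) + 7, ?_⟩
        have hp₂ := eps_pos (G (branch x) + G (branch x))
        rw [h₂ x hp, eps_add_ofNat, eps_add_ofNat]
        norm_num
        linarith
    · have hxy' := T.eqReal_radius hxy
      by_cases hp : IsPosReal (T.radius x)
      · rw [h₁ x hp, h₁ y (hxy'.isPosReal (T.isReal_radius hx) hp)]
        exact hxy'
      · have hp' : ¬ IsPosReal (T.radius y) := fun hpos =>
          hp (hxy'.symm.isPosReal (T.isReal_radius hy) hpos)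
        intro n
        rw [h₂ x hp, h₂ y hp', branch_congr hx hy hxy hp, sub_self, abs_zero]
        have := eps_pos n
        linarith
  obtain ⟨k, w, hw, hcov⟩ := h Ψ h₄
  have e : ∀ i, lam (M := M) (fun i => branch (w i)) i = branch (w i) := lam_apply (by fun_prop)
  refine ⟨k, lam fun i => branch (w i), fun g hg => ?_⟩
  obtain ⟨i, hi, hball⟩ := hcov _ (isReal_quatReal hg) (inUnit_quatReal hg)
  have hy := hw i hi
  refine ⟨i, hi, ?_⟩
  rw [e]
  generalize w i = y at hball hy
  by_cases hp : IsPosReal (T.radius y)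
  · rw [h₁ y hp] at hball
    obtain ⟨N, hN⟩ := hp
    obtain ⟨m, -, hm⟩ := T.exists_not_mem hg hy hN hball
    -- No sequence leaves the full set, so a centre with positive radius covers no embedded
    -- sequence.
    exact absurd trivial hm
  · obtain ⟨N, hN⟩ := hball.exists_forall (isReal_quatReal hg) hy (h₃ y hy)
    have h₄ := h₂ y hp
    obtain ⟨-, h₅, h₆⟩ := branch_spec hy hp (G (branch y))
    generalize G (branch y) = m at h₄ h₅ h₆ ⊢
    have hm : m ≤ m + m + 6 + N := by
      rw [add_assoc, add_assoc]
      exact le_self_add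
    obtain ⟨j, hj⟩ := exists_add_of_le hm
    have h₇ := abs_lt.1 (hN (m + m + 6 + N) le_add_self)
    have h₈ := abs_lt.1 (hy (m + m + 6) N)
    have h₉ := quatReal_bounds hg m j
    have hp₁ := eps_pos (m + j + (m + j))
    have hp₂ := eps_pos (m + m)
    rw [← hj] at h₉ hp₁
    rw [h₄, eps_add_ofNat] at h₇
    rw [eps_add_ofNat] at h₈
    norm_num at h₇ h₈
    rw [ap_quatReal g m] at h₉
    -- In units of `eps (m + m)`, the radius is `1 / 32` and changing the index of `y` costs at most
    -- `1 / 64`. With the widths of the nodes, the two digit values differ by less than one, hence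
    -- are equal.
    refine agree_of_digits_eq (b := 4) (by norm_num) hg (bin_branch y) (le_antisymm
      (lt_of_cast_lt_add_one ?_) (lt_of_cast_lt_add_one ?_))
    · refine lt_of_mul_lt_mul_right ?_ hp₂.le
      linarith
    · refine lt_of_mul_lt_mul_right ?_ hp₂.le
      linarith

/-- The least number principle. -/
theorem exists_least {P : M.D T0 → Prop} (hP : Dfn M P) {n : M.D T0} (hn : P n) :
    ∃ m, P m ∧ ∀ i, i < m → ¬ P i := by
  by_contra! hno
  have hd : Dfn M fun m => ∀ i, i < m → ¬ P i := Dfn.ballLt (by fun_prop) (hP.comp .snd).not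
  have := induct hd (fun i hi => absurd hi (not_lt.2 (zero_le' i))) (fun m ih i hi hPi => ?_) (n + 1)
  · exact this n (lt_add_one' n) hn
  · rcases (lt_add_one_iff'.1 hi).lt_or_eq with h | rfl
    · exact ih i h hPi
    · obtain ⟨j, hj, hj'⟩ := hno i hPi
      exact ih j hj hj'

/-- A discontinuous functional of type `2` computes `∃²`. -/
theorem exists_isExists (hc : M.Choice T0 T1) {G : M.D T2} {f : M.D T1}
    (h : ∀ n, ∃ g, Agree f g n ∧ G g ≠ G f) : ∃ E : M.D T2, IsExists E := by
  obtain ⟨Y, hY⟩ := hc.exists_functional (P := fun n g => Agree f g n ∧ ¬ G g = G f)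
    (by fun_prop) h
  have hz : Dfn M fun v : (M.D T1 × M.D T0) => ∃ j, j < v.2 + 1 ∧ v.1 j = 0 :=
    Dfn.bexLt (by fun_prop) (by fun_prop)
  obtain ⟨l, hl, hl'⟩ := exists_dfn_choice (M := M)
    (P := fun (v : M.D T1 × M.D T0) (j : M.D T0) =>
      (∃ i, i < v.2 + 1 ∧ v.1 i = 0) → v.1 j = 0 ∧ ∀ i, i < j → ¬ v.1 i = 0)
    (Dfn.imp (hz.comp .fst) (Dfn.and (by fun_prop) (Dfn.ballLt (by fun_prop) (by fun_prop))))
    fun v => by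
      by_cases hv : ∃ i, i < v.2 + 1 ∧ v.1 i = 0
      · obtain ⟨i, -, hi⟩ := hv
        obtain ⟨j, hj⟩ := exists_least (P := fun i => v.1 i = 0) (by fun_prop) hi
        exact ⟨j, fun _ => hj⟩
      · exact ⟨0, fun h => absurd h hv⟩
  -- Grilliot's trick. The sequence made from `a` copies `f` until a zero of `a` has appeared, then
  -- `Y` at the least zero. It equals `f` if `a` has no zero and `Y j` if `j` is the least one, as
  -- `f` and `Y j` agree below `j`; so `G` tells the two cases apart.
  have hdH : Dfn M fun v : M.D T1 × M.D T0 =>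
      sel (∃ j, j < v.2 + 1 ∧ v.1 j = 0) (Y (l v) v.2) (f v.2) := by fun_prop
  have hH : ∀ a i, lam (M := M) (fun i => sel (∃ j, j < i + 1 ∧ a j = 0) (Y (l (a, i)) i) (f i)) i =
      sel (∃ j, j < i + 1 ∧ a j = 0) (Y (l (a, i)) i) (f i) := fun a i =>
    lam_apply (hdH.comp (g := fun i => (a, i)) (by fun_prop)) i
  have hE : Dfn M fun a => (chi (¬ G (lam (M := M) (fun i => sel (∃ j, j < i + 1 ∧ a j = 0)
      (Y (l (a, i)) i) (f i))) = G f) : M.D T0) :=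
    (Dfn.not (Dfn.eq (Dfn.app (.const G) (Dfn.lam hdH)) (by fun_prop))).chi
  refine ⟨lam fun a => chi (¬ G (lam (M := M) (fun i => sel (∃ j, j < i + 1 ∧ a j = 0)
      (Y (l (a, i)) i) (f i))) = G f), fun a => ?_⟩
  rw [lam_apply hE, chi_eq_zero]
  constructor
  · intro hne
    by_contra hno
    refine hne (congrArg G (M.ext fun i => ?_))
    rw [hH, sel_neg fun ⟨j, _, hj⟩ => hno ⟨j, hj⟩]
  · rintro ⟨n, hn⟩
    obtain ⟨j, hj, hj'⟩ := exists_least (P := fun i => a i = 0) (by fun_prop) hn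
    have e : lam (M := M) (fun i => sel (∃ j, j < i + 1 ∧ a j = 0) (Y (l (a, i)) i) (f i)) = Y j := by
      refine M.ext fun i => ?_
      rw [hH]
      by_cases hi : ∃ j, j < i + 1 ∧ a j = 0
      · obtain ⟨h₁, h₂⟩ := hl' (a, i) hi
        have : l (a, i) = j := le_antisymm (not_lt.1 fun h => h₂ j h hj)
          (not_lt.1 fun h => hj' _ h h₁)
        rw [sel_pos hi, this]
      · rw [sel_neg hi]
        refine (hY j).1 i ?_
        by_contra hle
        exact hi ⟨j, lt_add_one_iff'.2 (not_lt.1 hle), hj⟩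
    rw [e]
    exact (hY j).2

/-- The first `m` entries of `f`, continued by `0`. -/
noncomputable def trunc (f : M.D T1) (m : M.D T0) : M.D T1 := lam fun i => sel (i < m) (f i) 0

section
variable {X : Type} [Obj M X]

@[fun_prop] theorem Dfn.trunc {f : X → M.D T1} {m : X → M.D T0} (hf : Dfn M f) (hm : Dfn M m) :
    Dfn M fun x => trunc (f x) (m x) := by
  unfold Model.trunc
  fun_prop

end

theorem trunc_apply (f : M.D T1) (m i : M.D T0) : trunc f m i = sel (i < m) (f i) 0 :=
  lam_apply (by fun_prop) i

theorem agree_trunc (f : M.D T1) (m : M.D T0) : Agree f (trunc f m) m := fun i hi => by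
  rw [trunc_apply, sel_pos hi]

theorem Agree.trunc_eq {f g : M.D T1} {m : M.D T0} (h : Agree f g m) : trunc f m = trunc g m := by
  refine M.ext fun i => ?_
  rw [trunc_apply, trunc_apply]
  by_cases hi : i < m
  · rw [sel_pos hi, sel_pos hi, h i hi]
  · rw [sel_neg hi, sel_neg hi]

theorem Bin.trunc {f : M.D T1} (h : Bin f) (m : M.D T0) : Bin (trunc f m) := by
  intro i
  rw [trunc_apply]
  by_cases hi : i < m
  · rw [sel_pos hi]
    exact h i
  · rw [sel_neg hi]
    exact zero_le' 1

/-- The finite sequences that are too short to lie in the neighbourhood given by `G`. -/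
noncomputable def BinTree.short (G : M.D T2) : M.BinTree where
  mem f m := m < G (Model.trunc f m)
  dfn := by fun_prop
  congr h h' := by rwa [← h.trunc_eq]

/-- By continuity at a branch, `G` of a long truncation equals `G` of the branch, so no branch stays
in `short G` and the radius is positive at every real. Each sequence lies in one of finitely many
balls and leaves `short G` below the index belonging to that ball; the truncation at the point of
leaving is a centre whose neighbourhood has bounded length. -/
theorem exists_covers_of_continuous (hc : M.Choice T0 T1) (h : HBU.Sat M.toStr Env.nil) {G : M.D T2}
    (hG : ∀ f, ∃ n, ∀ g, Agree f g n → G g = G f) : ∃ k w, Covers G k w := by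
  set T := short G
  rw [sat_HBU] at h
  have hpos : ∀ x, IsReal x → IsPosReal (T.radius x) := by
    intro x hx
    by_contra hp
    obtain ⟨n, hn⟩ := hG (branch x)
    obtain ⟨hm, -⟩ := branch_spec hx hp (n + G (branch x))
    have hm : n + G (branch x) < G (trunc (branch x) (n + G (branch x))) := hm
    rw [hn _ ((agree_trunc _ _).mono le_self_add)] at hm
    exact absurd hm (not_lt.2 le_add_self)
  have e : ∀ x, lam (M := M) (fun x => T.radius x) x = T.radius x := lam_apply (by fun_prop)
  obtain ⟨k, w, hw, hcov⟩ := h (lam fun x => T.radius x)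
    ⟨fun x hx => by rw [e]; exact ⟨T.isReal_radius hx, hpos x hx⟩,
      fun x y _ _ hxy => by rw [e, e]; exact T.eqReal_radius hxy⟩
  -- Positivity is known only for the reals `w i` with `i < k`, so the condition is made vacuous for
  -- other indices.
  obtain ⟨N, hN, hN'⟩ := exists_dfn_choice (M := M)
    (P := fun i n => i < k → 2 * eps n < ap (T.radius (w i)) n)
    (Dfn.imp (by fun_prop) (by fun_prop)) fun i => by
      by_cases hi : i < k
      · obtain ⟨n, hn⟩ := hpos _ (hw i hi)
        exact ⟨n, fun _ => hn⟩
      · exact ⟨0, fun h => absurd h hi⟩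
  refine exists_covers hc (N := sum N k) fun g hg => ?_
  obtain ⟨i, hi, hball⟩ := hcov _ (isReal_quatReal hg) (inUnit_quatReal hg)
  rw [e] at hball
  obtain ⟨m, hm, hgm⟩ := T.exists_not_mem hg (hw i hi) (hN' i hi) hball
  have hgm : G (trunc g m) ≤ m := not_lt.1 hgm
  exact ⟨trunc g m, hg.trunc m, ((agree_trunc g m).mono hgm).symm,
    hgm.trans (hm.le.trans (le_sum hN hi))⟩

/-- Either `∃²` exists, or every functional of type `2`, in particular `G`, is continuous. The
classical case distinction takes place in each model separately. -/
theorem HBUc_of_HBU (hc : M.Choice T0 T1) (h : HBU.Sat M.toStr Env.nil) :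
    HBUc.Sat M.toStr Env.nil := by
  rw [sat_HBUc]
  intro G
  by_cases hE : ∃ E : M.D T2, IsExists E
  · obtain ⟨E, hE⟩ := hE
    exact exists_covers_of_isExists h hE G
  · refine exists_covers_of_continuous hc h fun f => ?_
    by_contra! hno
    exact hE (exists_isExists hc hno)

end Model

/-- A sentence that holds in all models of choice is provable. -/
theorem proves_of_choice {T : Set Sentence} (hT : RCA ⊆ T) {σ τ : Ty} {ψ : Sentence}
    (h : ∀ M : Model, M.Choice σ τ → ψ.Sat M.toStr Env.nil) : T ∪ QFAC σ τ ⊢ᶠ ψ :=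
  proves_of_models (hT.trans Set.subset_union_left) fun M hM =>
    h M (Model.choice_of_sat fun φ hφ => hM φ (Or.inr hφ))

end HOA

/-! ### The equivalences, assembled from the implications in models. -/

open HOA HOA.Model

theorem mainTheorem8 :
    ((HOA.RCA ∪ HOA.QFAC HOA.T0 HOA.T1) ⊢ᶠ HOA.PITu ↔ᶠ HOA.HBUc) ∧
    ((HOA.RCA ∪ HOA.QFAC HOA.T0 HOA.T1) ⊢ᶠ HOA.HBUc ↔ᶠ HOA.HBU) ∧
    ((HOA.ACA ∪ HOA.QFAC HOA.T2 HOA.T1) ⊢ᶠ HOA.HBUc ↔ᶠ HOA.HBU) ∧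
    ((HOA.ACA ∪ HOA.QFAC HOA.T2 HOA.T1) ⊢ᶠ HOA.HBU ↔ᶠ HOA.existsSCF) ∧
    ((HOA.ACA ∪ HOA.QFAC HOA.T2 HOA.T1) ⊢ᶠ HOA.existsSCF ↔ᶠ HOA.PITu) ∧
    ((HOA.ACA ∪ HOA.QFAC HOA.T2 HOA.T1) ⊢ᶠ HOA.PITu ↔ᶠ HOA.existsPR) := by
  have hRCA {ψ : Sentence} := proves_of_choice (σ := HOA.T0) (τ := HOA.T1) (ψ := ψ) subset_rfl
  have hACA {ψ : Sentence} := proves_of_choice (T := ACA) (σ := HOA.T2) (τ := HOA.T1) (ψ := ψ)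
    Set.subset_union_left
  refine ⟨hRCA fun M hc => ?_, hRCA fun M hc => ?_, hACA fun M hc => ?_, hACA fun M hc => ?_,
    hACA fun M hc => ?_, hACA fun M hc => ?_⟩ <;> rw [sat_iff]
  · exact ⟨HBUc_of_PITu hc, PITu_of_HBUc⟩
  · exact ⟨HBU_of_HBUc, HBUc_of_HBU hc⟩
  · exact ⟨HBU_of_HBUc, HBUc_of_HBU hc.zero_one⟩
  · exact ⟨fun h => existsSCF_of_HBUc hc (HBUc_of_HBU hc.zero_one h),
      fun h => HBU_of_HBUc (HBUc_of_existsSCF h)⟩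
  · exact ⟨fun h => PITu_of_HBUc (HBUc_of_existsSCF h),
      fun h => existsSCF_of_HBUc hc (HBUc_of_PITu hc.zero_one h)⟩
  · exact ⟨fun h => existsPR_of_existsSCF (existsSCF_of_HBUc hc (HBUc_of_PITu hc.zero_one h)),
      PITu_of_existsPR⟩
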